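/- \textbf{Setting.} All gradings are by $RO(\mathbb{Z}/2)=\mathbb{Z}\oplus\mathbb{Z}\alpha$. Let $H=H\underline{\mathbb{F}}_{\star}$ be the coefficient ring of $\mathbb{Z}/2$-equivariant homology with coefficients in the constant Mackey functor $\mathbb{F}_2$, that is, the graded commutative ring $$H=\mathbb{F}_2[a,u]\oplus\mathbb{F}_2\{\theta_{i,j}\mid i,j\ge 0\},\qquad |a|=-\alpha,\quad |u|=1-\alpha,\quad |\theta_{i,j}|=-(2+j)+(2+i+j)\alpha,$$ with $u=\sigma^{-1}$, $a\theta_{i+1,j}=\theta_{i,j}$, $a\theta_{0,j}=0$, $u\theta_{i,j+1}=\theta_{i,j}$, $u\theta_{i,0}=0$, and zero product of any two of the $\theta_{i,j}$ (so $\theta_{i,j}=\theta/(a^iu^j)$). Let $$\mathcal{A}_{\star}=H[\xi_{i+1},\tau_i\mid i\ge 0]/\bigl(\tau_i^2=a\tau_{i+1}+(u+a\tau_0)\xi_{i+1}\bigr),\qquad |\xi_n|=(2^n-1)(1+\alpha),\quad |\tau_n|=(2^n-1)(1+\alpha)+1,$$ be the equivariant dual Steenrod algebra. The pair $(H,\mathcal{A}_\star)$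 is a graded Hopf algebroid: the left unit is the structure map $H\to\mathcal{A}_\star$; the right unit is given by $\eta_R(a)=a$, $\eta_R(u)=u+a\tau_0$ and $\eta_R(\theta_{i,j})=\sum_{k=0}^{i}\binom{j+k}{k}\theta_{i-k,j+k}\tau_0^k$; the coproduct is given by $\Delta\xi_n=\sum_{i+j=n}\xi_i^{2^j}\otimes\xi_j$ and $\Delta\tau_n=\sum_{i+j=n}\xi_i^{2^j}\otimes\tau_j+\tau_n\otimes 1$, where $\xi_0=1$; the counit sends $\xi_n$ ($n\ge1$) and $\tau_n$ ($n\geq 0$) to $0$; and the antipode $c$, which exchanges the two units, is determined by $\sum_{i+j=n}\xi_i^{2^j}c(\xi_j)=0$ for $n\ge 1$ and $c(\tau_n)=\sum_{i+j=n}c(\xi_i)^{2^j}\tau_j$. Tensor products $M\otimes_H N$ are formed with the right unit on the left factor and the left unit on the right factor. A \emph{profile function} is a pair of maps $h:\mathbb{N}\setminus\{0\}\to\mathbb{N}\cup\{\infty\}$ and $k:\mathbb{N}\to\mathbb{N}\cup\{\infty\}$; profile functions are ordered pointwise. Let $I(h,k)\subseteq\mathcal{A}_\star$ be the ideal generated by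 all $\xi_i^{2^{h(i)}}$ ($i\ge 1$) and $\tau_i^{2^{k(i)}}$ ($i\ge 0$), with the convention $x^{\infty}=0$. The pair $(h,k)$ \emph{defines a quotient Hopf algebroid} if $I=I(h,k)$ is a Hopf algebroid ideal: $I$ is homogeneous, $\varepsilon(I)=0$, $\Delta(I)\subseteq I\otimes\mathcal{A}_\star+\mathcal{A}_\star\otimes I$ (the sum of the images in $\mathcal{A}_\star\otimes_H\mathcal{A}_\star$), and $c(I)\subseteq I$; then $(H,\mathcal{A}_\star/I)$ carries the induced graded Hopf algebroid structure. \textbf{Theorem.} Let $(h_B,k_B)\ge(h_C,k_C)$ be profile functions that define quotient Hopf algebroids $B=\mathcal{A}_\star/I(h_B,k_B)$ and $C=\mathcal{A}_\star/I(h_C,k_C)$ of $(H,\mathcal{A}_\star)$, and suppose that $B$ and $C$ are free graded (left) $H$-modules, i.e. have bases of homogeneous elements. Then there is a surjective morphism $\pi:B\to C$ of graded Hopf algebroids over $H$, compatible with the projections from $\mathcal{A}_\star$, and the induced left $C$-comodule structure $$(\pi\otimes\mathrm{id})\circ\Delta:B\to C\otimes_H B$$ on $B$ is cofree: there are a graded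 set $S$ and a degree-preserving isomorphism of $C$-comodules $B\cong C\otimes_H H\{S\}$, where $H\{S\}$ is the free graded $H$-module on $S$ and $C\otimes_H H\{S\}$ has the coaction $\Delta\otimes\mathrm{id}$. -/

import Mathlib

open scoped TensorProduct

noncomputable section

namespace EquivariantSteenrod

/-! ### `RO(ℤ/2)`-graded rings and the tensor product over `(r, l)` -/

/-- The real representation ring `RO(ℤ/2) = ℤ ⊕ ℤα`; the pair `(p, q)` stands for `p + qα`. -/
abbrev RO : Type := ℤ × ℤ

/-- `𝒶` is an `RO(ℤ/2)`-grading of the commutative ring `A` (all the rings below have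
characteristic two, so that graded commutativity is commutativity). -/
structure IsGrading {A : Type*} [CommRing A] (𝒶 : RO → AddSubgroup A) : Prop where
  one_mem : (1 : A) ∈ 𝒶 0
  mul_mem : ∀ {d e : RO} {x y : A}, x ∈ 𝒶 d → y ∈ 𝒶 e → x * y ∈ 𝒶 (d + e)
  isInternal : DirectSum.IsInternal 𝒶

section Tensor

variable {H A B T : Type*} [CommRing H] [CommRing A] [CommRing B] [CommRing T]

/-- The ring `A`, regarded as an `H`-algebra through the ring map `r : H → A` (which will be the
right unit), whatever other `H`-algebra structure `A` has. -/
def ViaRight (_r : H →+* A) : Type _ := A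

instance (r : H →+* A) : CommRing (ViaRight r) := inferInstanceAs (CommRing A)

instance (r : H →+* A) : Algebra H (ViaRight r) := r.toAlgebra

/-- The identity `A → ViaRight r`. -/
def toRight (r : H →+* A) : A ≃+* ViaRight r := RingEquiv.refl A

theorem algebraMap_viaRight (r : H →+* A) (h : H) :
    algebraMap H (ViaRight r) h = toRight r (r h) := rfl

/-- `A ⊗_{(r,l)} M`: the tensor product over `H` with respect to the right structure `r` on `A`
and the given left structure on `M`, so that `x r(h) ⊗ m = x ⊗ h m`. It is a commutative ring
when `M` is an `H`-algebra. -/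
abbrev RLTensor (r : H →+* A) (M : Type*) [AddCommGroup M] [Module H M] : Type _ :=
  ViaRight r ⊗[H] M

/-- `x ↦ x ⊗ 1`. -/
def inl (r : H →+* A) (B : Type*) [CommRing B] [Algebra H B] : A →+* RLTensor r B :=
  (Algebra.TensorProduct.includeLeftRingHom : ViaRight r →+* RLTensor r B).comp
    (toRight r).toRingHom

/-- `y ↦ 1 ⊗ y`. -/
def inr (r : H →+* A) (B : Type*) [CommRing B] [Algebra H B] : B →+* RLTensor r B :=
  (Algebra.TensorProduct.includeRight : B →ₐ[H] RLTensor r B).toRingHom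

theorem inl_apply [Algebra H B] (r : H →+* A) (x : A) :
    inl r B x = (toRight r x) ⊗ₜ[H] (1 : B) := rfl

theorem inr_apply [Algebra H B] (r : H →+* A) (y : B) :
    inr r B y = (1 : ViaRight r) ⊗ₜ[H] y := rfl

theorem inl_right [Algebra H B] (r : H →+* A) (h : H) :
    inl r B (r h) = inr r B (algebraMap H B h) := by
  rw [inl_apply, inr_apply, ← algebraMap_viaRight, Algebra.algebraMap_eq_smul_one,
    Algebra.algebraMap_eq_smul_one, TensorProduct.smul_tmul]

/-- The ring map `A ⊗_{(r,l)} B → T`, `x ⊗ y ↦ f x * g y`, for ring maps `f`, `g` that agree on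
`H`. -/
def rlLift [Algebra H B] (r : H →+* A) (f : A →+* T) (g : B →+* T)
    (hfg : ∀ h, f (r h) = g (algebraMap H B h)) : RLTensor r B →+* T :=
  letI : Algebra H T := (f.comp r).toAlgebra
  (Algebra.TensorProduct.lift (A := ViaRight r) (R := H) (S := H) (B := B) (C := T)
    ({ f.comp (toRight r).symm.toRingHom with commutes' := fun _ => rfl } : ViaRight r →ₐ[H] T)
    ({ g with commutes' := fun h => (hfg h).symm } : B →ₐ[H] T)
    (fun _ _ => Commute.all _ _)).toRingHom

theorem rlLift_tmul [Algebra H B] (r : H →+* A) (f : A →+* T) (g : B →+* T)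
    (hfg : ∀ h, f (r h) = g (algebraMap H B h)) (x : A) (y : B) :
    rlLift r f g hfg ((toRight r x) ⊗ₜ[H] y) = f x * g y := rfl

theorem rlLift_inl [Algebra H B] (r : H →+* A) (f : A →+* T) (g : B →+* T)
    (hfg : ∀ h, f (r h) = g (algebraMap H B h)) (x : A) :
    rlLift r f g hfg (inl r B x) = f x := by
  rw [inl_apply, rlLift_tmul, map_one, mul_one]

theorem rlLift_inr [Algebra H B] (r : H →+* A) (f : A →+* T) (g : B →+* T)
    (hfg : ∀ h, f (r h) = g (algebraMap H B h)) (y : B) :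
    rlLift r f g hfg (inr r B y) = g y := by
  rw [inr_apply, ← map_one (toRight r), rlLift_tmul, map_one, one_mul]

theorem tmul_eq [Algebra H B] (r : H →+* A) (x : A) (y : B) :
    (toRight r x) ⊗ₜ[H] y = inl r B x * inr r B y := by
  rw [inl_apply, inr_apply, Algebra.TensorProduct.tmul_mul_tmul, mul_one, one_mul]

theorem rl_induction {M : Type*} [AddCommGroup M] [Module H M] {r : H →+* A}
    {p : RLTensor r M → Prop} (zero : p 0) (tmul : ∀ x m, p ((toRight r x) ⊗ₜ[H] m))
    (add : ∀ s t, p s → p t → p (s + t)) (t : RLTensor r M) : p t :=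
  TensorProduct.induction_on t zero (fun x m => tmul ((toRight r).symm x) m)
    (fun s t hs ht => add s t hs ht)

theorem rl_hom_ext [Algebra H B] {r : H →+* A} {f g : RLTensor r B →+* T}
    (h₁ : ∀ x, f (inl r B x) = g (inl r B x)) (h₂ : ∀ y, f (inr r B y) = g (inr r B y)) :
    f = g := by
  refine RingHom.ext fun t => ?_
  induction t using rl_induction with
  | zero => simp
  | add x y hx hy => rw [map_add, map_add, hx, hy]
  | tmul x y => rw [tmul_eq, map_mul, map_mul, h₁, h₂]

/-- The ring map `f ⊗ g`. -/
def rlMap {A' B' : Type*} [CommRing A'] [CommRing B'] [Algebra H B] [Algebra H B']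
    (r : H →+* A) (r' : H →+* A') (f : A →+* A') (hf : ∀ h, f (r h) = r' h) (g : B →ₐ[H] B') :
    RLTensor r B →+* RLTensor r' B' :=
  rlLift r ((inl r' B').comp f) ((inr r' B').comp g.toRingHom)
    (fun h => by simp [hf, inl_right])

theorem rlMap_inl {A' B' : Type*} [CommRing A'] [CommRing B'] [Algebra H B] [Algebra H B']
    (r : H →+* A) (r' : H →+* A') (f : A →+* A') (hf : ∀ h, f (r h) = r' h) (g : B →ₐ[H] B')
    (x : A) : rlMap r r' f hf g (inl r B x) = inl r' B' (f x) := rlLift_inl ..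

theorem rlMap_inr {A' B' : Type*} [CommRing A'] [CommRing B'] [Algebra H B] [Algebra H B']
    (r : H →+* A) (r' : H →+* A') (f : A →+* A') (hf : ∀ h, f (r h) = r' h) (g : B →ₐ[H] B')
    (y : B) : rlMap r r' f hf g (inr r B y) = inr r' B' (g y) := rlLift_inr ..

theorem rlMap_tmul {A' B' : Type*} [CommRing A'] [CommRing B'] [Algebra H B] [Algebra H B']
    (r : H →+* A) (r' : H →+* A') (f : A →+* A') (hf : ∀ h, f (r h) = r' h) (g : B →ₐ[H] B')
    (x : A) (y : B) :
    rlMap r r' f hf g ((toRight r x) ⊗ₜ[H] y) = (toRight r' (f x)) ⊗ₜ[H] (g y) := by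
  rw [tmul_eq, map_mul, rlMap_inl, rlMap_inr, ← tmul_eq]

theorem rlMap_id [Algebra H A] (r : H →+* A)
    (hf : ∀ h, (AlgHom.id H A).toRingHom (r h) = r h) (t : RLTensor r A) :
    rlMap r r (AlgHom.id H A).toRingHom hf (AlgHom.id H A) t = t := by
  induction t using rl_induction with
  | zero => rw [map_zero]
  | tmul x m => rw [rlMap_tmul]; rfl
  | add s t hs ht => rw [map_add, hs, ht]

/-- An additive map out of `A ⊗_{(r,l)} M`. -/
def rlLiftAdd (r : H →+* A) {M P : Type*} [AddCommGroup M] [Module H M] [AddCommGroup P]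
    (g : A →+ M →+ P) (hg : ∀ h x m, g (r h * x) m = g x (h • m)) : RLTensor r M →+ P :=
  TensorProduct.liftAddHom (R := H) (M := ViaRight r) g
    (fun h x m => hg h ((toRight r).symm x) m)

theorem rlLiftAdd_tmul (r : H →+* A) {M P : Type*} [AddCommGroup M] [Module H M]
    [AddCommGroup P] (g : A →+ M →+ P) (hg : ∀ h x m, g (r h * x) m = g x (h • m))
    (x : A) (m : M) : rlLiftAdd r g hg ((toRight r x) ⊗ₜ[H] m) = g x m := rfl

/-- The grading of `A ⊗_{(r,l)} M`: degree `d` is generated by the `x ⊗ m` with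
`|x| + |m| = d`. -/
def tensorDeg (r : H →+* A) {M : Type*} [AddCommGroup M] [Module H M]
    (𝒶 : RO → AddSubgroup A) (ℳ : RO → AddSubgroup M) (d : RO) : AddSubgroup (RLTensor r M) :=
  AddSubgroup.closure
    {t | ∃ i j : RO, i + j = d ∧ ∃ x ∈ 𝒶 i, ∃ m ∈ ℳ j, t = (toRight r x) ⊗ₜ[H] m}

end Tensor

/-! ### `RO(ℤ/2)`-graded Hopf algebroids -/

section HopfAlgebroid

variable {H A : Type*} [CommRing H] [CommRing A] [Algebra H A]

/-- `A ⊗ A ⊗ A` (tensor products over `H` with respect to the right structure on the left factor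
and the left structure on the right factor). -/
abbrev Triple (r : H →+* A) : Type _ := RLTensor ((inr r A).comp r) A

/-- `x ↦ x ⊗ 1 ⊗ 1`. -/
def in₁ (r : H →+* A) : A →+* Triple r := (inl ((inr r A).comp r) A).comp (inl r A)

/-- `x ↦ 1 ⊗ x ⊗ 1`. -/
def in₂ (r : H →+* A) : A →+* Triple r := (inl ((inr r A).comp r) A).comp (inr r A)

/-- `x ↦ 1 ⊗ 1 ⊗ x`. -/
def in₃ (r : H →+* A) : A →+* Triple r := inr ((inr r A).comp r) A

theorem in₁_right (r : H →+* A) (h : H) : in₁ r (r h) = in₂ r (algebraMap H A h) := by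
  simp only [in₁, in₂, RingHom.comp_apply, inl_right]

theorem in₂_right (r : H →+* A) (h : H) : in₂ r (r h) = in₃ r (algebraMap H A h) :=
  inl_right ((inr r A).comp r) h

/-- An `RO(ℤ/2)`-graded Hopf algebroid `(H, A)` with gradings `𝒽` of `H` and `𝒶` of `A`. The left
unit is `algebraMap H A`. -/
structure HopfAlgebroid (𝒽 : RO → AddSubgroup H) (𝒶 : RO → AddSubgroup A) where
  /-- the right unit -/
  etaR : H →+* A
  /-- the coproduct -/
  comul : A →+* RLTensor etaR A
  /-- the counit -/
  counit : A →+* H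
  /-- the antipode -/
  antipode : A →+* A
  grading_base : IsGrading 𝒽
  grading : IsGrading 𝒶
  etaL_mem : ∀ d, ∀ x ∈ 𝒽 d, algebraMap H A x ∈ 𝒶 d
  etaR_mem : ∀ d, ∀ x ∈ 𝒽 d, etaR x ∈ 𝒶 d
  comul_mem : ∀ d, ∀ x ∈ 𝒶 d, comul x ∈ tensorDeg etaR 𝒶 𝒶 d
  counit_mem : ∀ d, ∀ x ∈ 𝒶 d, counit x ∈ 𝒽 d
  antipode_mem : ∀ d, ∀ x ∈ 𝒶 d, antipode x ∈ 𝒶 d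
  comul_etaL : ∀ h, comul (algebraMap H A h) = inl etaR A (algebraMap H A h)
  comul_etaR : ∀ h, comul (etaR h) = inr etaR A (etaR h)
  counit_etaL : ∀ h, counit (algebraMap H A h) = h
  counit_etaR : ∀ h, counit (etaR h) = h
  /-- `(id ⊗ ε) ∘ Δ = id` -/
  id_counit : ∀ x, rlLift etaR (RingHom.id A) (etaR.comp counit)
    (fun h => by simp [counit_etaL]) (comul x) = x
  /-- `(ε ⊗ id) ∘ Δ = id` -/
  counit_id : ∀ x, rlLift etaR ((algebraMap H A).comp counit) (RingHom.id A)
    (fun h => by simp [counit_etaR]) (comul x) = x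
  /-- `(Δ ⊗ id) ∘ Δ = (id ⊗ Δ) ∘ Δ` -/
  coassoc : ∀ x,
    rlLift etaR ((rlLift etaR (in₁ etaR) (in₂ etaR) (in₁_right etaR)).comp comul) (in₃ etaR)
      (fun h => by simp [comul_etaR, rlLift_inr, in₂_right]) (comul x) =
    rlLift etaR (in₁ etaR) ((rlLift etaR (in₂ etaR) (in₃ etaR) (in₂_right etaR)).comp comul)
      (fun h => by simp [comul_etaL, rlLift_inl, in₁_right]) (comul x)
  antipode_etaL : ∀ h, antipode (algebraMap H A h) = etaR h
  antipode_etaR : ∀ h, antipode (etaR h) = algebraMap H A h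
  antipode_antipode : ∀ x, antipode (antipode x) = x
  /-- `μ ∘ (c ⊗ id) ∘ Δ = η_R ∘ ε` -/
  antipode_id : ∀ x, rlLift etaR antipode (RingHom.id A)
    (fun h => by simp [antipode_etaR]) (comul x) = etaR (counit x)
  /-- `μ ∘ (id ⊗ c) ∘ Δ = η_L ∘ ε` -/
  id_antipode : ∀ x, rlLift etaR (RingHom.id A) antipode
    (fun h => by simp [antipode_etaL]) (comul x) = algebraMap H A (counit x)


/-- The grading induced on a quotient ring. -/
def quotDeg (𝒶 : RO → AddSubgroup A) (I : Ideal A) (d : RO) : AddSubgroup (A ⧸ I) :=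
  (𝒶 d).map (Ideal.Quotient.mk I : A →+ A ⧸ I)

theorem mk_mem_quotDeg {𝒶 : RO → AddSubgroup A} (I : Ideal A) {d : RO} {x : A} (hx : x ∈ 𝒶 d) :
    Ideal.Quotient.mk I x ∈ quotDeg 𝒶 I d := ⟨x, hx, rfl⟩

/-- A morphism of `RO(ℤ/2)`-graded Hopf algebroids `(H, B) → (H, C)` that is the identity on
`H`. -/
structure HopfAlgebroid.Hom {B C : Type*} [CommRing B] [CommRing C] [Algebra H B] [Algebra H C]
    {𝒽 : RO → AddSubgroup H} {𝒷 : RO → AddSubgroup B} {𝒸 : RO → AddSubgroup C}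
    (𝓑 : HopfAlgebroid 𝒽 𝒷) (𝓒 : HopfAlgebroid 𝒽 𝒸) where
  /-- the underlying map, which respects the left units -/
  toAlgHom : B →ₐ[H] C
  map_mem : ∀ d, ∀ x ∈ 𝒷 d, toAlgHom x ∈ 𝒸 d
  map_etaR : ∀ h, toAlgHom (𝓑.etaR h) = 𝓒.etaR h
  map_comul : ∀ x, 𝓒.comul (toAlgHom x) =
    rlMap 𝓑.etaR 𝓒.etaR toAlgHom.toRingHom map_etaR toAlgHom (𝓑.comul x)
  map_counit : ∀ x, 𝓒.counit (toAlgHom x) = 𝓑.counit x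
  map_antipode : ∀ x, 𝓒.antipode (toAlgHom x) = toAlgHom (𝓑.antipode x)

variable {𝒽 : RO → AddSubgroup H} {𝒶 : RO → AddSubgroup A}

/-- `I` is an `RO(ℤ/2)`-graded Hopf algebroid ideal: a homogeneous ideal with `ε(I) = 0`,
`Δ(I) ⊆ I ⊗ A + A ⊗ I` and `c(I) ⊆ I`. -/
structure HopfAlgebroid.IsHopfIdeal (𝓐 : HopfAlgebroid 𝒽 𝒶) (I : Ideal A) : Prop where
  homogeneous : ∀ x ∈ I, x ∈ AddSubgroup.closure {y | y ∈ I ∧ ∃ d, y ∈ 𝒶 d}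
  counit_eq_zero : ∀ x ∈ I, 𝓐.counit x = 0
  comul_mem : ∀ x ∈ I, 𝓐.comul x ∈ I.map (inl 𝓐.etaR A) ⊔ I.map (inr 𝓐.etaR A)
  antipode_mem : ∀ x ∈ I, 𝓐.antipode x ∈ I

theorem isInternal_of_components {A : Type*} [AddCommGroup A] {𝒶 : RO → AddSubgroup A}
    (p : RO → A →+ A) (hp : ∀ d, ∀ x ∈ 𝒶 d, p d x = x)
    (hp' : ∀ d e, d ≠ e → ∀ x ∈ 𝒶 d, p e x = 0)
    (htop : ∀ x : A, x ∈ AddSubgroup.closure {y | ∃ d, y ∈ 𝒶 d}) :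
    DirectSum.IsInternal 𝒶 := by
  have key : ∀ (v : DirectSum RO fun d => 𝒶 d) (e : RO),
      p e (DirectSum.coeAddMonoidHom 𝒶 v) = v e := by
    intro v e
    induction v using DirectSum.induction_on with
    | zero => simp
    | add x y hx hy => simp [hx, hy]
    | of d x =>
      rw [DirectSum.coeAddMonoidHom_of]
      by_cases h : d = e
      · subst h
        rw [hp d x x.2, DirectSum.of_eq_same]
      · rw [hp' d e h x x.2, DirectSum.of_eq_of_ne _ _ _ (Ne.symm h)]
        rfl
  constructor
  · intro v w hvw
    refine DFinsupp.ext fun e => Subtype.ext ?_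
    rw [← key v e, ← key w e]
    exact congrArg _ hvw
  · intro x
    have hx := htop x
    induction hx using AddSubgroup.closure_induction with
    | mem x hx =>
      obtain ⟨d, hd⟩ := hx
      exact ⟨DirectSum.of (fun d => 𝒶 d) d ⟨x, hd⟩, DirectSum.coeAddMonoidHom_of ..⟩
    | zero => exact ⟨0, map_zero _⟩
    | add x y _ _ hx hy =>
      obtain ⟨v, rfl⟩ := hx
      obtain ⟨w, rfl⟩ := hy
      exact ⟨v + w, map_add _ _ _⟩
    | neg x _ hx =>
      obtain ⟨v, rfl⟩ := hx
      exact ⟨-v, map_neg _ _⟩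

theorem exists_components {A : Type*} [AddCommGroup A] {𝒶 : RO → AddSubgroup A}
    (h : DirectSum.IsInternal 𝒶) :
    ∃ p : RO → A →+ A, (∀ d, ∀ x ∈ 𝒶 d, p d x = x) ∧
      (∀ d e, d ≠ e → ∀ x ∈ 𝒶 d, p e x = 0) ∧
      (∀ x : A, x ∈ AddSubgroup.closure {y | ∃ d, y ∈ 𝒶 d}) := by
  let φ := AddEquiv.ofBijective (DirectSum.coeAddMonoidHom 𝒶) h
  have hφ : ∀ d (x : A) (hx : x ∈ 𝒶 d), φ.symm x = DirectSum.of (fun d => 𝒶 d) d ⟨x, hx⟩ := by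
    intro d x hx
    rw [AddEquiv.symm_apply_eq]
    exact (DirectSum.coeAddMonoidHom_of 𝒶 d ⟨x, hx⟩).symm
  refine ⟨fun e => AddMonoidHom.mk' (fun x => ((φ.symm x) e : A)) (by intros; simp), ?_, ?_, ?_⟩
  · intro d x hx
    simp [hφ d x hx]
  · intro d e hde x hx
    simp [hφ d x hx, DirectSum.of_eq_of_ne _ _ _ (Ne.symm hde)]
  · intro x
    obtain ⟨v, rfl⟩ := φ.surjective x
    induction v using DirectSum.induction_on with
    | zero => simp
    | add x y hx hy => rw [map_add]; exact add_mem hx hy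
    | of d x =>
      refine AddSubgroup.subset_closure ⟨d, ?_⟩
      have : φ (DirectSum.of (fun d => 𝒶 d) d x) = x := DirectSum.coeAddMonoidHom_of 𝒶 d x
      rw [this]
      exact x.2

theorem isGrading_quotDeg (h𝒶 : IsGrading 𝒶) {I : Ideal A}
    (hI : ∀ x ∈ I, x ∈ AddSubgroup.closure {y | y ∈ I ∧ ∃ d, y ∈ 𝒶 d}) :
    IsGrading (quotDeg 𝒶 I) where
  one_mem := ⟨1, h𝒶.one_mem, rfl⟩
  mul_mem := by
    rintro d e _ _ ⟨x, hx, rfl⟩ ⟨y, hy, rfl⟩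
    exact ⟨x * y, h𝒶.mul_mem hx hy, rfl⟩
  isInternal := by
    obtain ⟨p, h₁, h₂, h₃⟩ := exists_components h𝒶.isInternal
    have hpI : ∀ d, ∀ x ∈ I, p d x ∈ I := by
      intro d x hx
      have hx' := hI x hx
      clear hx
      induction hx' using AddSubgroup.closure_induction with
      | mem x hx =>
        obtain ⟨hx, e, he⟩ := hx
        by_cases hde : e = d
        · subst hde
          rwa [h₁ _ _ he]
        · rw [h₂ _ _ hde _ he]
          exact zero_mem _
      | zero => simp
      | add x y _ _ hx hy => rw [map_add]; exact add_mem hx hy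
      | neg x _ hx => rw [map_neg]; exact neg_mem hx
    refine isInternal_of_components
      (fun d => QuotientAddGroup.map I.toAddSubgroup I.toAddSubgroup (p d) (hpI d)) ?_ ?_ ?_
    · rintro d _ ⟨x, hx, rfl⟩
      exact congrArg (Ideal.Quotient.mk I) (h₁ d x hx)
    · rintro d e hde _ ⟨x, hx, rfl⟩
      exact (congrArg (Ideal.Quotient.mk I) (h₂ d e hde x hx)).trans (map_zero _)
    · intro x
      obtain ⟨x, rfl⟩ := Ideal.Quotient.mk_surjective x
      have hx := h₃ x
      induction hx using AddSubgroup.closure_induction with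
      | mem x hx =>
        obtain ⟨d, hd⟩ := hx
        exact AddSubgroup.subset_closure ⟨d, mk_mem_quotDeg I hd⟩
      | zero => rw [map_zero]; exact zero_mem _
      | add x y _ _ hx hy => rw [map_add]; exact add_mem hx hy
      | neg x _ hx => rw [map_neg]; exact neg_mem hx

theorem map_tensorDeg {B : Type*} [CommRing B] [Algebra H B] {𝒷 : RO → AddSubgroup B}
    (r : H →+* A) (r' : H →+* B) (f : A →ₐ[H] B) (hf : ∀ h, f (r h) = r' h)
    (hdeg : ∀ d, ∀ x ∈ 𝒶 d, f x ∈ 𝒷 d) {d : RO} {t : RLTensor r A}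
    (ht : t ∈ tensorDeg r 𝒶 𝒶 d) :
    rlMap r r' f.toRingHom hf f t ∈ tensorDeg r' 𝒷 𝒷 d := by
  induction ht using AddSubgroup.closure_induction with
  | mem t ht =>
    obtain ⟨i, j, hij, x, hx, y, hy, rfl⟩ := ht
    rw [rlMap_tmul]
    exact AddSubgroup.subset_closure ⟨i, j, hij, f x, hdeg _ _ hx, f y, hdeg _ _ hy, rfl⟩
  | zero => rw [map_zero]; exact zero_mem _
  | add x y _ _ hx hy => rw [map_add]; exact add_mem hx hy
  | neg x _ hx => rw [map_neg]; exact neg_mem hx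

/-- The right unit of the quotient. -/
def HopfAlgebroid.quotEtaR (𝓐 : HopfAlgebroid 𝒽 𝒶) (I : Ideal A) : H →+* A ⧸ I :=
  (Ideal.Quotient.mk I).comp 𝓐.etaR

theorem HopfAlgebroid.mk_etaR (𝓐 : HopfAlgebroid 𝒽 𝒶) (I : Ideal A) (h : H) :
    (Ideal.Quotient.mkₐ H I).toRingHom (𝓐.etaR h) = 𝓐.quotEtaR I h := rfl

/-- The map `A ⊗ A → A/I ⊗ A/I`. -/
def HopfAlgebroid.quotTensor (𝓐 : HopfAlgebroid 𝒽 𝒶) (I : Ideal A) :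
    RLTensor 𝓐.etaR A →+* RLTensor (𝓐.quotEtaR I) (A ⧸ I) :=
  rlMap 𝓐.etaR (𝓐.quotEtaR I) (Ideal.Quotient.mkₐ H I).toRingHom (𝓐.mk_etaR I)
    (Ideal.Quotient.mkₐ H I)

theorem HopfAlgebroid.quotTensor_inl (𝓐 : HopfAlgebroid 𝒽 𝒶) (I : Ideal A) (x : A) :
    𝓐.quotTensor I (inl 𝓐.etaR A x) = inl (𝓐.quotEtaR I) (A ⧸ I) (Ideal.Quotient.mk I x) :=
  rlMap_inl ..

theorem HopfAlgebroid.quotTensor_inr (𝓐 : HopfAlgebroid 𝒽 𝒶) (I : Ideal A) (x : A) :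
    𝓐.quotTensor I (inr 𝓐.etaR A x) = inr (𝓐.quotEtaR I) (A ⧸ I) (Ideal.Quotient.mk I x) :=
  rlMap_inr ..

/-- The coproduct of the quotient. -/
def HopfAlgebroid.quotComul (𝓐 : HopfAlgebroid 𝒽 𝒶) (I : Ideal A) (hI : 𝓐.IsHopfIdeal I) :
    A ⧸ I →+* RLTensor (𝓐.quotEtaR I) (A ⧸ I) :=
  Ideal.Quotient.lift I ((𝓐.quotTensor I).comp 𝓐.comul) (by
    intro x hx
    have h : I.map (inl 𝓐.etaR A) ⊔ I.map (inr 𝓐.etaR A) ≤ RingHom.ker (𝓐.quotTensor I) := by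
      refine sup_le (Ideal.map_le_iff_le_comap.2 ?_) (Ideal.map_le_iff_le_comap.2 ?_)
      · intro y hy
        rw [Ideal.mem_comap, RingHom.mem_ker, HopfAlgebroid.quotTensor_inl,
          Ideal.Quotient.eq_zero_iff_mem.2 hy, map_zero]
      · intro y hy
        rw [Ideal.mem_comap, RingHom.mem_ker, HopfAlgebroid.quotTensor_inr,
          Ideal.Quotient.eq_zero_iff_mem.2 hy, map_zero]
    exact h (hI.comul_mem x hx))

theorem HopfAlgebroid.quotComul_mk (𝓐 : HopfAlgebroid 𝒽 𝒶) (I : Ideal A) (hI : 𝓐.IsHopfIdeal I)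
    (x : A) : 𝓐.quotComul I hI (Ideal.Quotient.mk I x) = 𝓐.quotTensor I (𝓐.comul x) := rfl

/-- Comparison of maps out of `A ⊗ A` and `A/I ⊗ A/I`. -/
theorem HopfAlgebroid.rlLift_quotTensor (𝓐 : HopfAlgebroid 𝒽 𝒶) (I : Ideal A)
    {T T' : Type*} [CommRing T] [CommRing T']
    {f : A →+* T} {g : A →+* T} {hfg : ∀ h, f (𝓐.etaR h) = g (algebraMap H A h)}
    {f' : A ⧸ I →+* T'} {g' : A ⧸ I →+* T'}
    {hfg' : ∀ h, f' (𝓐.quotEtaR I h) = g' (algebraMap H (A ⧸ I) h)} (q : T →+* T')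
    (hf : ∀ x, f' (Ideal.Quotient.mk I x) = q (f x))
    (hg : ∀ x, g' (Ideal.Quotient.mk I x) = q (g x)) (t : RLTensor 𝓐.etaR A) :
    rlLift (𝓐.quotEtaR I) f' g' hfg' (𝓐.quotTensor I t) = q (rlLift 𝓐.etaR f g hfg t) := by
  have : (rlLift (𝓐.quotEtaR I) f' g' hfg').comp (𝓐.quotTensor I) =
      q.comp (rlLift 𝓐.etaR f g hfg) := by
    refine rl_hom_ext (fun x => ?_) (fun x => ?_)
    · rw [RingHom.comp_apply, RingHom.comp_apply, HopfAlgebroid.quotTensor_inl, rlLift_inl,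
        rlLift_inl, hf]
    · rw [RingHom.comp_apply, RingHom.comp_apply, HopfAlgebroid.quotTensor_inr, rlLift_inr,
        rlLift_inr, hg]
  exact RingHom.congr_fun this t

theorem HopfAlgebroid.quotTensor_inr_etaR (𝓐 : HopfAlgebroid 𝒽 𝒶) (I : Ideal A) (h : H) :
    𝓐.quotTensor I (((inr 𝓐.etaR A).comp 𝓐.etaR) h) =
      ((inr (𝓐.quotEtaR I) (A ⧸ I)).comp (𝓐.quotEtaR I)) h :=
  𝓐.quotTensor_inr I (𝓐.etaR h)

/-- The map `A ⊗ A ⊗ A → A/I ⊗ A/I ⊗ A/I`. -/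
def HopfAlgebroid.quotTriple (𝓐 : HopfAlgebroid 𝒽 𝒶) (I : Ideal A) :
    Triple 𝓐.etaR →+* Triple (𝓐.quotEtaR I) :=
  rlMap _ _ (𝓐.quotTensor I) (𝓐.quotTensor_inr_etaR I) (Ideal.Quotient.mkₐ H I)

theorem HopfAlgebroid.quotTriple_in₁ (𝓐 : HopfAlgebroid 𝒽 𝒶) (I : Ideal A) (x : A) :
    𝓐.quotTriple I (in₁ 𝓐.etaR x) = in₁ (𝓐.quotEtaR I) (Ideal.Quotient.mk I x) := by
  rw [HopfAlgebroid.quotTriple, in₁, in₁, RingHom.comp_apply, RingHom.comp_apply, rlMap_inl,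
    HopfAlgebroid.quotTensor_inl]

theorem HopfAlgebroid.quotTriple_in₂ (𝓐 : HopfAlgebroid 𝒽 𝒶) (I : Ideal A) (x : A) :
    𝓐.quotTriple I (in₂ 𝓐.etaR x) = in₂ (𝓐.quotEtaR I) (Ideal.Quotient.mk I x) := by
  rw [HopfAlgebroid.quotTriple, in₂, in₂, RingHom.comp_apply, RingHom.comp_apply, rlMap_inl,
    HopfAlgebroid.quotTensor_inr]

theorem HopfAlgebroid.quotTriple_in₃ (𝓐 : HopfAlgebroid 𝒽 𝒶) (I : Ideal A) (x : A) :
    𝓐.quotTriple I (in₃ 𝓐.etaR x) = in₃ (𝓐.quotEtaR I) (Ideal.Quotient.mk I x) :=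
  rlMap_inr ..

/-- The quotient Hopf algebroid `(H, A/I)` by a Hopf algebroid ideal. -/
def HopfAlgebroid.quotient (𝓐 : HopfAlgebroid 𝒽 𝒶) (I : Ideal A) (hI : 𝓐.IsHopfIdeal I) :
    HopfAlgebroid 𝒽 (quotDeg 𝒶 I) where
  etaR := 𝓐.quotEtaR I
  comul := 𝓐.quotComul I hI
  counit := Ideal.Quotient.lift I 𝓐.counit hI.counit_eq_zero
  antipode := Ideal.quotientMap I 𝓐.antipode hI.antipode_mem
  grading_base := 𝓐.grading_base
  grading := isGrading_quotDeg 𝓐.grading hI.homogeneous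
  etaL_mem d x hx := mk_mem_quotDeg I (𝓐.etaL_mem d x hx)
  etaR_mem d x hx := mk_mem_quotDeg I (𝓐.etaR_mem d x hx)
  comul_mem := by
    rintro d _ ⟨x, hx, rfl⟩
    exact map_tensorDeg 𝓐.etaR (𝓐.quotEtaR I) (Ideal.Quotient.mkₐ H I) (fun _ => rfl)
      (fun _ _ h => mk_mem_quotDeg I h) (𝓐.comul_mem d x hx)
  counit_mem := by
    rintro d _ ⟨x, hx, rfl⟩
    exact 𝓐.counit_mem d x hx
  antipode_mem := by
    rintro d _ ⟨x, hx, rfl⟩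
    exact mk_mem_quotDeg I (𝓐.antipode_mem d x hx)
  comul_etaL h := by
    rw [← Ideal.Quotient.mk_algebraMap, HopfAlgebroid.quotComul_mk, 𝓐.comul_etaL,
      HopfAlgebroid.quotTensor_inl]
  comul_etaR h := by
    change 𝓐.quotComul I hI (Ideal.Quotient.mk I (𝓐.etaR h)) = _
    rw [HopfAlgebroid.quotComul_mk, 𝓐.comul_etaR, HopfAlgebroid.quotTensor_inr]
    rfl
  counit_etaL h := 𝓐.counit_etaL h
  counit_etaR h := 𝓐.counit_etaR h
  id_counit x := by
    obtain ⟨x, rfl⟩ := Ideal.Quotient.mk_surjective x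
    rw [HopfAlgebroid.quotComul_mk]
    exact (𝓐.rlLift_quotTensor I (Ideal.Quotient.mk I) (fun _ => rfl) (fun _ => rfl) _).trans
      (congrArg _ (𝓐.id_counit x))
  counit_id x := by
    obtain ⟨x, rfl⟩ := Ideal.Quotient.mk_surjective x
    rw [HopfAlgebroid.quotComul_mk]
    exact (𝓐.rlLift_quotTensor I (Ideal.Quotient.mk I) (fun _ => rfl) (fun _ => rfl) _).trans
      (congrArg _ (𝓐.counit_id x))
  coassoc x := by
    obtain ⟨x, rfl⟩ := Ideal.Quotient.mk_surjective x
    rw [HopfAlgebroid.quotComul_mk]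
    refine (𝓐.rlLift_quotTensor I (𝓐.quotTriple I) (fun y => ?_) (fun y => ?_) _).trans
      ((congrArg _ (𝓐.coassoc x)).trans
      (𝓐.rlLift_quotTensor I (𝓐.quotTriple I) (fun y => ?_) (fun y => ?_) _).symm)
    · exact 𝓐.rlLift_quotTensor I (hfg := in₁_right _) (hfg' := in₁_right _)
        (𝓐.quotTriple I) (fun z => (𝓐.quotTriple_in₁ I z).symm)
        (fun z => (𝓐.quotTriple_in₂ I z).symm) _
    · exact (𝓐.quotTriple_in₃ I y).symm
    · exact (𝓐.quotTriple_in₁ I y).symm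
    · exact 𝓐.rlLift_quotTensor I (hfg := in₂_right _) (hfg' := in₂_right _)
        (𝓐.quotTriple I) (fun z => (𝓐.quotTriple_in₂ I z).symm)
        (fun z => (𝓐.quotTriple_in₃ I z).symm) _
  antipode_etaL h := congrArg (Ideal.Quotient.mk I) (𝓐.antipode_etaL h)
  antipode_etaR h := congrArg (Ideal.Quotient.mk I) (𝓐.antipode_etaR h)
  antipode_antipode x := by
    obtain ⟨x, rfl⟩ := Ideal.Quotient.mk_surjective x
    exact congrArg (Ideal.Quotient.mk I) (𝓐.antipode_antipode x)
  antipode_id x := by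
    obtain ⟨x, rfl⟩ := Ideal.Quotient.mk_surjective x
    rw [HopfAlgebroid.quotComul_mk]
    exact (𝓐.rlLift_quotTensor I (Ideal.Quotient.mk I) (fun _ => rfl) (fun _ => rfl) _).trans
      (congrArg _ (𝓐.antipode_id x))
  id_antipode x := by
    obtain ⟨x, rfl⟩ := Ideal.Quotient.mk_surjective x
    rw [HopfAlgebroid.quotComul_mk]
    exact (𝓐.rlLift_quotTensor I (Ideal.Quotient.mk I) (fun _ => rfl) (fun _ => rfl) _).trans
      (congrArg _ (𝓐.id_antipode x))

end HopfAlgebroid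

/-! ### Comodules and cofree comodules -/

section Comodule

variable {H C : Type*} [CommRing H] [CommRing C] [Algebra H C]
  {𝒽 : RO → AddSubgroup H} {𝒸 : RO → AddSubgroup C}

/-- `C ⊗_H M` (formed with the right `H`-module structure of `C`), regarded as an `H`-module
through the left unit of `C`: `h (x ⊗ m) = (η_L(h) x) ⊗ m`. -/
def Extended (𝓒 : HopfAlgebroid 𝒽 𝒸) (M : Type*) [AddCommGroup M] [Module H M] : Type _ :=
  RLTensor 𝓒.etaR M

variable (𝓒 : HopfAlgebroid 𝒽 𝒸) {M N P : Type*} [AddCommGroup M] [Module H M]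
  [AddCommGroup N] [Module H N] [AddCommGroup P] [Module H P]

instance : AddCommGroup (Extended 𝓒 M) := inferInstanceAs (AddCommGroup (RLTensor 𝓒.etaR M))

instance : Module H (Extended 𝓒 M) :=
  letI : Module (ViaRight 𝓒.etaR) (RLTensor 𝓒.etaR M) := TensorProduct.leftModule
  Module.compHom (RLTensor 𝓒.etaR M)
    ((toRight 𝓒.etaR).toRingHom.comp (algebraMap H C) : H →+* ViaRight 𝓒.etaR)

namespace Extended

/-- The identity map, as an isomorphism of groups. -/
def of (M : Type*) [AddCommGroup M] [Module H M] : RLTensor 𝓒.etaR M ≃+ Extended 𝓒 M :=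
  AddEquiv.refl _

/-- The element `x ⊗ m` of `C ⊗_H M`. -/
def tmul (x : C) (m : M) : Extended 𝓒 M := of 𝓒 M ((toRight 𝓒.etaR x) ⊗ₜ[H] m)

variable {𝓒}

theorem smul_tmul (h : H) (x : C) (m : M) :
    h • tmul 𝓒 x m = tmul 𝓒 (algebraMap H C h * x) m := rfl

theorem add_tmul (x y : C) (m : M) : tmul 𝓒 (x + y) m = tmul 𝓒 x m + tmul 𝓒 y m :=
  TensorProduct.add_tmul (toRight 𝓒.etaR x) (toRight 𝓒.etaR y) m

theorem tmul_add (x : C) (m n : M) : tmul 𝓒 x (m + n) = tmul 𝓒 x m + tmul 𝓒 x n :=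
  TensorProduct.tmul_add (toRight 𝓒.etaR x) m n

theorem tmul_zero (x : C) : tmul 𝓒 x (0 : M) = 0 :=
  TensorProduct.tmul_zero _ (toRight 𝓒.etaR x)

theorem tmul_smul (h : H) (x : C) (m : M) : tmul 𝓒 x (h • m) = tmul 𝓒 (𝓒.etaR h * x) m :=
  (TensorProduct.smul_tmul h (toRight 𝓒.etaR x) m).symm

theorem induction {p : Extended 𝓒 M → Prop} (h₀ : p 0) (ht : ∀ x m, p (tmul 𝓒 x m))
    (ha : ∀ s t, p s → p t → p (s + t)) (t : Extended 𝓒 M) : p t :=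
  TensorProduct.induction_on (motive := p) t h₀ (fun x m => ht ((toRight 𝓒.etaR).symm x) m)
    (fun s t hs ht => ha s t hs ht)

/-- An additive map out of `C ⊗_H M`. -/
def liftAdd {P : Type*} [AddCommGroup P] (g : C →+ M →+ P)
    (hg : ∀ h x m, g (𝓒.etaR h * x) m = g x (h • m)) : Extended 𝓒 M →+ P :=
  (rlLiftAdd 𝓒.etaR g hg).comp (of 𝓒 M).symm.toAddMonoidHom

theorem liftAdd_tmul {P : Type*} [AddCommGroup P] (g : C →+ M →+ P)
    (hg : ∀ h x m, g (𝓒.etaR h * x) m = g x (h • m))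
    (x : C) (m : M) : liftAdd g hg (tmul 𝓒 x m) = g x m := rfl

/-- `H`-linearity of an additive map out of `C ⊗_H M` may be checked on tensors. -/
def linearOfAdd (f : Extended 𝓒 M →+ P)
    (hf : ∀ h x m, f (tmul 𝓒 (algebraMap H C h * x) m) = h • f (tmul 𝓒 x m)) :
    Extended 𝓒 M →ₗ[H] P where
  toFun := f
  map_add' := map_add f
  map_smul' h t := by
    induction t using Extended.induction with
    | h₀ => simp
    | ht x m => rw [smul_tmul, hf, RingHom.id_apply]
    | ha s t hs ht => rw [smul_add, map_add, map_add, hs, ht, RingHom.id_apply, smul_add]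

/-- `id ⊗ f` for an `H`-linear map `f`. -/
def map (f : M →ₗ[H] N) : Extended 𝓒 M →ₗ[H] Extended 𝓒 N :=
  linearOfAdd (liftAdd
    (AddMonoidHom.mk' (fun x => AddMonoidHom.mk' (fun m => tmul 𝓒 x (f m))
        (fun m n => by rw [map_add, tmul_add]))
      (fun x y => by ext m; exact add_tmul x y (f m)))
    (fun h x m => by
      change tmul 𝓒 (𝓒.etaR h * x) (f m) = tmul 𝓒 x (f (h • m))
      rw [map_smul, tmul_smul]))
    (fun _ _ _ => rfl)

theorem map_tmul (f : M →ₗ[H] N) (x : C) (m : M) : map f (tmul 𝓒 x m) = tmul 𝓒 x (f m) := rfl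

theorem map_map (g : N →ₗ[H] P) (f : M →ₗ[H] N) (t : Extended 𝓒 M) :
    map g (map f t) = map (g ∘ₗ f) t := by
  induction t using Extended.induction with
  | h₀ => simp
  | ht x m => rfl
  | ha s t hs ht => simp only [map_add, hs, ht]

variable (𝓒) in
/-- `ε ⊗ id : C ⊗_H M → M`. -/
def counit (M : Type*) [AddCommGroup M] [Module H M] : Extended 𝓒 M →ₗ[H] M :=
  linearOfAdd (liftAdd
    (AddMonoidHom.mk' (fun x => AddMonoidHom.mk' (fun m => 𝓒.counit x • m)
        (fun m n => smul_add _ m n))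
      (fun x y => by ext m; simp [add_smul]))
    (fun h x m => by
      change 𝓒.counit (𝓒.etaR h * x) • m = 𝓒.counit x • h • m
      rw [map_mul, 𝓒.counit_etaR, mul_comm, mul_smul]))
    (fun h x m => by
      change 𝓒.counit (algebraMap H C h * x) • m = h • 𝓒.counit x • m
      rw [map_mul, 𝓒.counit_etaL, mul_smul])

theorem counit_map (f : M →ₗ[H] N) (t : Extended 𝓒 M) :
    counit 𝓒 N (map f t) = f (counit 𝓒 M t) := by
  induction t using Extended.induction with
  | h₀ => simp
  | ht x m => exact (map_smul f (𝓒.counit x) m).symm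
  | ha s t hs ht => simp only [map_add, hs, ht]

theorem counit_tmul (x : C) (m : M) : counit 𝓒 M (tmul 𝓒 x m) = 𝓒.counit x • m := rfl

variable (𝓒) in
/-- The map `C → C ⊗_H M`, `x ↦ x ⊗ m`. -/
def tmulRight (m : M) : C →ₗ[H] Extended 𝓒 M where
  toFun x := tmul 𝓒 x m
  map_add' x y := add_tmul x y m
  map_smul' h x := by rw [Algebra.smul_def]; rfl

theorem tmulRight_apply (m : M) (x : C) : tmulRight 𝓒 m x = tmul 𝓒 x m := rfl

theorem of_inl_mul {B : Type*} [CommRing B] [Algebra H B] (h : H) (t : RLTensor 𝓒.etaR B) :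
    of 𝓒 B (inl 𝓒.etaR B (algebraMap H C h) * t) = h • of 𝓒 B t := by
  induction t using rl_induction with
  | zero => simp
  | tmul x y =>
    rw [inl_apply, Algebra.TensorProduct.tmul_mul_tmul, one_mul, ← map_mul]
    rfl
  | add s t hs ht => rw [mul_add, map_add, hs, ht, map_add, smul_add]

variable (𝓒) in
/-- The coproduct of `C` as an `H`-linear map `C → C ⊗_H C`. -/
def comul : C →ₗ[H] Extended 𝓒 C where
  toFun x := of 𝓒 C (𝓒.comul x)
  map_add' x y := by rw [map_add, map_add]
  map_smul' h x := by rw [Algebra.smul_def, map_mul, 𝓒.comul_etaL, of_inl_mul, RingHom.id_apply]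

theorem map_tmulRight_inr_mul (h : H) (m : M) (t : RLTensor 𝓒.etaR C) :
    map (tmulRight 𝓒 m) (of 𝓒 C (inr 𝓒.etaR C (𝓒.etaR h) * t)) =
      map (tmulRight 𝓒 (h • m)) (of 𝓒 C t) := by
  induction t using rl_induction with
  | zero => simp
  | tmul x y =>
    rw [inr_apply, Algebra.TensorProduct.tmul_mul_tmul, one_mul]
    exact congrArg (tmul 𝓒 x) (tmul_smul h y m).symm
  | add s t hs ht => rw [mul_add, map_add, map_add, hs, ht, map_add, map_add]

theorem map_tmulRight_add (m n : M) (t : Extended 𝓒 C) :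
    map (tmulRight 𝓒 (m + n)) t = map (tmulRight 𝓒 m) t + map (tmulRight 𝓒 n) t := by
  induction t using Extended.induction with
  | h₀ => simp
  | ht x y => simp only [map_tmul, tmulRight_apply, tmul_add]
  | ha s t hs ht => rw [map_add, hs, ht, map_add, map_add]; abel

variable (𝓒) in
/-- `Δ ⊗ id : C ⊗_H M → C ⊗_H (C ⊗_H M)`, the coaction of the cofree comodule on `M`. -/
def coact (M : Type*) [AddCommGroup M] [Module H M] :
    Extended 𝓒 M →ₗ[H] Extended 𝓒 (Extended 𝓒 M) :=
  linearOfAdd (liftAdd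
    (AddMonoidHom.mk' (fun x => AddMonoidHom.mk'
        (fun m => map (tmulRight 𝓒 m) (comul 𝓒 x))
        (fun m n => map_tmulRight_add m n _))
      (fun x y => by ext m; simp))
    (fun h x m => by
      change map (tmulRight 𝓒 m) (comul 𝓒 (𝓒.etaR h * x)) =
        map (tmulRight 𝓒 (h • m)) (comul 𝓒 x)
      change map (tmulRight 𝓒 m) (of 𝓒 C (𝓒.comul (𝓒.etaR h * x))) = _
      rw [map_mul, 𝓒.comul_etaR, map_tmulRight_inr_mul]
      rfl))
    (fun h x m => by
      change map (tmulRight 𝓒 m) (comul 𝓒 (algebraMap H C h * x)) =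
        h • map (tmulRight 𝓒 m) (comul 𝓒 x)
      rw [← Algebra.smul_def, map_smul, map_smul])

theorem coact_tmul (x : C) (m : M) :
    coact 𝓒 M (tmul 𝓒 x m) = map (tmulRight 𝓒 m) (comul 𝓒 x) := rfl

theorem coact_map (f : M →ₗ[H] N) (t : Extended 𝓒 M) :
    coact 𝓒 N (map f t) = map (map f) (coact 𝓒 M t) := by
  induction t using Extended.induction with
  | h₀ => simp
  | ht x m =>
    rw [map_tmul, coact_tmul, coact_tmul, map_map]
    rfl
  | ha s t hs ht => simp only [map_add, hs, ht]

end Extended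

/-- A left comodule over the Hopf algebroid `(H, C)`: an `H`-module `M` with an `H`-linear,
counital and coassociative map `M → C ⊗_H M`. -/
structure LeftComodule (M : Type*) [AddCommGroup M] [Module H M] where
  /-- the coaction -/
  coaction : M →ₗ[H] Extended 𝓒 M
  counit_coaction : ∀ m, Extended.counit 𝓒 M (coaction m) = m
  coassoc : ∀ m, Extended.map coaction (coaction m) = Extended.coact 𝓒 M (coaction m)

section Induced

variable {B : Type*} [CommRing B] [Algebra H B] {𝒷 : RO → AddSubgroup B}
  {𝓑 : HopfAlgebroid 𝒽 𝒷} {𝓒}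

/-- The map `(f ⊗ id) ∘ Δ : B → C ⊗_H B` for a morphism `f : B → C` of Hopf algebroids. -/
def HopfAlgebroid.Hom.coaction (f : 𝓑.Hom 𝓒) : B →ₗ[H] Extended 𝓒 B where
  toFun b := Extended.of 𝓒 B
    (rlMap 𝓑.etaR 𝓒.etaR f.toAlgHom.toRingHom f.map_etaR (AlgHom.id H B) (𝓑.comul b))
  map_add' x y := by simp only [map_add]
  map_smul' h x := by
    have : f.toAlgHom.toRingHom (algebraMap H B h) = algebraMap H C h := f.toAlgHom.commutes h
    rw [Algebra.smul_def, map_mul, 𝓑.comul_etaL, map_mul, rlMap_inl, this, Extended.of_inl_mul,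
      RingHom.id_apply]

/-- The map `x ⊗ y ⊗ z ↦ f(x) ⊗ f(y) ⊗ z`, as a bilinear map in `x ⊗ y` and `z`. -/
def HopfAlgebroid.Hom.tripleAux (f : 𝓑.Hom 𝓒) :
    RLTensor 𝓑.etaR B →+ B →+ Extended 𝓒 (Extended 𝓒 B) :=
  AddMonoidHom.mk' (fun w => AddMonoidHom.mk'
    (fun z => Extended.map (Extended.tmulRight 𝓒 z) (Extended.of 𝓒 C
      (rlMap 𝓑.etaR 𝓒.etaR f.toAlgHom.toRingHom f.map_etaR f.toAlgHom w)))
    (fun y z => Extended.map_tmulRight_add y z _))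
    (fun v w => by
      refine AddMonoidHom.ext fun z => ?_
      simp only [AddMonoidHom.mk'_apply, map_add, AddMonoidHom.add_apply])

theorem HopfAlgebroid.Hom.tripleAux_apply (f : 𝓑.Hom 𝓒) (w : RLTensor 𝓑.etaR B) (z : B) :
    f.tripleAux w z = Extended.map (Extended.tmulRight 𝓒 z) (Extended.of 𝓒 C
      (rlMap 𝓑.etaR 𝓒.etaR f.toAlgHom.toRingHom f.map_etaR f.toAlgHom w)) := rfl

theorem HopfAlgebroid.Hom.tripleAux_mul (f : 𝓑.Hom 𝓒) (h : H) (w : RLTensor 𝓑.etaR B) (z : B) :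
    f.tripleAux (((inr 𝓑.etaR B).comp 𝓑.etaR) h * w) z = f.tripleAux w (h • z) := by
  have : f.toAlgHom (𝓑.etaR h) = 𝓒.etaR h := f.map_etaR h
  rw [f.tripleAux_apply, f.tripleAux_apply, map_mul, RingHom.comp_apply, rlMap_inr, this,
    Extended.map_tmulRight_inr_mul]

/-- The map `x ⊗ y ⊗ z ↦ f(x) ⊗ f(y) ⊗ z`. -/
def HopfAlgebroid.Hom.triple (f : 𝓑.Hom 𝓒) :
    Triple 𝓑.etaR →+ Extended 𝓒 (Extended 𝓒 B) :=
  rlLiftAdd ((inr 𝓑.etaR B).comp 𝓑.etaR) f.tripleAux f.tripleAux_mul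

theorem HopfAlgebroid.Hom.triple_tmul (f : 𝓑.Hom 𝓒) (w : RLTensor 𝓑.etaR B) (z : B) :
    f.triple ((toRight ((inr 𝓑.etaR B).comp 𝓑.etaR) w) ⊗ₜ[H] z) =
      Extended.map (Extended.tmulRight 𝓒 z) (Extended.of 𝓒 C
        (rlMap 𝓑.etaR 𝓒.etaR f.toAlgHom.toRingHom f.map_etaR f.toAlgHom w)) := rfl

theorem HopfAlgebroid.Hom.triple_left (f : 𝓑.Hom 𝓒) (t : RLTensor 𝓑.etaR B)
    (hfg : ∀ h, ((rlLift 𝓑.etaR (in₁ 𝓑.etaR) (in₂ 𝓑.etaR) (in₁_right 𝓑.etaR)).comp 𝓑.comul)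
      (𝓑.etaR h) = in₃ 𝓑.etaR (algebraMap H B h)) :
    f.triple (rlLift 𝓑.etaR
      ((rlLift 𝓑.etaR (in₁ 𝓑.etaR) (in₂ 𝓑.etaR) (in₁_right 𝓑.etaR)).comp 𝓑.comul)
      (in₃ 𝓑.etaR) hfg t) =
    Extended.coact 𝓒 B (Extended.of 𝓒 B
      (rlMap 𝓑.etaR 𝓒.etaR f.toAlgHom.toRingHom f.map_etaR (AlgHom.id H B) t)) := by
  have hin : ∀ w, rlLift 𝓑.etaR (in₁ 𝓑.etaR) (in₂ 𝓑.etaR) (in₁_right 𝓑.etaR) w =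
      inl ((inr 𝓑.etaR B).comp 𝓑.etaR) B w := by
    intro w
    refine RingHom.congr_fun (rl_hom_ext (fun x => ?_) (fun x => ?_)) w
    · rw [rlLift_inl]; rfl
    · rw [rlLift_inr]; rfl
  induction t using rl_induction with
  | zero => simp only [map_zero]
  | add s t hs ht => simp only [map_add, hs, ht]
  | tmul x z =>
    rw [rlLift_tmul, rlMap_tmul, RingHom.comp_apply, hin]
    change f.triple (inl _ B _ * inr _ B z) = Extended.map (Extended.tmulRight 𝓒 z)
      (Extended.of 𝓒 C (𝓒.comul (f.toAlgHom x)))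
    rw [← tmul_eq, f.triple_tmul, f.map_comul]

theorem HopfAlgebroid.Hom.triple_right (f : 𝓑.Hom 𝓒) (t : RLTensor 𝓑.etaR B)
    (hfg : ∀ h, in₁ 𝓑.etaR (𝓑.etaR h) =
      ((rlLift 𝓑.etaR (in₂ 𝓑.etaR) (in₃ 𝓑.etaR) (in₂_right 𝓑.etaR)).comp 𝓑.comul)
      (algebraMap H B h)) :
    f.triple (rlLift 𝓑.etaR (in₁ 𝓑.etaR)
      ((rlLift 𝓑.etaR (in₂ 𝓑.etaR) (in₃ 𝓑.etaR) (in₂_right 𝓑.etaR)).comp 𝓑.comul) hfg t) =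
    Extended.map f.coaction (Extended.of 𝓒 B
      (rlMap 𝓑.etaR 𝓒.etaR f.toAlgHom.toRingHom f.map_etaR (AlgHom.id H B) t)) := by
  have hin : ∀ x w, f.triple (in₁ 𝓑.etaR x *
      rlLift 𝓑.etaR (in₂ 𝓑.etaR) (in₃ 𝓑.etaR) (in₂_right 𝓑.etaR) w) =
      Extended.tmul 𝓒 (f.toAlgHom x) (Extended.of 𝓒 B
      (rlMap 𝓑.etaR 𝓒.etaR f.toAlgHom.toRingHom f.map_etaR (AlgHom.id H B) w)) := by
    intro x w
    induction w using rl_induction with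
    | zero => simp only [map_zero, mul_zero, Extended.tmul_zero]
    | add s t hs ht => simp only [map_add, mul_add, hs, ht, Extended.tmul_add]
    | tmul y z =>
      rw [rlLift_tmul, rlMap_tmul, ← mul_assoc]
      change f.triple (inl ((inr 𝓑.etaR B).comp 𝓑.etaR) B (inl 𝓑.etaR B x) *
        inl ((inr 𝓑.etaR B).comp 𝓑.etaR) B (inr 𝓑.etaR B y) * inr _ B z) = _
      rw [← map_mul, ← tmul_eq, ← tmul_eq, f.triple_tmul, rlMap_tmul]
      rfl
  induction t using rl_induction with
  | zero => simp only [map_zero]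
  | add s t hs ht => simp only [map_add, hs, ht]
  | tmul x z =>
    rw [rlLift_tmul, rlMap_tmul, RingHom.comp_apply, hin]
    rfl

/-- The `C`-comodule structure on `B` induced by a morphism `B → C` of Hopf algebroids. -/
def HopfAlgebroid.Hom.comodule (f : 𝓑.Hom 𝓒) : LeftComodule 𝓒 B where
  coaction := f.coaction
  counit_coaction b := by
    refine Eq.trans ?_ (𝓑.counit_id b)
    change Extended.counit 𝓒 B (Extended.of 𝓒 B (rlMap _ _ _ _ _ (𝓑.comul b))) = _
    generalize 𝓑.comul b = t
    induction t using rl_induction with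
    | zero => simp only [map_zero]
    | add s t hs ht => simp only [map_add, hs, ht]
    | tmul x y =>
      rw [rlMap_tmul, rlLift_tmul]
      change 𝓒.counit (f.toAlgHom x) • y = _
      rw [f.map_counit, Algebra.smul_def]
      rfl
  coassoc b := by
    exact (f.triple_right _ _).symm.trans ((congrArg f.triple (𝓑.coassoc b)).symm.trans
      (f.triple_left _ _))

/-- The identity morphism. -/
def HopfAlgebroid.Hom.id (𝓒 : HopfAlgebroid 𝒽 𝒸) : 𝓒.Hom 𝓒 where
  toAlgHom := AlgHom.id H C
  map_mem _ _ hx := hx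
  map_etaR _ := rfl
  map_comul x := by
    exact (rlMap_id 𝓒.etaR _ _).symm
  map_counit _ := rfl
  map_antipode _ := rfl

end Induced

theorem comul_coassoc (x : C) :
    Extended.map (Extended.comul 𝓒) (Extended.comul 𝓒 x) =
      Extended.coact 𝓒 C (Extended.comul 𝓒 x) := by
  have h : (HopfAlgebroid.Hom.id 𝓒).coaction = Extended.comul 𝓒 := by
    ext y
    exact congrArg (Extended.of 𝓒 C) ((HopfAlgebroid.Hom.id 𝓒).map_comul y).symm
  have := (HopfAlgebroid.Hom.id 𝓒).comodule.coassoc x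
  change Extended.map (HopfAlgebroid.Hom.id 𝓒).coaction ((HopfAlgebroid.Hom.id 𝓒).coaction x) =
    Extended.coact 𝓒 C ((HopfAlgebroid.Hom.id 𝓒).coaction x) at this
  rwa [h] at this

theorem comul_counit (x : C) : Extended.counit 𝓒 C (Extended.comul 𝓒 x) = x := by
  have h : (HopfAlgebroid.Hom.id 𝓒).coaction = Extended.comul 𝓒 := by
    ext y
    exact congrArg (Extended.of 𝓒 C) ((HopfAlgebroid.Hom.id 𝓒).map_comul y).symm
  have := (HopfAlgebroid.Hom.id 𝓒).comodule.counit_coaction x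
  change Extended.counit 𝓒 C ((HopfAlgebroid.Hom.id 𝓒).coaction x) = x at this
  rwa [h] at this

/-- The cofree `C`-comodule on the `H`-module `M`: `C ⊗_H M` with the coaction `Δ ⊗ id`. -/
def cofreeComodule (M : Type*) [AddCommGroup M] [Module H M] :
    LeftComodule 𝓒 (Extended 𝓒 M) where
  coaction := Extended.coact 𝓒 M
  counit_coaction t := by
    induction t using Extended.induction with
    | h₀ => simp only [map_zero]
    | ha s t hs ht => simp only [map_add, hs, ht]
    | ht x m =>
      rw [Extended.coact_tmul, Extended.counit_map, comul_counit]
      rfl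
  coassoc t := by
    induction t using Extended.induction with
    | h₀ => simp only [map_zero]
    | ha s t hs ht => simp only [map_add, hs, ht]
    | ht x m =>
      rw [Extended.coact_tmul, Extended.coact_map, ← comul_coassoc, Extended.map_map,
        Extended.map_map]
      rfl

/-- The grading of the free `H`-module `H{S}` on a set `S` of generators of degrees `deg`. -/
def freeDeg (𝒽 : RO → AddSubgroup H) {S : Type*} (deg : S → RO) (d : RO) :
    AddSubgroup (S →₀ H) :=
  AddSubgroup.closure {v | ∃ (s : S) (e : RO), e + deg s = d ∧ ∃ h ∈ 𝒽 e, v = Finsupp.single s h}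

/-- The comodule `M`, with the grading `ℳ`, is cofree: there are a set `S` of generators with
degrees in `RO(ℤ/2)` and a degree-preserving isomorphism of comodules between `M` and the cofree
comodule `C ⊗_H H{S}`. -/
def LeftComodule.IsCofree {M : Type*} [AddCommGroup M] [Module H M] {𝓒 : HopfAlgebroid 𝒽 𝒸}
    (X : LeftComodule 𝓒 M) (ℳ : RO → AddSubgroup M) : Prop :=
  ∃ (S : Type) (deg : S → RO) (φ : M ≃ₗ[H] Extended 𝓒 (S →₀ H)),
    (∀ m, Extended.map φ.toLinearMap (X.coaction m) =
      (cofreeComodule 𝓒 (S →₀ H)).coaction (φ m)) ∧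
    ∀ d m, m ∈ ℳ d ↔ (Extended.of 𝓒 (S →₀ H)).symm (φ m) ∈ tensorDeg 𝓒.etaR 𝒸 (freeDeg 𝒽 deg) d

end Comodule

/-! ### Sequences in rings of characteristic two -/

section Sequences

variable {R R' : Type*} [CommRing R] [CommRing R']

/-- The product `(x ∗ y)_n = ∑_{i+j=n} x_i^{2^j} y_j` of sequences. -/
def star (x y : ℕ → R) (n : ℕ) : R := ∑ p ∈ Finset.HasAntidiagonal.antidiagonal n, x p.1 ^ 2 ^ p.2 * y p.2

/-- The unit `(1, 0, 0, …)`. -/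
def starOne (n : ℕ) : R := if n = 0 then 1 else 0

theorem map_starOne {R' : Type*} [CommRing R'] (f : R →+* R') (n : ℕ) :
    f (starOne n) = starOne n := by
  unfold starOne
  split_ifs <;> simp

/-- The right inverse of a sequence with `x_0 = 1`:
`x⁻¹_0 = 1` and `x⁻¹_{n+1} = -∑_{j ≤ n} x_{n+1-j}^{2^j} x⁻¹_j`. -/
def starInv (x : ℕ → R) : ℕ → R
  | 0 => 1
  | n + 1 => -∑ j : Fin (n + 1), x (n + 1 - j) ^ 2 ^ (j : ℕ) * starInv x j

/-- `∑_{k+l=i} binom(j+k, k) θ_{l, j+k} t^k`. -/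
def shear (t : R) (θ : ℕ → ℕ → R) (i j : ℕ) : R :=
  ∑ p ∈ Finset.HasAntidiagonal.antidiagonal i, ((j + p.1).choose p.1 : R) * θ p.2 (j + p.1) * t ^ p.1

open Finset in
theorem sum_antidiagonal_assoc (f : ℕ → ℕ → ℕ → R) (n : ℕ) :
    ∑ p ∈ Finset.HasAntidiagonal.antidiagonal n, ∑ q ∈ Finset.HasAntidiagonal.antidiagonal p.1, f q.1 q.2 p.2 =
      ∑ p ∈ Finset.HasAntidiagonal.antidiagonal n, ∑ q ∈ Finset.HasAntidiagonal.antidiagonal p.2, f p.1 q.1 q.2 := by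
  rw [sum_sigma', sum_sigma']
  refine sum_nbij' (fun s => ⟨(s.2.1, s.2.2 + s.1.2), (s.2.2, s.1.2)⟩)
    (fun s => ⟨(s.1.1 + s.2.1, s.2.2), (s.1.1, s.2.1)⟩) ?_ ?_ ?_ ?_ ?_ <;>
  · rintro ⟨⟨a, b⟩, ⟨c, d⟩⟩ h
    simp only [mem_sigma, HasAntidiagonal.mem_antidiagonal] at h
    obtain ⟨h₁, h₂⟩ := h
    subst h₁
    subst h₂
    first
      | rfl
      | (simp only [mem_sigma, HasAntidiagonal.mem_antidiagonal, and_true]; omega)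

theorem add_pow_two_pow (h2 : (2 : R) = 0) (x y : R) (n : ℕ) :
    (x + y) ^ 2 ^ n = x ^ 2 ^ n + y ^ 2 ^ n := by
  induction n with
  | zero => simp
  | succ n ih =>
    rw [pow_succ, pow_mul, ih, pow_mul, pow_mul]
    linear_combination x ^ 2 ^ n * y ^ 2 ^ n * h2

theorem sum_pow_two_pow (h2 : (2 : R) = 0) {ι : Type*} (s : Finset ι) (f : ι → R) (n : ℕ) :
    (∑ i ∈ s, f i) ^ 2 ^ n = ∑ i ∈ s, f i ^ 2 ^ n := by
  classical
  induction s using Finset.induction_on with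
  | empty => simp
  | insert i s hi ih => rw [Finset.sum_insert hi, Finset.sum_insert hi, add_pow_two_pow h2, ih]

theorem star_assoc (h2 : (2 : R) = 0) (x y z : ℕ → R) :
    star (star x y) z = star x (star y z) := by
  funext n
  simp only [star, sum_pow_two_pow h2, Finset.sum_mul, Finset.mul_sum]
  rw [sum_antidiagonal_assoc (fun a b c => (x a ^ 2 ^ b * y b) ^ 2 ^ c * z c)]
  refine Finset.sum_congr rfl fun p _ => Finset.sum_congr rfl fun q hq => ?_
  rw [Finset.HasAntidiagonal.mem_antidiagonal] at hq
  rw [← hq, mul_pow, ← pow_mul, ← pow_add, mul_assoc]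

theorem star_add (x y z : ℕ → R) (n : ℕ) :
    star x (fun i => y i + z i) n = star x y n + star x z n := by
  simp only [star, mul_add, Finset.sum_add_distrib]

theorem star_smul (x y : ℕ → R) (c : R) (n : ℕ) :
    star x (fun i => c * y i) n = c * star x y n := by
  simp only [star, Finset.mul_sum]
  exact Finset.sum_congr rfl fun p _ => by ring

theorem one_star (x : ℕ → R) : star starOne x = x := by
  funext n
  rw [star, Finset.sum_eq_single (0, n)]
  · simp [starOne]
  · rintro ⟨a, b⟩ h hne
    have : a ≠ 0 := by
      rintro rfl
      simp only [Finset.HasAntidiagonal.mem_antidiagonal] at h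
      exact hne (by rw [← h, zero_add])
    simp [starOne, this]
  · simp

theorem star_one (x : ℕ → R) : star x starOne = x := by
  funext n
  rw [star, Finset.sum_eq_single (n, 0)]
  · simp [starOne]
  · rintro ⟨a, b⟩ h hne
    have : b ≠ 0 := by
      rintro rfl
      simp only [Finset.HasAntidiagonal.mem_antidiagonal] at h
      exact hne (by rw [← h, add_zero])
    simp [starOne, this]
  · simp

theorem star_succ (x y : ℕ → R) (n : ℕ) :
    star x y (n + 1) = x (n + 1) * y 0 + star (fun i => x i ^ 2) (fun i => y (i + 1)) n := by
  rw [star, Finset.Nat.sum_antidiagonal_succ']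
  simp only [star, pow_zero, pow_one]
  congr 1
  refine Finset.sum_congr rfl fun p _ => ?_
  rw [← pow_mul, pow_succ']

theorem star_sq (h2 : (2 : R) = 0) (x y : ℕ → R) (n : ℕ) :
    star x y n ^ 2 = star (fun i => x i ^ 2) (fun i => y i ^ 2) n := by
  have := sum_pow_two_pow h2 (Finset.HasAntidiagonal.antidiagonal n) (fun p => x p.1 ^ 2 ^ p.2 * y p.2) 1
  rw [pow_one] at this
  rw [star, this, star]
  refine Finset.sum_congr rfl fun p _ => ?_
  rw [mul_pow, ← pow_mul, ← pow_mul, mul_comm]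
  ring

theorem map_star (f : R →+* R') (x y : ℕ → R) (n : ℕ) :
    f (star x y n) = star (fun i => f (x i)) (fun i => f (y i)) n := by
  simp [star]

theorem star_zero (x y : ℕ → R) : star x y 0 = x 0 * y 0 := by simp [star]

theorem star_starInv (x : ℕ → R) (hx : x 0 = 1) : star x (starInv x) = starOne := by
  funext n
  cases n with
  | zero => simp [star, starInv, starOne, hx]
  | succ n =>
    have h : star x (starInv x) (n + 1) = starInv x (n + 1) +
        ∑ j : Fin (n + 1), x (n + 1 - j) ^ 2 ^ (j : ℕ) * starInv x j := by
      rw [star, ← Finset.Nat.sum_antidiagonal_swap,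
        Finset.Nat.sum_antidiagonal_eq_sum_range_succ_mk, Finset.sum_range_succ, add_comm,
        Finset.sum_range]
      simp [hx]
    rw [h, starInv, neg_add_cancel]
    simp [starOne]

theorem starInv_star (h2 : (2 : R) = 0) (x : ℕ → R) (hx : x 0 = 1) :
    star (starInv x) x = starOne := by
  have h₁ := star_starInv x hx
  have h₂ := star_starInv (starInv x) (by rw [starInv])
  have : x = starInv (starInv x) := by
    calc x = star x (star (starInv x) (starInv (starInv x))) := by rw [h₂, star_one]
      _ = starInv (starInv x) := by rw [← star_assoc h2, h₁, one_star]
  rwa [← this] at h₂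

theorem map_shear (f : R →+* R') (t : R) (θ : ℕ → ℕ → R) (i j : ℕ) :
    f (shear t θ i j) = shear (f t) (fun i j => f (θ i j)) i j := by
  simp [shear]

theorem shear_zero (θ : ℕ → ℕ → R) : shear 0 θ = θ := by
  funext i j
  rw [shear, Finset.sum_eq_single (0, i)]
  · simp
  · rintro ⟨a, b⟩ h hne
    have : a ≠ 0 := by
      rintro rfl
      simp only [Finset.HasAntidiagonal.mem_antidiagonal] at h
      exact hne (by rw [← h, zero_add])
    simp [this]
  · simp

theorem shear_shear (s t : R) (θ : ℕ → ℕ → R) : shear t (shear s θ) = shear (t + s) θ := by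
  funext i j
  have h : ∀ k l, (j + (k + l)).choose (k + l) * (k + l).choose k =
      (j + k).choose k * (j + k + l).choose l := by
    intro k l
    have h₁ : (j + (k + l)).choose (k + l) * (k + l).choose k =
        (j + (k + l)).choose k * (j + (k + l) - k).choose (k + l - k) :=
      Nat.choose_mul (by omega)
    have h₂ : (j + k + l).choose (j + k) * (j + k).choose k =
        (j + k + l).choose k * (j + k + l - k).choose (j + k - k) :=
      Nat.choose_mul (by omega)
    have h₃ : (j + k + l).choose (j + k) = (j + k + l).choose l := by
      rw [← Nat.choose_symm_of_eq_add (show j + k + l = (j + k) + l from rfl)]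
    have h₄ : (j + l).choose j = (j + l).choose l :=
      Nat.choose_symm_of_eq_add rfl
    rw [h₁, mul_comm ((j + k).choose k), ← h₃, h₂]
    have e₁ : j + (k + l) - k = j + l := by omega
    have e₂ : j + k + l - k = j + l := by omega
    rw [e₁, e₂, Nat.add_sub_cancel_left, Nat.add_sub_cancel, h₄, add_assoc]
  simp only [shear, Finset.mul_sum, Finset.sum_mul]
  rw [← sum_antidiagonal_assoc (fun a b c => ((j + a).choose a : R) *
    (((j + a + b).choose b : R) * θ c (j + a + b) * s ^ b) * t ^ a)]
  refine Finset.sum_congr rfl fun p _ => ?_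
  rw [(Commute.all t s).add_pow', Finset.mul_sum]
  refine Finset.sum_congr rfl fun q hq => ?_
  rw [Finset.HasAntidiagonal.mem_antidiagonal] at hq
  rw [← hq, nsmul_eq_mul]
  have := congrArg (Nat.cast : ℕ → R) (h q.1 q.2)
  push_cast at this
  rw [add_assoc j] at this ⊢
  linear_combination (- θ p.2 (j + (q.1 + q.2)) * s ^ q.2 * t ^ q.1) * this

theorem shear_rel_a {a : R} {θ : ℕ → ℕ → R} (h₀ : ∀ j, a * θ 0 j = 0)
    (h₁ : ∀ i j, a * θ (i + 1) j = θ i j) (t : R) :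
    (∀ j, a * shear t θ 0 j = 0) ∧ ∀ i j, a * shear t θ (i + 1) j = shear t θ i j := by
  constructor
  · intro j
    simp [shear, h₀]
  · intro i j
    rw [shear, Finset.Nat.sum_antidiagonal_succ', mul_add, Finset.mul_sum, shear]
    rw [show a * (((j + (i + 1, 0).1).choose (i + 1, 0).1 : R) *
      θ (i + 1, 0).2 (j + (i + 1, 0).1) * t ^ (i + 1, 0).1) = 0 from by
        linear_combination ((j + (i + 1)).choose (i + 1) : R) * t ^ (i + 1) * h₀ (j + (i + 1)),
      zero_add]
    refine Finset.sum_congr rfl fun p _ => ?_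
    linear_combination ((j + p.1).choose p.1 : R) * t ^ p.1 * h₁ p.2 (j + p.1)

theorem shear_rel_u (h2 : (2 : R) = 0) {a u : R} {θ : ℕ → ℕ → R} (h₀ : ∀ j, a * θ 0 j = 0)
    (h₁ : ∀ i j, a * θ (i + 1) j = θ i j) (h₂ : ∀ i, u * θ i 0 = 0)
    (h₃ : ∀ i j, u * θ i (j + 1) = θ i j) (t : R) :
    (∀ i, (u + a * t) * shear t θ i 0 = 0) ∧
      ∀ i j, (u + a * t) * shear t θ i (j + 1) = shear t θ i j := by
  have hshift := (shear_rel_a h₀ h₁ t)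
  constructor
  · intro i
    cases i with
    | zero =>
      have e : shear t θ 0 0 = θ 0 0 := by simp [shear]
      rw [e]
      linear_combination h₂ 0 + t * h₀ 0
    | succ i =>
      rw [add_mul, mul_right_comm, hshift.2 i 0]
      rw [shear, Finset.Nat.sum_antidiagonal_succ, mul_add, Finset.mul_sum, shear, Finset.sum_mul,
        add_assoc, ← Finset.sum_add_distrib]
      rw [Finset.sum_eq_zero, add_zero]
      · simp [h₂]
      · intro p _
        have := h₃ p.2 p.1
        simp only [zero_add, Nat.choose_self, Nat.cast_one, one_mul]
        linear_combination t ^ (p.1 + 1) * this + θ p.2 p.1 * t ^ (p.1 + 1) * h2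
  · intro i j
    cases i with
    | zero =>
      have e : ∀ j, shear t θ 0 j = θ 0 j := by intro j; simp [shear]
      rw [e, e]
      linear_combination h₃ 0 j + t * h₀ (j + 1)
    | succ i =>
      rw [add_mul, mul_right_comm, hshift.2 i (j + 1)]
      rw [shear, Finset.Nat.sum_antidiagonal_succ, mul_add, Finset.mul_sum, shear, Finset.sum_mul,
        add_assoc, ← Finset.sum_add_distrib, shear, Finset.Nat.sum_antidiagonal_succ]
      congr 1
      · have := h₃ (i + 1) j
        simpa using this
      · refine Finset.sum_congr rfl fun p _ => ?_
        have e₁ := h₃ p.2 (j + (p.1 + 1))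
        have e₂ : ((j + 1 + (p.1 + 1)).choose (p.1 + 1) : R) =
            ((j + 1 + p.1).choose p.1 : R) + ((j + (p.1 + 1)).choose (p.1 + 1) : R) := by
          rw [← Nat.cast_add, show j + 1 + (p.1 + 1) = (j + 1 + p.1) + 1 by ring,
            Nat.choose_succ_succ, show j + (p.1 + 1) = j + 1 + p.1 by ring]
        simp only
        rw [e₂, show j + 1 + (p.1 + 1) = j + (p.1 + 1) + 1 by ring,
          show j + 1 + p.1 = j + (p.1 + 1) by ring]
        linear_combination (((j + (p.1 + 1)).choose p.1 : R) +
          ((j + (p.1 + 1)).choose (p.1 + 1) : R)) * t ^ (p.1 + 1) * e₁ +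
          ((j + (p.1 + 1)).choose p.1 : R) * θ p.2 (j + (p.1 + 1)) * t ^ (p.1 + 1) * h2

theorem shear_mul_shear {θ : ℕ → ℕ → R} (h : ∀ i j k l, θ i j * θ k l = 0) (t : R)
    (i j k l : ℕ) : shear t θ i j * shear t θ k l = 0 := by
  simp only [shear, Finset.sum_mul_sum]
  refine Finset.sum_eq_zero fun p _ => Finset.sum_eq_zero fun q _ => ?_
  linear_combination ((j + p.1).choose p.1 : R) * t ^ p.1 * ((l + q.1).choose q.1 : R) *
    t ^ q.1 * h p.2 (j + p.1) q.2 (l + q.1)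

end Sequences

/-! ### The coefficient ring `HF_⋆` -/

section Coefficients

/-- Generators of the coefficient ring: the Euler class `a`, the class `u = σ⁻¹`, and the classes
`θ_{i,j} = θ / (aⁱ uʲ)` of the negative cone. -/
inductive HGen : Type
  | a
  | u
  | theta (i j : ℕ)

/-- `|a| = -α`, `|u| = 1 - α`, `|θ_{i,j}| = -(2 + j) + (2 + i + j)α`. -/
def HGen.deg : HGen → RO
  | .a => (0, -1)
  | .u => (1, -1)
  | .theta i j => (-2 - j, 2 + i + j)

open MvPolynomial in
/-- The relations of the coefficient ring: `a` and `u` act on the negative cone by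
`a θ_{i+1,j} = θ_{i,j}`, `a θ_{0,j} = 0`, `u θ_{i,j+1} = θ_{i,j}`, `u θ_{i,0} = 0`, and the product
of two elements of the negative cone is zero. -/
inductive HRel : MvPolynomial HGen (ZMod 2) → MvPolynomial HGen (ZMod 2) → Prop
  | a_zero (j : ℕ) : HRel (X .a * X (.theta 0 j)) 0
  | a_succ (i j : ℕ) : HRel (X .a * X (.theta (i + 1) j)) (X (.theta i j))
  | u_zero (i : ℕ) : HRel (X .u * X (.theta i 0)) 0
  | u_succ (i j : ℕ) : HRel (X .u * X (.theta i (j + 1))) (X (.theta i j))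
  | theta_mul (i j k l : ℕ) : HRel (X (.theta i j) * X (.theta k l)) 0

/-- The ideal generated by the relations. -/
def HIdeal : Ideal (MvPolynomial HGen (ZMod 2)) := Ideal.span {p | ∃ x y, HRel x y ∧ p = x - y}

/-- The coefficient ring `HF_⋆ = 𝔽₂[a, u] ⊕ 𝔽₂{θ_{i,j} | i, j ≥ 0}`, the value at the point of
the `RO(ℤ/2)`-graded homology with coefficients in the constant Mackey functor `𝔽₂`. -/
def HF : Type := MvPolynomial HGen (ZMod 2) ⧸ HIdeal

instance : CommRing HF := inferInstanceAs (CommRing (MvPolynomial HGen (ZMod 2) ⧸ HIdeal))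

instance : Algebra (ZMod 2) HF :=
  inferInstanceAs (Algebra (ZMod 2) (MvPolynomial HGen (ZMod 2) ⧸ HIdeal))

namespace HF

/-- The projection from the polynomial ring. -/
def mk : MvPolynomial HGen (ZMod 2) →+* HF := Ideal.Quotient.mk HIdeal

/-- The generators. -/
def gen (g : HGen) : HF := mk (MvPolynomial.X g)

/-- The Euler class `a`. -/
def a : HF := gen .a

/-- The class `u = σ⁻¹`. -/
def u : HF := gen .u

/-- The classes `θ_{i,j} = θ / (aⁱ uʲ)`. -/
def theta (i j : ℕ) : HF := gen (.theta i j)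

/-- The degree `d` part of the coefficient ring, generated by the monomials of degree `d`. -/
def deg (d : RO) : AddSubgroup HF :=
  AddSubgroup.closure
    {x | ∃ m : HGen →₀ ℕ, Finsupp.weight HGen.deg m = d ∧ x = mk (MvPolynomial.monomial m 1)}

theorem mk_surjective : Function.Surjective mk := Ideal.Quotient.mk_surjective

theorem mk_rel {x y : MvPolynomial HGen (ZMod 2)} (h : HRel x y) : mk x = mk y :=
  Ideal.Quotient.eq.2 (Ideal.subset_span ⟨x, y, h, rfl⟩)

theorem a_theta_zero (j : ℕ) : a * theta 0 j = 0 := by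
  simpa using! mk_rel (HRel.a_zero j)

theorem a_theta_succ (i j : ℕ) : a * theta (i + 1) j = theta i j := by
  simpa using! mk_rel (HRel.a_succ i j)

theorem u_theta_zero (i : ℕ) : u * theta i 0 = 0 := by
  simpa using! mk_rel (HRel.u_zero i)

theorem u_theta_succ (i j : ℕ) : u * theta i (j + 1) = theta i j := by
  simpa using! mk_rel (HRel.u_succ i j)

theorem theta_mul_theta (i j k l : ℕ) : theta i j * theta k l = 0 := by
  simpa using! mk_rel (HRel.theta_mul i j k l)

theorem two_eq_zero : (2 : HF) = 0 := by
  have : (2 : ZMod 2) = 0 := rfl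
  rw [← map_ofNat (algebraMap (ZMod 2) HF) 2, this, map_zero]

/-- Ring maps out of the coefficient ring. -/
def lift {R : Type*} [CommRing R] [Algebra (ZMod 2) R] (a u : R) (θ : ℕ → ℕ → R)
    (h₀ : ∀ j, a * θ 0 j = 0) (h₁ : ∀ i j, a * θ (i + 1) j = θ i j)
    (h₂ : ∀ i, u * θ i 0 = 0) (h₃ : ∀ i j, u * θ i (j + 1) = θ i j)
    (h₄ : ∀ i j k l, θ i j * θ k l = 0) : HF →+* R :=
  Ideal.Quotient.lift HIdeal
    (MvPolynomial.eval₂Hom (algebraMap (ZMod 2) R)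
      (fun g => match g with | .a => a | .u => u | .theta i j => θ i j)) (by
    intro p hp
    refine (Ideal.span_le (I := RingHom.ker (MvPolynomial.eval₂Hom _ _))).2 ?_ hp
    rintro _ ⟨x, y, hxy, rfl⟩
    rw [SetLike.mem_coe, RingHom.mem_ker, map_sub, sub_eq_zero]
    cases hxy with
    | a_zero j => simpa using h₀ j
    | a_succ i j => simpa using h₁ i j
    | u_zero i => simpa using h₂ i
    | u_succ i j => simpa using h₃ i j
    | theta_mul i j k l => simpa using h₄ i j k l)

section lift

variable {R : Type*} [CommRing R] [Algebra (ZMod 2) R] {a u : R} {θ : ℕ → ℕ → R}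
    (h₀ : ∀ j, a * θ 0 j = 0) (h₁ : ∀ i j, a * θ (i + 1) j = θ i j)
    (h₂ : ∀ i, u * θ i 0 = 0) (h₃ : ∀ i j, u * θ i (j + 1) = θ i j)
    (h₄ : ∀ i j k l, θ i j * θ k l = 0)

theorem lift_a : lift a u θ h₀ h₁ h₂ h₃ h₄ HF.a = a :=
  MvPolynomial.eval₂Hom_X' _ _ _

theorem lift_u : lift a u θ h₀ h₁ h₂ h₃ h₄ HF.u = u :=
  MvPolynomial.eval₂Hom_X' _ _ _

theorem lift_theta (i j : ℕ) : lift a u θ h₀ h₁ h₂ h₃ h₄ (theta i j) = θ i j :=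
  MvPolynomial.eval₂Hom_X' _ _ _

end lift

theorem hom_ext {R : Type*} [CommRing R] {f g : HF →+* R} (ha : f a = g a) (hu : f u = g u)
    (hθ : ∀ i j, f (theta i j) = g (theta i j)) : f = g := by
  have : f.comp mk = g.comp mk := by
    refine MvPolynomial.ringHom_ext' (RingHom.ext_zmod _ _) ?_
    rintro (_ | _ | ⟨i, j⟩)
    · exact ha
    · exact hu
    · exact hθ i j
  refine RingHom.ext fun x => ?_
  obtain ⟨x, rfl⟩ := mk_surjective x
  exact RingHom.congr_fun this x

end HF

/-- A family of subgroups that is compatible with the unit and with products. -/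
structure IsMulFamily {R : Type*} [CommRing R] (𝓡 : RO → AddSubgroup R) : Prop where
  one_mem : (1 : R) ∈ 𝓡 0
  mul_mem : ∀ {d e : RO} {x y : R}, x ∈ 𝓡 d → y ∈ 𝓡 e → x * y ∈ 𝓡 (d + e)

theorem IsMulFamily.pow_mem {R : Type*} [CommRing R] {𝓡 : RO → AddSubgroup R}
    (h : IsMulFamily 𝓡) {d : RO} {x : R} (hx : x ∈ 𝓡 d) (n : ℕ) : x ^ n ∈ 𝓡 (n • d) := by
  induction n with
  | zero => simpa using h.one_mem
  | succ n ih => rw [pow_succ, succ_nsmul]; exact h.mul_mem ih hx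

theorem IsMulFamily.of_closure {R : Type*} [CommRing R] {s : RO → Set R}
    (one_mem : (1 : R) ∈ s 0) (mul_mem : ∀ {d e : RO} {x y : R}, x ∈ s d → y ∈ s e →
      x * y ∈ AddSubgroup.closure (s (d + e))) :
    IsMulFamily (fun d => AddSubgroup.closure (s d)) where
  one_mem := AddSubgroup.subset_closure one_mem
  mul_mem := by
    intro d e x y hx hy
    induction hx using AddSubgroup.closure_induction with
    | mem x hx =>
      induction hy using AddSubgroup.closure_induction with
      | mem y hy => exact mul_mem hx hy
      | zero => rw [mul_zero]; exact zero_mem _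
      | add y z _ _ hy hz => rw [mul_add]; exact add_mem hy hz
      | neg y _ hy => rw [mul_neg]; exact neg_mem hy
    | zero => rw [zero_mul]; exact zero_mem _
    | add x z _ _ hx hz => rw [add_mul]; exact add_mem hx hz
    | neg x _ hx => rw [neg_mul]; exact neg_mem hx

/-- The elements on which a map `ρ : R → R[RO]` is `x ↦ x · d`. -/
def eigenDeg {R : Type*} [CommRing R] (ρ : R →+* AddMonoidAlgebra R RO) (d : RO) :
    AddSubgroup R where
  carrier := {x | ρ x = AddMonoidAlgebra.single d x}
  add_mem' := by
    intro x y hx hy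
    rw [Set.mem_ofPred_eq] at *
    rw [map_add, hx, hy, AddMonoidAlgebra.single_add]
  zero_mem' := by
    rw [Set.mem_ofPred_eq, map_zero, AddMonoidAlgebra.single_zero]
  neg_mem' := by
    intro x hx
    rw [Set.mem_ofPred_eq] at *
    rw [map_neg, hx, neg_eq_iff_add_eq_zero, ← AddMonoidAlgebra.single_add, add_neg_cancel,
      AddMonoidAlgebra.single_zero]

theorem mem_eigenDeg {R : Type*} [CommRing R] {ρ : R →+* AddMonoidAlgebra R RO} {d : RO}
    {x : R} : x ∈ eigenDeg ρ d ↔ ρ x = AddMonoidAlgebra.single d x := Iff.rfl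

theorem isMulFamily_eigenDeg {R : Type*} [CommRing R] (ρ : R →+* AddMonoidAlgebra R RO) :
    IsMulFamily (eigenDeg ρ) where
  one_mem := by
    rw [mem_eigenDeg, map_one, AddMonoidAlgebra.one_def]
  mul_mem := by
    intro d e x y hx hy
    rw [mem_eigenDeg] at *
    rw [map_mul, hx, hy, AddMonoidAlgebra.single_mul_single]

theorem isGrading_of_eigenDeg {R : Type*} [CommRing R] (ρ : R →+* AddMonoidAlgebra R RO)
    {𝓡 : RO → AddSubgroup R} (h : IsMulFamily 𝓡) (hρ : ∀ d, ∀ x ∈ 𝓡 d, x ∈ eigenDeg ρ d)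
    (htop : ∀ x : R, x ∈ AddSubgroup.closure {y | ∃ d, y ∈ 𝓡 d}) : IsGrading 𝓡 where
  one_mem := h.one_mem
  mul_mem := h.mul_mem
  isInternal := by
    refine isInternal_of_components
      (fun d => AddMonoidHom.mk' (fun x => (ρ x).coeff d) (fun x y => by simp)) ?_ ?_ htop
    · intro d x hx
      have := hρ d x hx
      rw [mem_eigenDeg] at this
      simp [this]
    · intro d e hde x hx
      have := hρ d x hx
      rw [mem_eigenDeg] at this
      simp [this, hde]

namespace HF

theorem isMulFamily_deg : IsMulFamily deg := by
  refine IsMulFamily.of_closure ⟨0, by simp, by simp⟩ ?_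
  rintro d e _ _ ⟨m, rfl, rfl⟩ ⟨n, rfl, rfl⟩
  refine AddSubgroup.subset_closure ⟨m + n, by simp, ?_⟩
  rw [← map_mul, MvPolynomial.monomial_mul, one_mul]

theorem gen_mem (g : HGen) : gen g ∈ deg g.deg :=
  AddSubgroup.subset_closure ⟨Finsupp.single g 1, by simp [Finsupp.weight_single], rfl⟩

/-- A ring map is degree-preserving if it is so on the generators. -/
theorem map_mem {R : Type*} [CommRing R] {𝓡 : RO → AddSubgroup R} (h : IsMulFamily 𝓡)
    (f : HF →+* R) (hf : ∀ g, f (gen g) ∈ 𝓡 g.deg) {d : RO} {x : HF} (hx : x ∈ deg d) :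
    f x ∈ 𝓡 d := by
  induction hx using AddSubgroup.closure_induction with
  | mem x hx =>
    obtain ⟨m, rfl, rfl⟩ := hx
    induction m using Finsupp.induction_linear with
    | zero => simpa using h.one_mem
    | add m n hm hn =>
      have : mk (MvPolynomial.monomial (m + n) 1) =
          mk (MvPolynomial.monomial m 1) * mk (MvPolynomial.monomial n 1) := by
        rw [← map_mul, MvPolynomial.monomial_mul, one_mul]
      rw [this, map_mul, map_add]
      exact h.mul_mem hm hn
    | single g n =>
      have : mk (MvPolynomial.monomial (Finsupp.single g n) 1) = gen g ^ n := by
        rw [gen, ← map_pow, MvPolynomial.X_pow_eq_monomial]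
      rw [this, map_pow, Finsupp.weight_single]
      exact h.pow_mem (hf g) n
  | zero => rw [map_zero]; exact zero_mem _
  | add x z _ _ hx hz => rw [map_add]; exact add_mem hx hz
  | neg x _ hx => rw [map_neg]; exact neg_mem hx

theorem mem_closure_deg (x : HF) : x ∈ AddSubgroup.closure {y | ∃ d, y ∈ deg d} := by
  obtain ⟨p, rfl⟩ := mk_surjective x
  induction p using MvPolynomial.induction_on' with
  | monomial m c =>
    have hc : c = 0 ∨ c = 1 := by
      revert c
      decide
    rcases hc with rfl | rfl
    · simp
    · exact AddSubgroup.subset_closure ⟨_, AddSubgroup.subset_closure ⟨m, rfl, rfl⟩⟩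
  | add p q hp hq => rw [map_add]; exact add_mem hp hq

/-- The map `x ↦ x · |x|` on homogeneous elements. -/
def weightHom : HF →+* AddMonoidAlgebra HF RO :=
  lift (AddMonoidAlgebra.single HGen.a.deg a) (AddMonoidAlgebra.single HGen.u.deg u)
    (fun i j => AddMonoidAlgebra.single (HGen.theta i j).deg (theta i j))
    (fun j => by
      rw [AddMonoidAlgebra.single_mul_single, a_theta_zero, AddMonoidAlgebra.single_zero])
    (fun i j => by
      rw [AddMonoidAlgebra.single_mul_single, a_theta_succ]
      congr 1
      simp only [HGen.deg, Prod.mk_add_mk, Prod.mk.injEq]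
      push_cast
      constructor <;> ring)
    (fun i => by
      rw [AddMonoidAlgebra.single_mul_single, u_theta_zero, AddMonoidAlgebra.single_zero])
    (fun i j => by
      rw [AddMonoidAlgebra.single_mul_single, u_theta_succ]
      congr 1
      simp only [HGen.deg, Prod.mk_add_mk, Prod.mk.injEq]
      push_cast
      constructor <;> ring)
    (fun i j k l => by
      rw [AddMonoidAlgebra.single_mul_single, theta_mul_theta, AddMonoidAlgebra.single_zero])

theorem mem_eigenDeg_weightHom {d : RO} {x : HF} (hx : x ∈ deg d) : x ∈ eigenDeg weightHom d := by
  refine map_mem (isMulFamily_eigenDeg weightHom) (RingHom.id HF) ?_ hx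
  rintro (_ | _ | ⟨i, j⟩)
  · exact lift_a ..
  · exact lift_u ..
  · exact lift_theta ..

theorem isGrading_deg : IsGrading deg :=
  isGrading_of_eigenDeg weightHom isMulFamily_deg (fun _ _ => mem_eigenDeg_weightHom)
    mem_closure_deg

end HF

end Coefficients

/-! ### The dual Steenrod algebra `𝒜_⋆` -/

section Steenrod

/-- Polynomial generators of the dual Steenrod algebra: `xi n` stands for `ξ_{n+1}`, and `tau n`
for `τ_n`. -/
inductive AGen : Type
  | xi (n : ℕ)
  | tau (n : ℕ)

/-- `|ξ_n| = (2ⁿ - 1)(1 + α)`. -/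
def xiDeg (n : ℕ) : RO := (2 ^ n - 1, 2 ^ n - 1)

/-- `|τ_n| = (2ⁿ - 1)(1 + α) + 1`. -/
def tauDeg (n : ℕ) : RO := (2 ^ n, 2 ^ n - 1)

/-- The degrees of the generators. -/
def AGen.deg : AGen → RO
  | .xi n => xiDeg (n + 1)
  | .tau n => tauDeg n

open MvPolynomial in
/-- The ideal generated by the relations `τ_i² = a τ_{i+1} + (u + a τ_0) ξ_{i+1}`. -/
def AIdeal : Ideal (MvPolynomial AGen HF) :=
  Ideal.span (Set.range fun i : ℕ =>
    X (.tau i) ^ 2 - (C HF.a * X (.tau (i + 1)) + (C HF.u + C HF.a * X (.tau 0)) * X (.xi i)))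

/-- The equivariant dual Steenrod algebra
`𝒜_⋆ = HF_⋆[ξ_{i+1}, τ_i | i ≥ 0] / (τ_i² = a τ_{i+1} + η_R(u) ξ_{i+1})`, where
`η_R(u) = u + a τ_0`. -/
def AStar : Type := MvPolynomial AGen HF ⧸ AIdeal

instance : CommRing AStar := inferInstanceAs (CommRing (MvPolynomial AGen HF ⧸ AIdeal))

/-- The left unit of `𝒜_⋆` is the structure map of this `HF_⋆`-algebra. -/
instance : Algebra HF AStar := inferInstanceAs (Algebra HF (MvPolynomial AGen HF ⧸ AIdeal))

instance : Algebra (ZMod 2) AStar :=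
  inferInstanceAs (Algebra (ZMod 2) (MvPolynomial AGen HF ⧸ AIdeal))

namespace AStar

/-- The projection from the polynomial ring. -/
def mk : MvPolynomial AGen HF →+* AStar := Ideal.Quotient.mk AIdeal

/-- The left unit. -/
def etaL : HF →+* AStar := algebraMap HF AStar

/-- The generators. -/
def gen (g : AGen) : AStar := mk (MvPolynomial.X g)

/-- The elements `ξ_n`, with `ξ_0 = 1`. -/
def xi : ℕ → AStar
  | 0 => 1
  | n + 1 => gen (.xi n)

/-- The elements `τ_n`. -/
def tau (n : ℕ) : AStar := gen (.tau n)

/-- The degree `d` part of `𝒜_⋆`, generated by the products of a homogeneous element of `HF_⋆` and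
a monomial in the generators, of total degree `d`. -/
def deg (d : RO) : AddSubgroup AStar :=
  AddSubgroup.closure
    {x | ∃ (m : AGen →₀ ℕ) (e : RO), e + Finsupp.weight AGen.deg m = d ∧
      ∃ h ∈ HF.deg e, x = mk (MvPolynomial.monomial m h)}

theorem mk_surjective : Function.Surjective mk := Ideal.Quotient.mk_surjective

theorem mk_C (h : HF) : mk (MvPolynomial.C h) = etaL h := rfl

theorem tau_sq (i : ℕ) :
    tau i ^ 2 = etaL HF.a * tau (i + 1) + (etaL HF.u + etaL HF.a * tau 0) * xi (i + 1) := by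
  have : mk (MvPolynomial.X (.tau i) ^ 2) = mk (MvPolynomial.C HF.a * MvPolynomial.X (.tau (i + 1))
      + (MvPolynomial.C HF.u + MvPolynomial.C HF.a * MvPolynomial.X (.tau 0)) *
        MvPolynomial.X (.xi i)) :=
    Ideal.Quotient.eq.2 (Ideal.subset_span ⟨i, rfl⟩)
  simpa only [map_add, map_mul, map_pow, mk_C] using! this

theorem two_eq_zero : (2 : AStar) = 0 := by
  rw [← map_ofNat etaL 2, HF.two_eq_zero, map_zero]

/-- Ring maps out of `𝒜_⋆`. -/
def lift {R : Type*} [CommRing R] (φ : HF →+* R) (x t : ℕ → R)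
    (h : ∀ i, t i ^ 2 = φ HF.a * t (i + 1) + (φ HF.u + φ HF.a * t 0) * x (i + 1)) :
    AStar →+* R :=
  Ideal.Quotient.lift AIdeal
    (MvPolynomial.eval₂Hom φ (fun g => match g with | .xi n => x (n + 1) | .tau n => t n)) (by
    intro p hp
    refine (Ideal.span_le (I := RingHom.ker (MvPolynomial.eval₂Hom _ _))).2 ?_ hp
    rintro _ ⟨i, rfl⟩
    rw [SetLike.mem_coe, RingHom.mem_ker, map_sub, sub_eq_zero]
    simpa using h i)

section lift

variable {R : Type*} [CommRing R] {φ : HF →+* R} {x t : ℕ → R}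
  (h : ∀ i, t i ^ 2 = φ HF.a * t (i + 1) + (φ HF.u + φ HF.a * t 0) * x (i + 1))

theorem lift_etaL (y : HF) : lift φ x t h (etaL y) = φ y := MvPolynomial.eval₂Hom_C _ _ _

theorem lift_xi (hx : x 0 = 1) (n : ℕ) : lift φ x t h (xi n) = x n := by
  cases n with
  | zero => rw [xi, map_one, hx]
  | succ n => exact MvPolynomial.eval₂Hom_X' _ _ _

theorem lift_tau (n : ℕ) : lift φ x t h (tau n) = t n := MvPolynomial.eval₂Hom_X' _ _ _

end lift

theorem hom_ext {R : Type*} [CommRing R] {f g : AStar →+* R} (h : ∀ y, f (etaL y) = g (etaL y))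
    (hx : ∀ n, f (xi n) = g (xi n)) (ht : ∀ n, f (tau n) = g (tau n)) : f = g := by
  have : f.comp mk = g.comp mk := by
    refine MvPolynomial.ringHom_ext' (RingHom.ext h) ?_
    rintro (n | n)
    · exact hx (n + 1)
    · exact ht n
  refine RingHom.ext fun x => ?_
  obtain ⟨x, rfl⟩ := mk_surjective x
  exact RingHom.congr_fun this x

/-! #### The grading -/

theorem isMulFamily_deg : IsMulFamily deg := by
  refine IsMulFamily.of_closure ⟨0, 0, by simp, 1, HF.isGrading_deg.one_mem, ?_⟩ ?_
  · rw [MvPolynomial.monomial_zero', map_one, map_one]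
  · rintro d e _ _ ⟨m, i, rfl, h, hh, rfl⟩ ⟨n, j, rfl, k, hk, rfl⟩
    refine AddSubgroup.subset_closure
      ⟨m + n, i + j, ?_, h * k, HF.isGrading_deg.mul_mem hh hk, ?_⟩
    · rw [map_add]; abel
    · rw [← map_mul, MvPolynomial.monomial_mul]

theorem etaL_mem {d : RO} {h : HF} (hh : h ∈ HF.deg d) : etaL h ∈ deg d :=
  AddSubgroup.subset_closure ⟨0, d, by simp, h, hh, rfl⟩

theorem gen_mem (g : AGen) : gen g ∈ deg g.deg :=
  AddSubgroup.subset_closure ⟨Finsupp.single g 1, 0, by simp [Finsupp.weight_single], 1,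
    HF.isGrading_deg.one_mem, rfl⟩

theorem xi_mem (n : ℕ) : xi n ∈ deg (xiDeg n) := by
  cases n with
  | zero =>
    have : xiDeg 0 = 0 := by simp [xiDeg]
    rw [this]
    exact isMulFamily_deg.one_mem
  | succ n => exact gen_mem (.xi n)

theorem tau_mem (n : ℕ) : tau n ∈ deg (tauDeg n) := gen_mem (.tau n)

/-- A ring map is degree-preserving if it is so on `HF_⋆` and on the generators. -/
theorem map_mem {R : Type*} [CommRing R] {𝓡 : RO → AddSubgroup R} (h𝓡 : IsMulFamily 𝓡)
    (f : AStar →+* R) (hf : ∀ g, f (etaL (HF.gen g)) ∈ 𝓡 g.deg)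
    (hx : ∀ n, f (xi n) ∈ 𝓡 (xiDeg n)) (ht : ∀ n, f (tau n) ∈ 𝓡 (tauDeg n))
    {d : RO} {x : AStar} (hd : x ∈ deg d) : f x ∈ 𝓡 d := by
  induction hd using AddSubgroup.closure_induction with
  | mem x hmem =>
    obtain ⟨m, e, rfl, h, hh, rfl⟩ := hmem
    have key : f (mk (MvPolynomial.monomial m 1)) ∈ 𝓡 (Finsupp.weight AGen.deg m) := by
      induction m using Finsupp.induction_linear with
      | zero => simpa using h𝓡.one_mem
      | add m n hm hn =>
        have : mk (MvPolynomial.monomial (m + n) 1) =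
            mk (MvPolynomial.monomial m 1) * mk (MvPolynomial.monomial n 1) := by
          rw [← map_mul, MvPolynomial.monomial_mul, one_mul]
        rw [this, map_mul, map_add]
        exact h𝓡.mul_mem hm hn
      | single g n =>
        have : mk (MvPolynomial.monomial (Finsupp.single g n) 1) = gen g ^ n := by
          rw [gen, ← map_pow, MvPolynomial.X_pow_eq_monomial]
        rw [this, map_pow, Finsupp.weight_single]
        refine h𝓡.pow_mem ?_ n
        cases g with
        | xi n => exact hx (n + 1)
        | tau n => exact ht n
    have : mk (MvPolynomial.monomial m h) = etaL h * mk (MvPolynomial.monomial m 1) := by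
      rw [← mk_C, ← map_mul, MvPolynomial.C_mul_monomial, mul_one]
    rw [this, map_mul]
    exact h𝓡.mul_mem (HF.map_mem h𝓡 (f.comp etaL) hf hh) key
  | zero => rw [map_zero]; exact zero_mem _
  | add x z _ _ hx hz => rw [map_add]; exact add_mem hx hz
  | neg x _ hx => rw [map_neg]; exact neg_mem hx

theorem mem_closure_deg (x : AStar) : x ∈ AddSubgroup.closure {y | ∃ d, y ∈ deg d} := by
  obtain ⟨p, rfl⟩ := mk_surjective x
  induction p using MvPolynomial.induction_on' with
  | monomial m h =>
    have hh := HF.mem_closure_deg h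
    induction hh using AddSubgroup.closure_induction with
    | mem h hh =>
      obtain ⟨e, he⟩ := hh
      exact AddSubgroup.subset_closure ⟨_, AddSubgroup.subset_closure ⟨m, e, rfl, h, he, rfl⟩⟩
    | zero => simp
    | add x y _ _ hx hy => rw [map_add, map_add]; exact add_mem hx hy
    | neg x _ hx => rw [map_neg, map_neg]; exact neg_mem hx
  | add p q hp hq => rw [map_add]; exact add_mem hp hq

/-- The map `x ↦ x · |x|` on homogeneous elements. -/
def weightHom : AStar →+* AddMonoidAlgebra AStar RO :=
  lift ((AddMonoidAlgebra.mapRingHom RO etaL).comp HF.weightHom)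
    (fun n => AddMonoidAlgebra.single (xiDeg n) (xi n))
    (fun n => AddMonoidAlgebra.single (tauDeg n) (tau n)) (by
      intro i
      have ha : (AddMonoidAlgebra.mapRingHom RO etaL).comp HF.weightHom HF.a =
          AddMonoidAlgebra.single HGen.a.deg (etaL HF.a) := by
        rw [RingHom.comp_apply, HF.weightHom, HF.lift_a, AddMonoidAlgebra.mapRingHom_single]
      have hu : (AddMonoidAlgebra.mapRingHom RO etaL).comp HF.weightHom HF.u =
          AddMonoidAlgebra.single HGen.u.deg (etaL HF.u) := by
        rw [RingHom.comp_apply, HF.weightHom, HF.lift_u, AddMonoidAlgebra.mapRingHom_single]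
      have e₁ : HGen.a.deg + tauDeg (i + 1) = tauDeg i + tauDeg i := by
        simp only [HGen.deg, tauDeg, Prod.mk_add_mk, Prod.mk.injEq]
        constructor <;> ring
      have e₂ : HGen.a.deg + tauDeg 0 = HGen.u.deg := by
        simp [HGen.deg, tauDeg]
      have e₃ : HGen.u.deg + xiDeg (i + 1) = tauDeg i + tauDeg i := by
        simp only [HGen.deg, tauDeg, xiDeg, Prod.mk_add_mk, Prod.mk.injEq]
        constructor <;> ring
      rw [ha, hu, pow_two]
      simp only [AddMonoidAlgebra.single_mul_single]
      rw [e₁, e₂, ← AddMonoidAlgebra.single_add, AddMonoidAlgebra.single_mul_single, e₃,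
        ← AddMonoidAlgebra.single_add, ← pow_two, tau_sq])

theorem mem_eigenDeg_weightHom {d : RO} {x : AStar} (hx : x ∈ deg d) :
    x ∈ eigenDeg weightHom d := by
  refine map_mem (isMulFamily_eigenDeg weightHom) (RingHom.id AStar) ?_ ?_ ?_ hx
  · intro g
    have h : HF.weightHom (HF.gen g) = AddMonoidAlgebra.single g.deg (HF.gen g) :=
      HF.mem_eigenDeg_weightHom (HF.gen_mem g)
    rw [RingHom.id_apply, mem_eigenDeg, weightHom, lift_etaL, RingHom.comp_apply, h,
      AddMonoidAlgebra.mapRingHom_single]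
  · intro n
    exact lift_xi _ (by simp [xiDeg, xi, AddMonoidAlgebra.one_def]; rfl) n
  · intro n
    exact lift_tau _ n

theorem isGrading_deg : IsGrading deg :=
  isGrading_of_eigenDeg weightHom isMulFamily_deg (fun _ _ => mem_eigenDeg_weightHom)
    mem_closure_deg

/-! #### The structure maps -/

theorem map_theta_rel {R : Type*} [CommRing R] (f : HF →+* R) :
    (∀ j, f HF.a * f (HF.theta 0 j) = 0) ∧
    (∀ i j, f HF.a * f (HF.theta (i + 1) j) = f (HF.theta i j)) ∧
    (∀ i, f HF.u * f (HF.theta i 0) = 0) ∧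
    (∀ i j, f HF.u * f (HF.theta i (j + 1)) = f (HF.theta i j)) ∧
    ∀ i j k l, f (HF.theta i j) * f (HF.theta k l) = 0 := by
  simp only [← map_mul, HF.a_theta_zero, HF.a_theta_succ, HF.u_theta_zero, HF.u_theta_succ,
    HF.theta_mul_theta, map_zero, implies_true, and_self]

/-- The right unit: `η_R(a) = a`, `η_R(u) = u + a τ_0`, and
`η_R(θ_{i,j}) = ∑_{k+l=i} binom(j+k, k) θ_{l,j+k} τ_0^k`, which is the expansion of
`θ / (aⁱ (u + a τ_0)ʲ)`. -/
def etaR : HF →+* AStar :=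
  HF.lift (etaL HF.a) (etaL HF.u + etaL HF.a * tau 0)
    (shear (tau 0) fun i j => etaL (HF.theta i j))
    (shear_rel_a (map_theta_rel etaL).1 (map_theta_rel etaL).2.1 _).1
    (shear_rel_a (map_theta_rel etaL).1 (map_theta_rel etaL).2.1 _).2
    (shear_rel_u two_eq_zero (map_theta_rel etaL).1 (map_theta_rel etaL).2.1
      (map_theta_rel etaL).2.2.1 (map_theta_rel etaL).2.2.2.1 _).1
    (shear_rel_u two_eq_zero (map_theta_rel etaL).1 (map_theta_rel etaL).2.1
      (map_theta_rel etaL).2.2.1 (map_theta_rel etaL).2.2.2.1 _).2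
    (shear_mul_shear (map_theta_rel etaL).2.2.2.2 _)

theorem etaR_a : etaR HF.a = etaL HF.a := HF.lift_a ..

theorem etaR_u : etaR HF.u = etaL HF.u + etaL HF.a * tau 0 := HF.lift_u ..

theorem etaR_theta (i j : ℕ) :
    etaR (HF.theta i j) = shear (tau 0) (fun i j => etaL (HF.theta i j)) i j := HF.lift_theta ..

/-- `x ↦ x ⊗ 1` -/
abbrev i₁ : AStar →+* RLTensor etaR AStar := inl etaR AStar

/-- `x ↦ 1 ⊗ x` -/
abbrev i₂ : AStar →+* RLTensor etaR AStar := inr etaR AStar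

theorem i₁_etaR (h : HF) : i₁ (etaR h) = i₂ (etaL h) := inl_right etaR h

theorem tensor_two_eq_zero : (2 : RLTensor etaR AStar) = 0 := by
  rw [← map_ofNat i₁ 2, two_eq_zero, map_zero]

/-- `Δ(ξ_n) = ∑_{i+j=n} ξ_i^{2^j} ⊗ ξ_j` -/
def comulXi (n : ℕ) : RLTensor etaR AStar := star (fun i => i₁ (xi i)) (fun j => i₂ (xi j)) n

/-- `Δ(τ_n) = ∑_{i+j=n} ξ_i^{2^j} ⊗ τ_j + τ_n ⊗ 1` -/
def comulTau (n : ℕ) : RLTensor etaR AStar :=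
  star (fun i => i₁ (xi i)) (fun j => i₂ (tau j)) n + i₁ (tau n)

theorem comulXi_zero : comulXi 0 = 1 := by
  simp [comulXi, star_zero, xi]

theorem comulTau_zero : comulTau 0 = i₂ (tau 0) + i₁ (tau 0) := by
  simp [comulTau, star_zero, xi]

theorem comul_rel (n : ℕ) : comulTau n ^ 2 = (i₁.comp etaL) HF.a * comulTau (n + 1) +
    ((i₁.comp etaL) HF.u + (i₁.comp etaL) HF.a * comulTau 0) * comulXi (n + 1) := by
  have h2 := tensor_two_eq_zero
  have ha : i₂ (etaL HF.a) = i₁ (etaL HF.a) := by rw [← i₁_etaR, etaR_a]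
  have hu : i₂ (etaL HF.u) = i₁ (etaL HF.u) + i₁ (etaL HF.a) * i₁ (tau 0) := by
    rw [← i₁_etaR, etaR_u, map_add, map_mul]
  have e : ∀ i, i₂ (tau i) ^ 2 = i₁ (etaL HF.a) * i₂ (tau (i + 1)) +
      (i₁ (etaL HF.u) + i₁ (etaL HF.a) * comulTau 0) * i₂ (xi (i + 1)) := by
    intro i
    rw [← map_pow, tau_sq, comulTau_zero]
    simp only [map_add, map_mul, ha, hu]
    ring
  have e' : i₁ (tau n) ^ 2 = i₁ (etaL HF.a) * i₁ (tau (n + 1)) +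
      (i₁ (etaL HF.u) + i₁ (etaL HF.a) * i₁ (tau 0)) * i₁ (xi (n + 1)) := by
    rw [← map_pow, tau_sq]
    simp only [map_add, map_mul]
  have hsq : comulTau n ^ 2 = star (fun i => i₁ (xi i)) (fun j => i₂ (tau j)) n ^ 2 +
      i₁ (tau n) ^ 2 := by
    rw [comulTau]
    linear_combination star (fun i => i₁ (xi i)) (fun j => i₂ (tau j)) n * i₁ (tau n) * h2
  rw [hsq, star_sq h2]
  simp only [e]
  rw [star_add, star_smul, star_smul, e']
  have s₁ := star_succ (fun i => i₁ (xi i)) (fun j => i₂ (tau j)) n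
  have s₂ := star_succ (fun i => i₁ (xi i)) (fun j => i₂ (xi j)) n
  have x0 : i₂ (xi 0) = 1 := map_one _
  rw [x0] at s₂
  simp only [RingHom.comp_apply, comulXi]
  rw [comulTau_zero, comulTau, s₁, s₂]
  linear_combination (-(i₁ (etaL HF.a) * i₁ (xi (n + 1)) * i₂ (tau 0))) * h2

/-- The coproduct. -/
def comul : AStar →+* RLTensor etaR AStar := lift (i₁.comp etaL) comulXi comulTau comul_rel

theorem comul_etaL (h : HF) : comul (etaL h) = i₁ (etaL h) := lift_etaL ..

theorem comul_xi (n : ℕ) : comul (xi n) = comulXi n := lift_xi _ comulXi_zero n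

theorem comul_tau (n : ℕ) : comul (tau n) = comulTau n := lift_tau ..

theorem comul_etaR (h : HF) : comul (etaR h) = i₂ (etaR h) := by
  have ha : i₂ (etaL HF.a) = i₁ (etaL HF.a) := by rw [← i₁_etaR, etaR_a]
  have : comul.comp etaR = i₂.comp etaR := by
    refine HF.hom_ext ?_ ?_ ?_
    · rw [RingHom.comp_apply, RingHom.comp_apply, etaR_a, comul_etaL, ha]
    · rw [RingHom.comp_apply, RingHom.comp_apply, etaR_u, map_add, map_mul, map_add, map_mul,
        comul_etaL, comul_etaL, comul_tau, comulTau_zero, ← i₁_etaR, ← i₁_etaR, etaR_a, etaR_u,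
        map_add, map_mul]
      ring
    · intro i j
      rw [RingHom.comp_apply, RingHom.comp_apply, etaR_theta, map_shear, map_shear, comul_tau,
        comulTau_zero, ← shear_shear]
      simp only [comul_etaL, ← i₁_etaR, etaR_theta, map_shear]
  exact RingHom.congr_fun this h

/-- The counit, with `ε(ξ_n) = 0` for `n ≥ 1` and `ε(τ_n) = 0`. -/
def counit : AStar →+* HF := lift (RingHom.id HF) starOne 0 (by simp [starOne])

theorem counit_etaL (h : HF) : counit (etaL h) = h := lift_etaL ..

theorem counit_xi (n : ℕ) : counit (xi n) = starOne n := lift_xi _ (by simp [starOne]) n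

theorem counit_tau (n : ℕ) : counit (tau n) = 0 := lift_tau ..

theorem counit_etaR (h : HF) : counit (etaR h) = h := by
  have : counit.comp etaR = RingHom.id HF := by
    refine HF.hom_ext ?_ ?_ ?_
    · rw [RingHom.comp_apply, etaR_a, counit_etaL]
      rfl
    · rw [RingHom.comp_apply, etaR_u, map_add, map_mul, counit_etaL, counit_tau, mul_zero,
        add_zero]
      rfl
    · intro i j
      rw [RingHom.comp_apply, etaR_theta, map_shear, counit_tau, shear_zero, counit_etaL]
      rfl
  exact RingHom.congr_fun this h

/-- `c(ξ_n)`, determined by `∑_{i+j=n} ξ_i^{2^j} c(ξ_j) = 0` for `n ≥ 1`. -/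
def conjXi : ℕ → AStar := starInv xi

/-- `c(τ_n) = ∑_{i+j=n} c(ξ_i)^{2^j} τ_j`. -/
def conjTau : ℕ → AStar := star conjXi tau

theorem star_xi_conjXi : star xi conjXi = starOne := star_starInv xi rfl

theorem star_conjXi_xi : star conjXi xi = starOne := starInv_star two_eq_zero xi rfl

theorem conjXi_zero : conjXi 0 = 1 := by rw [conjXi, starInv]

theorem conjTau_zero : conjTau 0 = tau 0 := by rw [conjTau, star_zero, conjXi_zero, one_mul]

theorem conj_rel (n : ℕ) : conjTau n ^ 2 = etaR HF.a * conjTau (n + 1) +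
    (etaR HF.u + etaR HF.a * conjTau 0) * conjXi (n + 1) := by
  have h2 := two_eq_zero
  rw [conjTau, star_sq h2]
  simp only [tau_sq]
  rw [star_add, star_smul, star_smul]
  have s₁ := star_succ conjXi tau n
  have s₂ := star_succ conjXi xi n
  rw [star_conjXi_xi, show (starOne (n + 1) : AStar) = 0 from by simp [starOne],
    show xi 0 = 1 from rfl] at s₂
  rw [s₁, etaR_a, etaR_u, ← conjTau, conjTau_zero]
  linear_combination (-(etaL HF.u + etaL HF.a * tau 0)) * s₂ -
    (2 * etaL HF.a * tau 0 + etaL HF.u) * conjXi (n + 1) * h2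

/-- The antipode. -/
def antipode : AStar →+* AStar := lift etaR conjXi conjTau conj_rel

theorem antipode_etaL (h : HF) : antipode (etaL h) = etaR h := lift_etaL ..

theorem antipode_xi (n : ℕ) : antipode (xi n) = conjXi n := lift_xi _ conjXi_zero n

theorem antipode_tau (n : ℕ) : antipode (tau n) = conjTau n := lift_tau ..

theorem antipode_etaR (h : HF) : antipode (etaR h) = etaL h := by
  have h2 := two_eq_zero
  have : antipode.comp etaR = etaL := by
    refine HF.hom_ext ?_ ?_ ?_
    · rw [RingHom.comp_apply, etaR_a, antipode_etaL, etaR_a]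
    · rw [RingHom.comp_apply, etaR_u, map_add, map_mul, antipode_etaL, antipode_etaL,
        antipode_tau, conjTau_zero, etaR_a, etaR_u]
      linear_combination etaL HF.a * tau 0 * h2
    · intro i j
      rw [RingHom.comp_apply, etaR_theta, map_shear, antipode_tau, conjTau_zero]
      have e : (fun i j => antipode (etaL (HF.theta i j))) =
          shear (tau 0) fun i j => etaL (HF.theta i j) := by
        funext i j
        rw [antipode_etaL, etaR_theta]
      rw [e, shear_shear, ← two_mul, h2, zero_mul, shear_zero]
  exact RingHom.congr_fun this h

theorem antipode_antipode (x : AStar) : antipode (antipode x) = x := by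
  have hx : ∀ n, antipode (conjXi n) = xi n := by
    have e : star conjXi (fun n => antipode (conjXi n)) = starOne := by
      funext n
      have := map_star antipode xi conjXi n
      rw [star_xi_conjXi] at this
      simp only [antipode_xi] at this
      rw [← this]
      exact map_starOne _ _
    have : (fun n => antipode (conjXi n)) = xi := by
      rw [← one_star (fun n => antipode (conjXi n)), ← star_xi_conjXi, star_assoc two_eq_zero, e,
        star_one]
    exact fun n => congrFun this n
  have : antipode.comp antipode = RingHom.id AStar := by
    refine hom_ext ?_ ?_ ?_
    · intro h
      rw [RingHom.comp_apply, antipode_etaL, antipode_etaR]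
      rfl
    · intro n
      rw [RingHom.comp_apply, antipode_xi, hx]
      rfl
    · intro n
      rw [RingHom.comp_apply, antipode_tau, conjTau, map_star]
      simp only [hx, antipode_tau]
      have : star xi conjTau = tau := by
        rw [conjTau, ← star_assoc two_eq_zero, star_xi_conjXi, one_star]
      exact congrFun this n
  exact RingHom.congr_fun this x

theorem isMulFamily_tensorDeg : IsMulFamily (tensorDeg etaR deg deg) := by
  refine IsMulFamily.of_closure
    ⟨0, 0, by simp, 1, isMulFamily_deg.one_mem, 1, isMulFamily_deg.one_mem, ?_⟩ ?_
  · rw [map_one]; rfl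
  · rintro d e _ _ ⟨i, j, rfl, x, hx, y, hy, rfl⟩ ⟨i', j', rfl, x', hx', y', hy', rfl⟩
    refine AddSubgroup.subset_closure ⟨i + i', j + j', by abel, x * x',
      isMulFamily_deg.mul_mem hx hx', y * y', isMulFamily_deg.mul_mem hy hy', ?_⟩
    rw [Algebra.TensorProduct.tmul_mul_tmul, map_mul]

theorem i₁_mem {d : RO} {x : AStar} (hx : x ∈ deg d) : i₁ x ∈ tensorDeg etaR deg deg d :=
  AddSubgroup.subset_closure ⟨d, 0, add_zero d, x, hx, 1, isMulFamily_deg.one_mem, rfl⟩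

theorem i₂_mem {d : RO} {x : AStar} (hx : x ∈ deg d) : i₂ x ∈ tensorDeg etaR deg deg d :=
  AddSubgroup.subset_closure ⟨0, d, zero_add d, 1, isMulFamily_deg.one_mem, x, hx, rfl⟩

theorem star_mem {R : Type*} [CommRing R] {𝓡 : RO → AddSubgroup R} (h : IsMulFamily 𝓡)
    {x y : ℕ → R} {δ : ℕ → RO} (hx : ∀ n, x n ∈ 𝓡 (xiDeg n)) (hy : ∀ n, y n ∈ 𝓡 (δ n))
    (hδ : ∀ i j, 2 ^ j • xiDeg i + δ j = δ (i + j)) (n : ℕ) : star x y n ∈ 𝓡 (δ n) := by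
  refine sum_mem fun p hp => ?_
  rw [Finset.HasAntidiagonal.mem_antidiagonal] at hp
  rw [← hp, ← hδ]
  exact h.mul_mem (h.pow_mem (hx _) _) (hy _)

theorem xiDeg_add (i j : ℕ) : 2 ^ j • xiDeg i + xiDeg j = xiDeg (i + j) := by
  simp only [xiDeg, Prod.smul_mk, Prod.mk_add_mk, nsmul_eq_mul, Prod.mk.injEq]
  push_cast
  constructor <;> ring

theorem tauDeg_add (i j : ℕ) : 2 ^ j • xiDeg i + tauDeg j = tauDeg (i + j) := by
  simp only [xiDeg, tauDeg, Prod.smul_mk, Prod.mk_add_mk, nsmul_eq_mul, Prod.mk.injEq]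
  push_cast
  constructor <;> ring

theorem starInv_mem {R : Type*} [CommRing R] {𝓡 : RO → AddSubgroup R} (h : IsMulFamily 𝓡)
    {x : ℕ → R} (hx : ∀ n, x n ∈ 𝓡 (xiDeg n)) (n : ℕ) : starInv x n ∈ 𝓡 (xiDeg n) := by
  induction n using Nat.strong_induction_on with
  | _ n ih =>
    cases n with
    | zero =>
      have : xiDeg 0 = 0 := by simp [xiDeg]
      rw [starInv, this]
      exact h.one_mem
    | succ n =>
      rw [starInv]
      refine neg_mem (sum_mem fun j _ => ?_)
      have e := xiDeg_add (n + 1 - j) j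
      rw [Nat.sub_add_cancel j.2.le] at e
      rw [← e]
      exact h.mul_mem (h.pow_mem (hx _) _) (ih j j.2)

theorem etaR_mem {d : RO} {h : HF} (hh : h ∈ HF.deg d) : etaR h ∈ deg d := by
  refine HF.map_mem isMulFamily_deg etaR ?_ hh
  have ha : etaL HF.a ∈ deg HGen.a.deg := etaL_mem (HF.gen_mem .a)
  rintro (_ | _ | ⟨i, j⟩)
  · change etaR HF.a ∈ _
    rw [etaR_a]
    exact ha
  · change etaR HF.u ∈ _
    rw [etaR_u]
    refine add_mem (etaL_mem (HF.gen_mem .u)) ?_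
    have : HGen.u.deg = HGen.a.deg + tauDeg 0 := by simp [HGen.deg, tauDeg]
    rw [this]
    exact isMulFamily_deg.mul_mem ha (tau_mem 0)
  · change etaR (HF.theta i j) ∈ _
    rw [etaR_theta]
    refine sum_mem fun p hp => ?_
    rw [Finset.HasAntidiagonal.mem_antidiagonal] at hp
    have e : (HGen.theta i j).deg = (HGen.theta p.2 (j + p.1)).deg + p.1 • tauDeg 0 := by
      rw [← hp]
      simp only [HGen.deg, tauDeg, Prod.smul_mk, Prod.mk_add_mk, nsmul_eq_mul, Prod.mk.injEq]
      push_cast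
      constructor <;> ring
    rw [e, mul_assoc, ← nsmul_eq_mul]
    exact AddSubgroup.nsmul_mem _ (isMulFamily_deg.mul_mem (etaL_mem (HF.gen_mem _))
      (isMulFamily_deg.pow_mem (tau_mem 0) _)) _

/-- The ring maps out of `A ⊗ A ⊗ A` used below have characteristic two. -/
theorem triple_two_eq_zero : (2 : Triple etaR) = 0 := by
  rw [← map_ofNat (in₁ etaR) 2, two_eq_zero, map_zero]

/-- The `RO(ℤ/2)`-graded Hopf algebroid `(HF_⋆, 𝒜_⋆)`. -/
def hopfAlgebroid : HopfAlgebroid HF.deg AStar.deg where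
  etaR := etaR
  comul := comul
  counit := counit
  antipode := antipode
  grading_base := HF.isGrading_deg
  grading := isGrading_deg
  etaL_mem _ _ hx := etaL_mem hx
  etaR_mem _ _ hx := etaR_mem hx
  comul_mem d x hx := by
    refine map_mem isMulFamily_tensorDeg comul ?_ ?_ ?_ hx
    · intro g
      rw [comul_etaL]
      exact i₁_mem (etaL_mem (HF.gen_mem g))
    · intro n
      rw [comul_xi]
      exact star_mem isMulFamily_tensorDeg (fun n => i₁_mem (xi_mem n))
        (fun n => i₂_mem (xi_mem n)) xiDeg_add n
    · intro n
      rw [comul_tau]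
      exact add_mem (star_mem isMulFamily_tensorDeg (fun n => i₁_mem (xi_mem n))
        (fun n => i₂_mem (tau_mem n)) tauDeg_add n) (i₁_mem (tau_mem n))
  counit_mem d x hx := by
    refine map_mem HF.isMulFamily_deg counit ?_ ?_ ?_ hx
    · intro g
      rw [counit_etaL]
      exact HF.gen_mem g
    · intro n
      rw [counit_xi, starOne]
      split_ifs with hn
      · subst hn
        have : xiDeg 0 = 0 := by simp [xiDeg]
        rw [this]
        exact HF.isMulFamily_deg.one_mem
      · exact zero_mem _
    · intro n
      rw [counit_tau]
      exact zero_mem _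
  antipode_mem d x hx := by
    refine map_mem isMulFamily_deg antipode ?_ ?_ ?_ hx
    · intro g
      rw [antipode_etaL]
      exact etaR_mem (HF.gen_mem g)
    · intro n
      rw [antipode_xi]
      exact starInv_mem isMulFamily_deg xi_mem n
    · intro n
      rw [antipode_tau]
      exact star_mem isMulFamily_deg (starInv_mem isMulFamily_deg xi_mem) tau_mem tauDeg_add n
  comul_etaL := comul_etaL
  comul_etaR := comul_etaR
  counit_etaL := counit_etaL
  counit_etaR := counit_etaR
  id_counit x := by
    have hfg : ∀ h, RingHom.id AStar (etaR h) = (etaR.comp counit) (algebraMap HF AStar h) :=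
      fun h => (congrArg etaR (counit_etaL h)).symm
    have : (rlLift etaR (RingHom.id AStar) (etaR.comp counit) hfg).comp comul =
        RingHom.id AStar := by
      refine hom_ext ?_ ?_ ?_
      · intro h
        rw [RingHom.comp_apply, comul_etaL, rlLift_inl]
      · intro n
        rw [RingHom.comp_apply, comul_xi, comulXi, map_star]
        simp only [rlLift_inl, rlLift_inr, RingHom.comp_apply, counit_xi, RingHom.id_apply]
        have : (fun i => etaR (starOne i)) = (starOne : ℕ → AStar) := by
          funext i
          exact map_starOne _ _
        rw [this]
        exact congrFun (star_one xi) n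
      · intro n
        rw [RingHom.comp_apply, comul_tau, comulTau, map_add, map_star]
        simp only [rlLift_inl, rlLift_inr, RingHom.comp_apply, counit_tau, RingHom.id_apply,
          map_zero]
        simp [star]
    exact RingHom.congr_fun this x
  counit_id x := by
    have hfg : ∀ h, ((algebraMap HF AStar).comp counit) (etaR h) =
        RingHom.id AStar (algebraMap HF AStar h) := fun h => congrArg etaL (counit_etaR h)
    have : (rlLift etaR ((algebraMap HF AStar).comp counit) (RingHom.id AStar) hfg).comp comul =
        RingHom.id AStar := by
      refine hom_ext ?_ ?_ ?_
      · intro h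
        rw [RingHom.comp_apply, comul_etaL, rlLift_inl, RingHom.comp_apply, counit_etaL]
        rfl
      · intro n
        rw [RingHom.comp_apply, comul_xi, comulXi, map_star]
        simp only [rlLift_inl, rlLift_inr, RingHom.comp_apply, counit_xi, RingHom.id_apply]
        have : (fun i => algebraMap HF AStar (starOne i)) = (starOne : ℕ → AStar) := by
          funext i
          exact map_starOne _ _
        rw [this]
        exact congrFun (one_star xi) n
      · intro n
        rw [RingHom.comp_apply, comul_tau, comulTau, map_add, map_star]
        simp only [rlLift_inl, rlLift_inr, RingHom.comp_apply, counit_tau, counit_xi,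
          RingHom.id_apply, map_zero, add_zero]
        have : (fun i => algebraMap HF AStar (starOne i)) = (starOne : ℕ → AStar) := by
          funext i
          exact map_starOne _ _
        rw [this]
        exact congrFun (one_star tau) n
    exact RingHom.congr_fun this x
  coassoc x := by
    have h₁ : ∀ h, ((rlLift etaR (in₁ etaR) (in₂ etaR) (in₁_right etaR)).comp comul) (etaR h) =
        in₃ etaR (algebraMap HF AStar h) := fun h => by
      rw [RingHom.comp_apply, comul_etaR, rlLift_inr, in₂_right]
    have h₂ : ∀ h, in₁ etaR (etaR h) =
        ((rlLift etaR (in₂ etaR) (in₃ etaR) (in₂_right etaR)).comp comul)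
          (algebraMap HF AStar h) := fun h => by
      have : comul (algebraMap HF AStar h) = i₁ (algebraMap HF AStar h) := comul_etaL h
      rw [RingHom.comp_apply, this, rlLift_inl, in₁_right]
    have : (rlLift etaR ((rlLift etaR (in₁ etaR) (in₂ etaR) (in₁_right etaR)).comp comul)
        (in₃ etaR) h₁).comp comul =
        (rlLift etaR (in₁ etaR) ((rlLift etaR (in₂ etaR) (in₃ etaR) (in₂_right etaR)).comp comul)
        h₂).comp comul := by
      refine hom_ext ?_ ?_ ?_
      · intro h
        simp only [RingHom.comp_apply, comul_etaL, rlLift_inl]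
      · intro n
        simp only [RingHom.comp_apply, comul_xi, comulXi, map_star, rlLift_inl, rlLift_inr]
        exact congrFun (star_assoc triple_two_eq_zero (fun i => in₁ etaR (xi i))
          (fun i => in₂ etaR (xi i)) (fun i => in₃ etaR (xi i))) n
      · intro n
        simp only [RingHom.comp_apply, comul_tau, comul_xi, comulTau, comulXi, map_add, map_star,
          rlLift_inl, rlLift_inr]
        rw [star_add, ← add_assoc]
        congr 2
        exact congrFun (star_assoc triple_two_eq_zero (fun i => in₁ etaR (xi i))
          (fun i => in₂ etaR (xi i)) (fun i => in₃ etaR (tau i))) n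
    exact RingHom.congr_fun this x
  antipode_etaL := antipode_etaL
  antipode_etaR := antipode_etaR
  antipode_antipode := antipode_antipode
  antipode_id x := by
    have hfg : ∀ h, antipode (etaR h) = RingHom.id AStar (algebraMap HF AStar h) := antipode_etaR
    have : (rlLift etaR antipode (RingHom.id AStar) hfg).comp comul = etaR.comp counit := by
      refine hom_ext ?_ ?_ ?_
      · intro h
        rw [RingHom.comp_apply, comul_etaL, rlLift_inl, RingHom.comp_apply, counit_etaL,
          antipode_etaL]
      · intro n
        rw [RingHom.comp_apply, comul_xi, comulXi, map_star, RingHom.comp_apply, counit_xi]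
        simp only [rlLift_inl, rlLift_inr, antipode_xi, RingHom.id_apply]
        rw [show star (fun i => conjXi i) (fun i => xi i) = starOne from star_conjXi_xi]
        exact (map_starOne _ _).symm
      · intro n
        rw [RingHom.comp_apply, comul_tau, comulTau, map_add, map_star, RingHom.comp_apply,
          counit_tau, map_zero]
        simp only [rlLift_inl, rlLift_inr, antipode_xi, antipode_tau, RingHom.id_apply]
        change conjTau n + conjTau n = 0
        linear_combination conjTau n * two_eq_zero
    exact RingHom.congr_fun this x
  id_antipode x := by
    have hfg : ∀ h, RingHom.id AStar (etaR h) = antipode (algebraMap HF AStar h) :=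
      fun h => (antipode_etaL h).symm
    have : (rlLift etaR (RingHom.id AStar) antipode hfg).comp comul = etaL.comp counit := by
      refine hom_ext ?_ ?_ ?_
      · intro h
        rw [RingHom.comp_apply, comul_etaL, rlLift_inl, RingHom.comp_apply, counit_etaL]
        rfl
      · intro n
        rw [RingHom.comp_apply, comul_xi, comulXi, map_star, RingHom.comp_apply, counit_xi]
        simp only [rlLift_inl, rlLift_inr, antipode_xi, RingHom.id_apply]
        rw [show star (fun i => xi i) (fun i => conjXi i) = starOne from star_xi_conjXi]
        exact (map_starOne _ _).symm
      · intro n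
        rw [RingHom.comp_apply, comul_tau, comulTau, map_add, map_star, RingHom.comp_apply,
          counit_tau, map_zero]
        simp only [rlLift_inl, rlLift_inr, antipode_tau, RingHom.id_apply]
        have : star (fun i => xi i) (fun i => conjTau i) = tau := by
          change star xi (star conjXi tau) = tau
          rw [← star_assoc two_eq_zero, star_xi_conjXi, one_star]
        rw [this]
        linear_combination tau n * two_eq_zero
    exact RingHom.congr_fun this x

end AStar

end Steenrod

/-! ### Profile functions -/

section Profile

/-- A profile function: a pair of maps `h : ℕ ∖ {0} → ℕ ∪ {∞}` and `k : ℕ → ℕ ∪ {∞}`. -/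
structure ProfileFunction where
  /-- the exponents of the `ξ_i`, `i ≥ 1` -/
  h : ℕ+ → ℕ∞
  /-- the exponents of the `τ_i`, `i ≥ 0` -/
  k : ℕ → ℕ∞

/-- The pointwise order. -/
instance : LE ProfileFunction where
  le p q := (∀ i, p.h i ≤ q.h i) ∧ ∀ i, p.k i ≤ q.k i

/-- `x^{2^e}`, with the convention `x^∞ = 0`. -/
def powTwoPow {R : Type*} [CommRing R] (x : R) : ℕ∞ → R
  | ⊤ => 0
  | (n : ℕ) => x ^ 2 ^ n

/-- The ideal `I(h, k)` of `𝒜_⋆` generated by the `ξ_i^{2^{h(i)}}`, `i ≥ 1`, and the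
`τ_i^{2^{k(i)}}`, `i ≥ 0`. -/
def ProfileFunction.ideal (p : ProfileFunction) : Ideal AStar :=
  Ideal.span (Set.range (fun i : ℕ+ => powTwoPow (AStar.xi i) (p.h i)) ∪
    Set.range (fun i : ℕ => powTwoPow (AStar.tau i) (p.k i)))

/-- `M`, with the grading `ℳ`, is a free `RO(ℤ/2)`-graded `H`-module: it has a basis of
homogeneous elements. -/
def IsGradedFree (H : Type*) {M : Type*} [CommRing H] [AddCommGroup M] [Module H M]
    (ℳ : RO → AddSubgroup M) : Prop :=
  ∃ (S : Type) (b : Module.Basis S H M), ∀ s, ∃ d, b s ∈ ℳ d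

end Profile

end EquivariantSteenrod

end

noncomputable section

/-! For a morphism `B → C` and any `H`-linear map `q : B → F`, the composite `(id ⊗ q)(π ⊗ id)Δ : B
→ C ⊗ F` is a map of comodules into a cofree one (`map_toCofree`). It remains to choose a free `F`
and a degree-preserving `q` for which it is bijective.

The choice comes from monomials. Call a monomial reduced for a profile if the exponent of each `ξ_i`
is below `2^{h(i)}` and that of each `τ_i` is at most one, and zero where `k(i) = 0`. Reduced
monomials always span the quotient, because `τ_i²` can be rewritten; when the quotient is graded
free they form a basis (`linearIndependent_redMono`). Dividing exponents with remainder by the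
truncation heights of `C` writes each reduced monomial of `B` uniquely as `m_c m_s`, with `m_c`
reduced for `C` and the exponents of `s` divisible by the heights of `C` (`splitEquiv`). The set of
generators consists of these `s`, and `q` is the coordinate projection onto them.

Up to higher polynomial degree every generator of the dual Steenrod algebra is primitive. The
heights are powers of two, so in characteristic two `m_s` contributes `1 ⊗ m_s` modulo terms that
vanish in `C`. Hence, modulo the augmentation ideal of `H`, the comodule map sends `m_c m_s` to `m_c
⊗ m_s` plus terms of higher polynomial degree (`psi_comul_mono`). Identifying `m_c ⊗ m_s` with `m_c
m_s` turns it into `id + E`, and `E` has to be shown locally nilpotent.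

`H` has elements on both sides of degree zero, so Nakayama's lemma for connected graded rings does
not apply directly. Two facts replace it. The negative cone `N` spanned by the `θ_{i,j}` has square
zero. A homogeneous matrix entry of `E` outside `N` has the degree of a monomial in `a` and `u`, and
this forces a measure with values in the natural numbers to drop (`measure_lt`). So powers of `E`
push every vector into `N`-multiples and then to zero (`exists_pow_apply_eq_zero`). The same
nilpotence, applied to the idempotent that projects onto the relations among reduced monomials,
proves their linear independence. -/

namespace EquivariantSteenrod

/-! ### Locally nilpotent endomorphisms -/

section LocallyNilpotent

variable {H F : Type*} [CommRing H] [AddCommGroup F] [Module H F]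

/-- The vectors that all high powers of `E` move into the submodule `P`. -/
def attracted (E : F →ₗ[H] F) (P : Submodule H F) : Submodule H F where
  carrier := {v | ∃ n, ∀ m, n ≤ m → (E ^ m) v ∈ P}
  zero_mem' := ⟨0, fun m _ => by rw [map_zero]; exact zero_mem _⟩
  add_mem' := by
    rintro v w ⟨n, hn⟩ ⟨k, hk⟩
    refine ⟨max n k, fun m hm => ?_⟩
    rw [map_add]
    exact add_mem (hn m (le_of_max_le_left hm)) (hk m (le_of_max_le_right hm))
  smul_mem' := by
    rintro h v ⟨n, hn⟩
    refine ⟨n, fun m hm => ?_⟩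
    rw [map_smul]
    exact P.smul_mem h (hn m hm)

theorem mem_attracted_of_pow_mem {E : F →ₗ[H] F} {P : Submodule H F}
    {v : F} {n : ℕ} (h : (E ^ n) v ∈ attracted E P) : v ∈ attracted E P := by
  obtain ⟨k, hk⟩ := h
  refine ⟨k + n, fun m hm => ?_⟩
  obtain ⟨l, rfl⟩ := Nat.exists_eq_add_of_le' hm
  rw [show l + (k + n) = (l + k) + n by ring, pow_add, Module.End.mul_apply]
  exact hk _ (Nat.le_add_left k l)

/-- An endomorphism that is strictly triangular on a generating family, modulo an ideal of square
zero, is locally nilpotent. -/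
theorem exists_pow_apply_eq_zero {T : Type*} {N : Ideal H}
    (hN : ∀ a ∈ N, ∀ b ∈ N, a * b = 0) {x : T → F} (hx : Submodule.span H (Set.range x) = ⊤)
    (f : T → ℕ) {E : F →ₗ[H] F}
    (hE : ∀ s, E (x s) ∈ (N • ⊤ : Submodule H F) ⊔ Submodule.span H (x '' {t | f t < f s}))
    (v : F) : ∃ n, (E ^ n) v = 0 := by
  have hNs : ∀ v ∈ (N • ⊤ : Submodule H F), E v ∈ (N • ⊤ : Submodule H F) := fun v hv =>
    Submodule.smul_top_le_comap_smul_top N E hv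
  -- Induction on the height `f`: one application of `E` leads to `N F`, which `E` preserves, plus
  -- generators of smaller height.
  have hx' : ∀ n s, f s < n → x s ∈ attracted E (N • ⊤) := by
    intro n
    induction n with
    | zero => intro s hs; omega
    | succ n ih =>
      intro s hs
      refine mem_attracted_of_pow_mem (n := 1) ?_
      rw [pow_one]
      have hle : (N • ⊤ : Submodule H F) ⊔ Submodule.span H (x '' {t | f t < f s}) ≤
          attracted E (N • ⊤) := by
        refine sup_le ?_ (Submodule.span_le.2 ?_)
        · intro v hv
          refine ⟨0, fun m _ => ?_⟩
          induction m with
          | zero => exact hv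
          | succ m ihm => rw [pow_succ', Module.End.mul_apply]; exact hNs _ (ihm (Nat.zero_le _))
        · rintro _ ⟨t, ht, rfl⟩
          rw [Set.mem_ofPred_eq] at ht
          exact ih t (by omega)
      exact hle (hE s)
  have h₁ : ∀ v, v ∈ attracted E (N • ⊤) := by
    intro v
    have : Submodule.span H (Set.range x) ≤ attracted E (N • ⊤) := by
      rw [Submodule.span_le]
      rintro _ ⟨s, rfl⟩
      exact hx' (f s + 1) s (Nat.lt_succ_self _)
    rw [hx] at this
    exact this trivial
  -- For `a` in `N`, linearity gives `E^m (a w) = a E^m w`. Since `E^m w` lies in `N F` for large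
  -- `m`, the product lies in `N² F = 0`.
  have h₂ : (N • ⊤ : Submodule H F) ≤ attracted E ⊥ := by
    rw [Submodule.smul_le]
    rintro a ha w -
    obtain ⟨n, hn⟩ := h₁ w
    refine ⟨n, fun m hm => ?_⟩
    rw [map_smul, Submodule.mem_bot]
    have := hn m hm
    generalize (E ^ m) w = z at this
    induction this using Submodule.smul_induction_on' with
    | smul b hb w _ => rw [smul_smul, hN a ha b hb, zero_smul]
    | add v _ w _ hv hw => rw [smul_add, hv, hw, add_zero]
  obtain ⟨n, hn⟩ := h₁ v
  obtain ⟨k, hk⟩ := mem_attracted_of_pow_mem (h₂ (hn n le_rfl))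
  exact ⟨k, (Submodule.mem_bot H).1 (hk k le_rfl)⟩

/-- The inverse is the alternating geometric series in `E`, which is finite on each vector. Both
halves are inductions on the power that kills the vector, so no uniform bound on that power is
needed. -/
theorem bijective_id_add {E : F →ₗ[H] F} (hE : ∀ v, ∃ n, (E ^ n) v = 0) :
    Function.Bijective (LinearMap.id + E : F →ₗ[H] F) := by
  constructor
  · refine (injective_iff_map_eq_zero _).2 fun v hv => ?_
    have h : E v = -v := by
      rw [LinearMap.add_apply, LinearMap.id_apply] at hv
      exact (neg_eq_of_add_eq_zero_right hv).symm
    obtain ⟨n, hn⟩ := hE v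
    induction n with
    | zero => exact hn
    | succ n ih =>
      rw [pow_succ, Module.End.mul_apply, h, map_neg, neg_eq_zero] at hn
      exact ih hn
  · intro v
    obtain ⟨n, hn⟩ := hE v
    induction n generalizing v with
    | zero => exact ⟨0, by rw [map_zero]; exact hn.symm⟩
    | succ n ih =>
      rw [pow_succ, Module.End.mul_apply] at hn
      obtain ⟨w, hw⟩ := ih (E v) hn
      refine ⟨v - w, ?_⟩
      rw [map_sub, hw, LinearMap.add_apply, LinearMap.id_apply, add_sub_cancel_right]

end LocallyNilpotent

/-! ### The coefficient ring modulo its positive and negative cones -/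

namespace HF

/-- The augmentation `HF_⋆ → 𝔽₂`. -/
def rho : HF →+* ZMod 2 := lift 0 0 (fun _ _ => 0) (by simp) (by simp) (by simp) (by simp) (by simp)

theorem rho_a : rho a = 0 := lift_a ..

theorem rho_u : rho u = 0 := lift_u ..

theorem rho_theta (i j : ℕ) : rho (theta i j) = 0 := lift_theta ..

/-- The negative cone, the ideal generated by the `θ_{i,j}`. -/
def negCone : Ideal HF := Ideal.span (Set.range fun p : ℕ × ℕ => theta p.1 p.2)

theorem negCone_mul_negCone : ∀ x ∈ negCone, ∀ y ∈ negCone, x * y = 0 := by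
  have : negCone * negCone = ⊥ := by
    rw [negCone, Ideal.span_mul_span, Ideal.span_eq_bot]
    intro z hz
    obtain ⟨_, ⟨p, rfl⟩, _, ⟨q, rfl⟩, rfl⟩ := hz
    exact theta_mul_theta ..
  intro x hx y hy
  have h := Ideal.mul_mem_mul hx hy
  rwa [this, Ideal.mem_bot] at h

theorem mk_monomial_add (m n : HGen →₀ ℕ) : mk (MvPolynomial.monomial (m + n) 1) =
    mk (MvPolynomial.monomial m 1) * mk (MvPolynomial.monomial n 1) := by
  rw [← map_mul, MvPolynomial.monomial_mul, one_mul]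

/-- A monomial involving some `θ_{i,j}` lies in the negative cone. Any other is `a^i u^j`, of degree
`j - (i + j)α`, which gives both inequalities and vanishes only for `i = j = 0`. -/
theorem mk_monomial_mem_negCone_or (m : HGen →₀ ℕ) :
    mk (MvPolynomial.monomial m 1) ∈ negCone ∨
      (0 ≤ (Finsupp.weight HGen.deg m).1 ∧
        (Finsupp.weight HGen.deg m).1 + (Finsupp.weight HGen.deg m).2 ≤ 0 ∧
        (Finsupp.weight HGen.deg m = 0 → mk (MvPolynomial.monomial m 1) = 1)) := by
  induction m using Finsupp.induction_linear with
  | zero => simp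
  | add m n hm hn =>
    rw [mk_monomial_add, map_add]
    rcases hm with hm | ⟨h₁, h₂, h₃⟩
    · exact Or.inl (Ideal.mul_mem_right _ _ hm)
    rcases hn with hn | ⟨k₁, k₂, k₃⟩
    · exact Or.inl (Ideal.mul_mem_left _ _ hn)
    refine Or.inr ⟨?_, ?_, ?_⟩
    · simp only [Prod.fst_add]; omega
    · simp only [Prod.fst_add, Prod.snd_add]; omega
    · intro h
      have e₁ := congrArg Prod.fst h
      have e₂ := congrArg Prod.snd h
      simp only [Prod.fst_add, Prod.snd_add, Prod.fst_zero, Prod.snd_zero] at e₁ e₂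
      rw [h₃ (Prod.ext (by simp; omega) (by simp; omega)),
        k₃ (Prod.ext (by simp; omega) (by simp; omega)), one_mul]
  | single g n =>
    have e : mk (MvPolynomial.monomial (Finsupp.single g n) 1) = gen g ^ n := by
      rw [gen, ← map_pow, MvPolynomial.X_pow_eq_monomial]
    rw [e, Finsupp.weight_single]
    rcases n.eq_zero_or_pos with rfl | hn
    · simp
    cases g with
    | a =>
      refine Or.inr ⟨by simp [HGen.deg], by simp [HGen.deg], fun h => ?_⟩
      have := congrArg Prod.snd h
      simp [HGen.deg] at this
      omega
    | u =>
      refine Or.inr ⟨by simp [HGen.deg], by simp [HGen.deg], fun h => ?_⟩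
      have := congrArg Prod.snd h
      simp [HGen.deg] at this
      omega
    | theta i j =>
      exact Or.inl (Ideal.pow_mem_of_mem _ (Ideal.subset_span (Set.mem_range_self (i, j))) n hn)

theorem mem_negCone_of_deg {d : RO} (hd : ¬(0 ≤ d.1 ∧ d.1 + d.2 ≤ 0)) {x : HF} (hx : x ∈ deg d) :
    x ∈ negCone := by
  refine (AddSubgroup.closure_le (K := negCone.toAddSubgroup)).2 ?_ hx
  rintro _ ⟨m, rfl, rfl⟩
  rcases mk_monomial_mem_negCone_or m with h | h
  · exact h
  · exact absurd ⟨h.1, h.2.1⟩ hd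

theorem rho_eq_zero_of_mem_negCone {x : HF} (hx : x ∈ negCone) : rho x = 0 := by
  have : negCone ≤ RingHom.ker rho := by
    rw [negCone, Ideal.span_le]
    rintro _ ⟨p, rfl⟩
    exact rho_theta _ _
  exact this hx

/-- Modulo the negative cone the degree zero part consists of `0` and `1` only, and `rho` separates
these two. -/
theorem mem_negCone_of_deg_zero {x : HF} (hx : x ∈ deg 0) (hρ : rho x = 0) : x ∈ negCone := by
  have key : x ∈ negCone ∨ x - 1 ∈ negCone := by
    clear hρ
    induction hx using AddSubgroup.closure_induction with
    | mem x hx =>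
      obtain ⟨m, hm, rfl⟩ := hx
      rcases mk_monomial_mem_negCone_or m with h | h
      · exact Or.inl h
      · right
        rw [h.2.2 hm, sub_self]
        exact zero_mem _
    | zero => exact Or.inl (zero_mem _)
    | neg x _ hx =>
      have : -x = x := by linear_combination -x * two_eq_zero
      rwa [this]
    | add x y _ _ hx hy =>
      rcases hx with hx | hx <;> rcases hy with hy | hy
      · exact Or.inl (add_mem hx hy)
      · right
        have := add_mem hx hy
        rwa [← add_sub_assoc] at this
      · right
        have := add_mem hx hy
        rwa [sub_add_eq_add_sub] at this
      · left
        have := add_mem hx hy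
        have e : x - 1 + (y - 1) = x + y := by linear_combination -two_eq_zero
        rwa [e] at this
  rcases key with h | h
  · exact h
  · have := rho_eq_zero_of_mem_negCone h
    rw [map_sub, hρ, map_one] at this
    exact absurd this (by decide)

end HF

namespace AStar

/-! ### Monomials and their coefficients modulo the augmentation ideal of `HF_⋆` -/

/-- The monomial with exponents `e` in the generators of `𝒜_⋆`. -/
def mono (e : AGen →₀ ℕ) : AStar := mk (MvPolynomial.monomial e 1)

theorem mono_zero : mono 0 = 1 := map_one mk

theorem mono_add (e f : AGen →₀ ℕ) : mono (e + f) = mono e * mono f := by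
  rw [mono, mono, mono, ← map_mul, MvPolynomial.monomial_mul, one_mul]

theorem mono_single (g : AGen) (n : ℕ) : mono (Finsupp.single g n) = gen g ^ n := by
  rw [mono, gen, ← map_pow, MvPolynomial.X_pow_eq_monomial]

theorem mk_monomial (e : AGen →₀ ℕ) (h : HF) :
    mk (MvPolynomial.monomial e h) = h • mono e := by
  rw [Algebra.smul_def]
  change _ = etaL h * mono e
  rw [← mk_C, mono, ← map_mul, MvPolynomial.C_mul_monomial, mul_one]

theorem mono_mem (e : AGen →₀ ℕ) : mono e ∈ deg (Finsupp.weight AGen.deg e) :=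
  AddSubgroup.subset_closure ⟨e, 0, zero_add _, 1, HF.isGrading_deg.one_mem, rfl⟩

/-- The exponents of the `τ_n` in a monomial are at most one. -/
def TauReduced (t : AGen →₀ ℕ) : Prop := ∀ n, t (.tau n) < 2

theorem coeff_mul_X_pow_eq_zero {t : AGen →₀ ℕ} {g : AGen} {n : ℕ} (h : t g < n)
    (p : MvPolynomial AGen (ZMod 2)) : (p * MvPolynomial.X g ^ n).coeff t = 0 := by
  rw [MvPolynomial.X_pow_eq_monomial, MvPolynomial.coeff_mul_monomial', if_neg]
  rw [Finsupp.single_le_iff]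
  omega

/-- Since `rho` kills `a` and `u`, the defining relations reduce to `τ_i² = 0`. They cannot affect
the coefficient of a monomial whose `τ`-exponents are at most one. -/
theorem coeff_map_rho_eq_zero {t : AGen →₀ ℕ} (ht : TauReduced t) {p : MvPolynomial AGen HF}
    (hp : p ∈ AIdeal) : (MvPolynomial.map HF.rho p).coeff t = 0 := by
  -- Taking a coefficient is not linear over the polynomial ring, so the span induction carries an
  -- arbitrary multiplier.
  have key : ∀ q, (MvPolynomial.map HF.rho (q * p)).coeff t = 0 := by
    induction hp using Submodule.span_induction with
    | mem p hp =>
      obtain ⟨i, rfl⟩ := hp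
      intro q
      simpa [HF.rho_a, HF.rho_u] using coeff_mul_X_pow_eq_zero (ht i) (MvPolynomial.map HF.rho q)
    | zero => simp
    | add p q _ _ hp hq => intro r; rw [mul_add, map_add, MvPolynomial.coeff_add, hp, hq, add_zero]
    | smul r p _ hp => intro q; rw [smul_eq_mul, ← mul_assoc]; exact hp _
  simpa using key 1

/-- The coefficient of the monomial with exponents `t`, modulo the augmentation ideal of
`HF_⋆`. -/
def chi (t : AGen →₀ ℕ) (ht : TauReduced t) : AStar →+ ZMod 2 :=
  QuotientAddGroup.lift AIdeal.toAddSubgroup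
    (AddMonoidHom.mk' (fun p => (MvPolynomial.map HF.rho p).coeff t) (fun p q => by simp))
    (fun _ hp => coeff_map_rho_eq_zero ht hp)

section chi

variable {t : AGen →₀ ℕ} (ht : TauReduced t)

theorem chi_mk (p : MvPolynomial AGen HF) :
    chi t ht (mk p) = (MvPolynomial.map HF.rho p).coeff t := rfl

theorem chi_etaL_mul (h : HF) (x : AStar) : chi t ht (etaL h * x) = HF.rho h * chi t ht x := by
  obtain ⟨p, rfl⟩ := mk_surjective x
  rw [← mk_C, ← map_mul, chi_mk, chi_mk, map_mul, MvPolynomial.map_C, MvPolynomial.coeff_C_mul]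

theorem chi_gen_pow_mul {g : AGen} {n : ℕ} (h : t g < n) (x : AStar) :
    chi t ht (gen g ^ n * x) = 0 := by
  obtain ⟨p, rfl⟩ := mk_surjective x
  rw [gen, ← map_pow, ← map_mul, chi_mk, mul_comm, map_mul, map_pow, MvPolynomial.map_X]
  exact coeff_mul_X_pow_eq_zero h _

open Classical in
theorem chi_mono (e : AGen →₀ ℕ) : chi t ht (mono e) = if e = t then 1 else 0 := by
  rw [mono, chi_mk, MvPolynomial.map_monomial, map_one, MvPolynomial.coeff_monomial]

/-- The two units agree modulo the ideal generated by the augmentation ideal of the coefficients,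
and `chi` vanishes on that ideal. This is what makes products of two such functionals well defined
on the tensor product over `H`, where the right unit acts on the left factor. -/
theorem chi_etaR_mul (h : HF) (x : AStar) : chi t ht (etaR h * x) = HF.rho h * chi t ht x := by
  let J : Ideal AStar := (RingHom.ker HF.rho).map etaL
  have hJ : ∀ h, HF.rho h = 0 → Ideal.Quotient.mk J (etaL h) = 0 := fun h hh =>
    Ideal.Quotient.eq_zero_iff_mem.2 (Ideal.mem_map_of_mem etaL hh)
  have e : (Ideal.Quotient.mk J).comp etaR = (Ideal.Quotient.mk J).comp etaL := by
    refine HF.hom_ext ?_ ?_ ?_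
    · simp [etaR_a]
    · simp [etaR_u, hJ _ HF.rho_a]
    · intro i j
      simp [etaR_theta, hJ _ (HF.rho_theta _ _), shear]
  have hd : etaR h - etaL h ∈ J := Ideal.Quotient.eq.1 (RingHom.congr_fun e h)
  have hz : ∀ y ∈ J, ∀ x, chi t ht (y * x) = 0 := by
    intro y hy
    induction hy using Submodule.span_induction with
    | mem y hy =>
      obtain ⟨h, hh, rfl⟩ := hy
      intro x
      rw [chi_etaL_mul, show HF.rho h = 0 from hh, zero_mul]
    | zero => simp
    | add y z _ _ hy hz => intro x; rw [add_mul, map_add, hy, hz, add_zero]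
    | smul r y _ hy => intro x; rw [smul_eq_mul, mul_comm r, mul_assoc]; exact hy _
  have := hz _ hd x
  rw [sub_mul, map_sub, sub_eq_zero, chi_etaL_mul] at this
  exact this

end chi

end AStar

/-! ### Reduced monomials -/

/-- `2 ^ e`, with `0` in place of `∞`, so that `n % twoPow e = n` means `n < 2 ^ e`. -/
def twoPow : ℕ∞ → ℕ
  | ⊤ => 0
  | (n : ℕ) => 2 ^ n

/-- Encoding `∞` by `0` turns the order of exponents into divisibility, with `0` as the largest
element. -/
theorem twoPow_dvd {d e : ℕ∞} (h : d ≤ e) : twoPow d ∣ twoPow e := by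
  cases e with
  | top => exact dvd_zero _
  | coe e =>
    cases d with
    | top => simp at h
    | coe d => exact pow_dvd_pow 2 (by exact_mod_cast h)

namespace ProfileFunction

variable (p : ProfileFunction)

/-- The truncation heights of the generators in the quotient by `I(h, k)`; `0` stands for `∞`. -/
def bound : AGen → ℕ
  | .xi n => twoPow (p.h n.succPNat)
  -- The height is `2` for every nonzero value of `k`, since `τ_n²` is a combination of other
  -- monomials even where it is not in the ideal.
  | .tau n => if p.k n = 0 then 1 else 2

/-- The exponents are smaller than the truncation heights. -/
def IsReduced (e : AGen →₀ ℕ) : Prop := ∀ g, e g % p.bound g = e g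

variable {p}

theorem IsReduced.lt {e : AGen →₀ ℕ} (he : p.IsReduced e) {g : AGen} (hg : p.bound g ≠ 0) :
    e g < p.bound g := by
  rw [← he g]
  exact Nat.mod_lt _ (Nat.pos_of_ne_zero hg)

theorem bound_tau_ne_zero (n : ℕ) : p.bound (.tau n) ≠ 0 := by
  simp only [bound]
  split_ifs <;> simp

theorem IsReduced.tauReduced {e : AGen →₀ ℕ} (he : p.IsReduced e) : AStar.TauReduced e := by
  intro n
  refine (he.lt (bound_tau_ne_zero n)).trans_le ?_
  simp only [bound]
  split_ifs <;> simp

theorem IsReduced.mono {e f : AGen →₀ ℕ} (he : p.IsReduced e) (hf : f ≤ e) : p.IsReduced f := by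
  intro g
  by_cases h : p.bound g = 0
  · rw [h, Nat.mod_zero]
  · exact Nat.mod_eq_of_lt ((hf g).trans_lt (he.lt h))

theorem bound_dvd_bound {q : ProfileFunction} (h : p ≤ q) (g : AGen) : p.bound g ∣ q.bound g := by
  cases g with
  | xi n => exact twoPow_dvd (h.1 _)
  | tau n =>
    have := h.2 n
    by_cases hp : p.k n = 0
    · simp [bound, hp]
    · have hq : q.k n ≠ 0 := fun hq => hp (by rw [hq] at this; exact nonpos_iff_eq_zero.1 this)
      simp [bound, hp, hq]

theorem exists_bound_eq_two_pow {g : AGen} (hg : p.bound g ≠ 0) : ∃ n, p.bound g = 2 ^ n := by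
  cases g with
  | xi n =>
    simp only [bound] at *
    generalize p.h n.succPNat = e at *
    cases e with
    | top => exact absurd rfl hg
    | coe e => exact ⟨e, rfl⟩
  | tau n =>
    simp only [bound] at *
    split_ifs
    · exact ⟨0, rfl⟩
    · exact ⟨1, rfl⟩

theorem powTwoPow_zero {R : Type*} [CommRing R] (x : R) : powTwoPow x 0 = x := by
  change x ^ 2 ^ 0 = x
  simp

/-- These are the two ways to remove an excessive power of a generator: it is zero in the quotient,
or it is a square `τ_n²` to which the defining relation applies. -/
theorem gen_pow_bound_mem {g : AGen} (hg : p.bound g ≠ 0) :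
    AStar.gen g ^ p.bound g ∈ p.ideal ∨ ∃ n, g = .tau n ∧ p.bound g = 2 := by
  cases g with
  | xi n =>
    left
    refine Ideal.subset_span (Or.inl ⟨n.succPNat, ?_⟩)
    have hx : AStar.xi (n.succPNat : ℕ) = AStar.gen (.xi n) := rfl
    simp only [bound] at *
    rw [hx]
    generalize p.h n.succPNat = e at *
    cases e with
    | top => exact absurd rfl hg
    | coe e => rfl
  | tau n =>
    by_cases h : p.k n = 0
    · left
      refine Ideal.subset_span (Or.inr ⟨n, ?_⟩)
      simp only [bound, h, if_true, pow_one]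
      exact powTwoPow_zero _
    · exact Or.inr ⟨n, rfl, by simp [bound, h]⟩

/-- A generator `τ_i^{2^k}` with `k ≥ 1` is at least divisible by `τ_i²`. This weaker information
suffices for the coefficient functionals of reduced monomials to vanish on the ideal, whatever the
value of `k`. -/
theorem exists_dvd_of_mem_generators {x : AStar}
    (hx : x ∈ Set.range (fun i : ℕ+ => powTwoPow (AStar.xi i) (p.h i)) ∪
      Set.range (fun i : ℕ => powTwoPow (AStar.tau i) (p.k i))) :
    x = 0 ∨ ∃ g, p.bound g ≠ 0 ∧ AStar.gen g ^ p.bound g ∣ x := by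
  rcases hx with ⟨i, rfl⟩ | ⟨i, rfl⟩
  · have hx : AStar.xi (i : ℕ) = AStar.gen (.xi i.natPred) := by
      conv_lhs => rw [← PNat.succPNat_natPred i]
      rfl
    have hb : p.bound (.xi i.natPred) = twoPow (p.h i) := by
      simp only [bound, PNat.succPNat_natPred]
    simp only [hx]
    generalize p.h i = e at *
    cases e with
    | top => exact Or.inl rfl
    | coe e =>
      refine Or.inr ⟨.xi i.natPred, ?_, ?_⟩
      · rw [hb]
        exact pow_ne_zero _ two_ne_zero
      · rw [hb]
        exact dvd_rfl
  · by_cases h : p.k i = 0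
    · refine Or.inr ⟨.tau i, bound_tau_ne_zero i, ?_⟩
      simp only [bound, h, if_true, pow_one, powTwoPow_zero]
      exact dvd_rfl
    · have hb : p.bound (.tau i) = 2 := by simp [bound, h]
      simp only
      generalize p.k i = e at *
      cases e with
      | top => exact Or.inl rfl
      | coe e =>
        refine Or.inr ⟨.tau i, bound_tau_ne_zero i, ?_⟩
        rw [hb]
        have he : e ≠ 0 := by rintro rfl; exact h rfl
        exact pow_dvd_pow (AStar.tau i) (by
          calc 2 = 2 ^ 1 := rfl
            _ ≤ 2 ^ e := Nat.pow_le_pow_right two_pos (by omega))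

theorem chi_eq_zero_of_mem_ideal {t : AGen →₀ ℕ} (ht : p.IsReduced t) {x : AStar}
    (hx : x ∈ p.ideal) : AStar.chi t ht.tauReduced x = 0 := by
  have key : ∀ y, AStar.chi t ht.tauReduced (x * y) = 0 := by
    induction hx using Submodule.span_induction with
    | mem x hx =>
      intro y
      rcases exists_dvd_of_mem_generators hx with rfl | ⟨g, hg, z, rfl⟩
      · simp
      · rw [mul_assoc]
        exact AStar.chi_gen_pow_mul _ (ht.lt hg) _
    | zero => simp
    | add x y _ _ hx hy => intro z; rw [add_mul, map_add, hx, hy, add_zero]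
    | smul r y _ hy => intro x; rw [smul_eq_mul, mul_comm r, mul_assoc]; exact hy _
  simpa using key 1

theorem ideal_le_ideal {q : ProfileFunction} (h : p ≤ q) : q.ideal ≤ p.ideal := by
  have hpow : ∀ {x : AStar} {d e : ℕ∞}, d ≤ e → powTwoPow x d ∣ powTwoPow x e := by
    intro x d e hde
    cases e with
    | top => exact dvd_zero _
    | coe e =>
      cases d with
      | top => simp at hde
      | coe d => exact pow_dvd_pow x (Nat.pow_le_pow_right two_pos (by exact_mod_cast hde))
  refine Ideal.span_le.2 ?_
  rintro _ (⟨i, rfl⟩ | ⟨i, rfl⟩)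
  · exact Ideal.mem_of_dvd _ (hpow (h.1 i)) (Ideal.subset_span (Or.inl ⟨i, rfl⟩))
  · exact Ideal.mem_of_dvd _ (hpow (h.2 i)) (Ideal.subset_span (Or.inr ⟨i, rfl⟩))

/-! ### Reduced monomials span the quotient. -/

variable (p) in
/-- The exponents of the monomials that form a basis of the quotient by `I(h, k)` if this is
free. -/
abbrev Reduced : Type := {e : AGen →₀ ℕ // p.IsReduced e}

variable (p) in
/-- The image of a reduced monomial in the quotient by `I(h, k)`. -/
def redMono (t : p.Reduced) : AStar ⧸ p.ideal := Ideal.Quotient.mk p.ideal (AStar.mono t)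

/-- The number of factors `τ_n` in a monomial. -/
def tauCount : (AGen →₀ ℕ) →+ ℕ :=
  Finsupp.weight fun g => match g with | .xi _ => 0 | .tau _ => 1

theorem tauCount_xi (n k : ℕ) : tauCount (Finsupp.single (.xi n) k) = 0 := by
  simp [tauCount, Finsupp.weight_single]

theorem tauCount_tau (n k : ℕ) : tauCount (Finsupp.single (.tau n) k) = k := by
  simp [tauCount, Finsupp.weight_single]

/-- Induction on the number of `τ`-factors. Replacing `τ_n²` by `a τ_{n+1} + u ξ_{n+1} + a τ_0
ξ_{n+1}` leaves at most one of the two factors in each term, while an excessive power of any other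
kind is already zero in the quotient. -/
theorem mono_mem_span (e : AGen →₀ ℕ) : Ideal.Quotient.mk p.ideal (AStar.mono e) ∈
    Submodule.span HF (Set.range p.redMono) := by
  induction hn : tauCount e using Nat.strong_induction_on generalizing e with
  | _ n ih =>
    subst hn
    by_cases he : p.IsReduced e
    · exact Submodule.subset_span ⟨⟨e, he⟩, rfl⟩
    · obtain ⟨g, hg⟩ := not_forall.1 he
      have h₀ : p.bound g ≠ 0 := fun h => hg (by rw [h, Nat.mod_zero])
      have h₁ : p.bound g ≤ e g := by
        by_contra h
        exact hg (Nat.mod_eq_of_lt (not_le.1 h))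
      obtain ⟨f, rfl⟩ : ∃ f, e = f + Finsupp.single g (p.bound g) :=
        ⟨e - Finsupp.single g (p.bound g),
          (tsub_add_cancel_of_le (Finsupp.single_le_iff.2 h₁)).symm⟩
      rw [AStar.mono_add, AStar.mono_single]
      rcases gen_pow_bound_mem h₀ with h | ⟨n, rfl, h⟩
      · rw [Ideal.Quotient.eq_zero_iff_mem.2 (Ideal.mul_mem_left _ _ h)]
        exact zero_mem _
      · have e₁ : AStar.mono f * AStar.gen (.tau n) ^ 2 =
            HF.a • AStar.mono (f + Finsupp.single (.tau (n + 1)) 1) +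
            HF.u • AStar.mono (f + Finsupp.single (.xi n) 1) +
            HF.a • AStar.mono (f + Finsupp.single (.tau 0) 1 + Finsupp.single (.xi n) 1) := by
          have := AStar.tau_sq n
          rw [AStar.tau, AStar.tau, AStar.tau, AStar.xi] at this
          rw [this]
          simp only [AStar.mono_add, AStar.mono_single, Algebra.smul_def, pow_one]
          change _ = AStar.etaL _ * _ + AStar.etaL _ * _ + AStar.etaL _ * _
          ring
        have hmk : ∀ (h : HF) (x : AStar), Ideal.Quotient.mk p.ideal (h • x) =
            h • Ideal.Quotient.mk p.ideal x := fun _ _ => rfl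
        rw [h] at ih ⊢
        rw [e₁, map_add, map_add, hmk, hmk, hmk]
        simp only [map_add, tauCount_tau] at ih
        refine add_mem (add_mem ?_ ?_) ?_ <;>
        · refine Submodule.smul_mem _ _ (ih _ ?_ _ rfl)
          simp only [map_add, tauCount_tau, tauCount_xi]
          omega

theorem span_redMono : Submodule.span HF (Set.range p.redMono) = ⊤ := by
  rw [eq_top_iff]
  rintro x -
  obtain ⟨x, rfl⟩ := Ideal.Quotient.mk_surjective x
  obtain ⟨q, rfl⟩ := AStar.mk_surjective x
  induction q using MvPolynomial.induction_on' with
  | monomial e h =>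
    rw [AStar.mk_monomial]
    exact Submodule.smul_mem _ h (mono_mem_span e)
  | add q r hq hr => rw [map_add, map_add]; exact add_mem hq hr

end ProfileFunction

namespace AStar

/-! ### The coproduct of a monomial up to higher polynomial degree -/

/-- The subgroup of `𝒜_⋆ ⊗ 𝒜_⋆` generated by the tensors of monomials of polynomial degree at
least `n`. -/
def polyFil (n : ℕ) : AddSubgroup (RLTensor etaR AStar) :=
  AddSubgroup.closure
    {t | ∃ e f : AGen →₀ ℕ, n ≤ e.degree + f.degree ∧ t = i₁ (mono e) * i₂ (mono f)}

theorem mul_mem_polyFil {m n : ℕ} {x y : RLTensor etaR AStar} (hx : x ∈ polyFil m)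
    (hy : y ∈ polyFil n) : x * y ∈ polyFil (m + n) := by
  induction hx using AddSubgroup.closure_induction with
  | mem x hx =>
    induction hy using AddSubgroup.closure_induction with
    | mem y hy =>
      obtain ⟨e, f, h, rfl⟩ := hx
      obtain ⟨e', f', h', rfl⟩ := hy
      refine AddSubgroup.subset_closure ⟨e + e', f + f', ?_, ?_⟩
      · rw [map_add, map_add]; omega
      · rw [mono_add, mono_add, map_mul, map_mul]; ring
    | zero => rw [mul_zero]; exact zero_mem _
    | add y z _ _ hy hz => rw [mul_add]; exact add_mem hy hz
    | neg y _ hy => exact (mul_neg x y : x * -y = -(x * y)) ▸ neg_mem hy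
  | zero => rw [zero_mul]; exact zero_mem _
  | add x z _ _ hx hz => rw [add_mul]; exact add_mem hx hz
  | neg x _ hx => exact (neg_mul x y : -x * y = -(x * y)) ▸ neg_mem hx

theorem polyFil_anti {m n : ℕ} (h : m ≤ n) : polyFil n ≤ polyFil m := by
  refine AddSubgroup.closure_mono ?_
  rintro _ ⟨e, f, hn, rfl⟩
  exact ⟨e, f, h.trans hn, rfl⟩

theorem i₁_gen_pow_mul_i₂_gen_mem (g g' : AGen) {n : ℕ} (hn : n ≠ 0) :
    i₁ (gen g) ^ n * i₂ (gen g') ∈ polyFil 2 := by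
  refine AddSubgroup.subset_closure ⟨Finsupp.single g n, Finsupp.single g' 1, ?_, ?_⟩
  · rw [Finsupp.degree_single, Finsupp.degree_single]; omega
  · rw [mono_single, mono_single, map_pow, pow_one]

theorem i₁_gen_mem (g : AGen) : i₁ (gen g) ∈ polyFil 1 := by
  refine AddSubgroup.subset_closure ⟨Finsupp.single g 1, 0, ?_, ?_⟩
  · rw [Finsupp.degree_single]; omega
  · rw [mono_single, mono_zero, map_one, pow_one, mul_one]

theorem i₂_gen_mem (g : AGen) : i₂ (gen g) ∈ polyFil 1 := by
  refine AddSubgroup.subset_closure ⟨0, Finsupp.single g 1, ?_, ?_⟩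
  · rw [Finsupp.degree_single]; omega
  · rw [mono_single, mono_zero, map_one, pow_one, one_mul]

/-- Used to split off the summand with `ξ_0 = 1` on the left, which is the term `1 ⊗ x` of a
coproduct. -/
theorem sum_antidiagonal_sub_mem {G : Type*} [AddCommGroup G] {S : AddSubgroup G} {n : ℕ}
    {f : ℕ × ℕ → G} (h : ∀ a b, f (a + 1, b) ∈ S) :
    ∑ p ∈ Finset.HasAntidiagonal.antidiagonal n, f p - f (0, n) ∈ S := by
  rw [← Finset.add_sum_erase _ _ (show (0, n) ∈ Finset.HasAntidiagonal.antidiagonal n from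
    Finset.HasAntidiagonal.mem_antidiagonal.2 (zero_add n)), add_sub_cancel_left]
  refine sum_mem fun p hp => ?_
  obtain ⟨_ | a, b⟩ := p
  · simp only [Finset.mem_erase, Finset.HasAntidiagonal.mem_antidiagonal, zero_add] at hp
    exact absurd (congrArg (Prod.mk 0) hp.2) hp.1
  · exact h a b

/-- Apart from `x ⊗ 1` and `1 ⊗ x`, the coproduct of a generator consists of terms with a positive
power of some `ξ` on the left and a generator on the right. No coefficients from `H` occur, so a
filtration by additive subgroups is enough. -/
theorem comul_gen_sub_mem (g : AGen) : comul (gen g) - (i₁ (gen g) + i₂ (gen g)) ∈ polyFil 2 := by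
  cases g with
  | xi n =>
    have h : comul (gen (.xi n)) = comulXi (n + 1) := comul_xi (n + 1)
    rw [h, comulXi, star_succ, star]
    have := sum_antidiagonal_sub_mem (S := polyFil 2) (n := n)
      (f := fun p => (i₁ (xi p.1) ^ 2) ^ 2 ^ p.2 * i₂ (xi (p.2 + 1))) (fun a b => by
        rw [← pow_mul]
        exact i₁_gen_pow_mul_i₂_gen_mem (.xi a) (.xi b) (by positivity))
    convert this using 1
    simp only [xi, map_one, one_pow, one_mul, mul_one]
    ring
  | tau n =>
    have h : comul (gen (.tau n)) = comulTau n := comul_tau n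
    rw [h, comulTau, star]
    have := sum_antidiagonal_sub_mem (S := polyFil 2) (n := n)
      (f := fun p => i₁ (xi p.1) ^ 2 ^ p.2 * i₂ (tau p.2)) (fun a b =>
        i₁_gen_pow_mul_i₂_gen_mem (.xi a) (.tau b) (by positivity))
    convert this using 1
    simp only [xi, map_one, one_pow, one_mul, tau]
    ring

/-- The product of the `(x_g ⊗ 1 + 1 ⊗ x_g)^{e_g}`. -/
def primProd (e : AGen →₀ ℕ) : RLTensor etaR AStar :=
  e.prod fun g n => (i₁ (gen g) + i₂ (gen g)) ^ n

theorem primProd_add (e f : AGen →₀ ℕ) : primProd (e + f) = primProd e * primProd f :=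
  Finsupp.prod_add_index' (fun _ => pow_zero _) (fun _ _ _ => pow_add _ _ _)

theorem primProd_single (g : AGen) (n : ℕ) :
    primProd (Finsupp.single g n) = (i₁ (gen g) + i₂ (gen g)) ^ n :=
  Finsupp.prod_single_index (pow_zero _)

theorem exponent_induction {P : (AGen →₀ ℕ) → Prop} (e : AGen →₀ ℕ) (zero : P 0)
    (add_single : ∀ e g, P e → P (e + Finsupp.single g 1)) : P e := by
  induction h : e.degree generalizing e with
  | zero => rwa [(Finsupp.degree_eq_zero_iff e).1 h]
  | succ n ih =>
    obtain ⟨g, hg⟩ : ∃ g, e g ≠ 0 := by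
      by_contra! h'
      rw [show e = 0 from Finsupp.ext h', map_zero] at h
      omega
    have hle : Finsupp.single g 1 ≤ e := Finsupp.single_le_iff.2 (Nat.one_le_iff_ne_zero.2 hg)
    rw [← tsub_add_cancel_of_le hle] at h ⊢
    rw [map_add, Finsupp.degree_single] at h
    exact add_single _ _ (ih _ (by omega))

/-- Multiplicativity of the coproduct and of the filtration carries the primitivity of generators
over to monomials. The first half of the conjunction is needed to bound the error in the product. -/
theorem comul_mono_sub_mem (e : AGen →₀ ℕ) :
    primProd e ∈ polyFil e.degree ∧ comul (mono e) - primProd e ∈ polyFil (e.degree + 1) := by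
  induction e using exponent_induction with
  | zero =>
    constructor
    · exact AddSubgroup.subset_closure ⟨0, 0, by simp, by simp [primProd, mono_zero]⟩
    · simp [primProd, mono_zero]
  | add_single e g ih =>
    have hg : i₁ (gen g) + i₂ (gen g) ∈ polyFil 1 := add_mem (i₁_gen_mem g) (i₂_gen_mem g)
    have hc : comul (gen g) ∈ polyFil 1 := by
      have := add_mem (polyFil_anti one_le_two (comul_gen_sub_mem g)) hg
      rwa [sub_add_cancel] at this
    rw [primProd_add, primProd_single, pow_one, mono_add, mono_single, pow_one, map_add,
      Finsupp.degree_single, map_mul]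
    refine ⟨mul_mem_polyFil ih.1 hg, ?_⟩
    have e₁ : comul (mono e) * comul (gen g) - primProd e * (i₁ (gen g) + i₂ (gen g)) =
        (comul (mono e) - primProd e) * comul (gen g) +
        primProd e * (comul (gen g) - (i₁ (gen g) + i₂ (gen g))) := by ring
    rw [e₁]
    refine add_mem (mul_mem_polyFil ih.2 hc) ?_
    rw [add_assoc]
    exact mul_mem_polyFil ih.1 (comul_gen_sub_mem g)

/-! ### Coefficients of the coproduct -/

/-- The functional `x ⊗ y ↦ χ_c(x) χ_s(y)`. -/
def psi {c s : AGen →₀ ℕ} (hc : TauReduced c) (hs : TauReduced s) :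
    RLTensor etaR AStar →+ ZMod 2 :=
  rlLiftAdd etaR ((AddMonoidHom.mul.compl₂ (chi s hs)).comp (chi c hc))
    (fun h x y => by
      change chi c hc (etaR h * x) * chi s hs y = chi c hc x * chi s hs (h • y)
      rw [chi_etaR_mul, Algebra.smul_def]
      change _ = _ * chi s hs (etaL h * y)
      rw [chi_etaL_mul]
      ring)

section psi

variable {c s : AGen →₀ ℕ} (hc : TauReduced c) (hs : TauReduced s)

theorem psi_mul (x y : AStar) : psi hc hs (i₁ x * i₂ y) = chi c hc x * chi s hs y := by
  rw [← tmul_eq]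
  rfl

open Classical in
theorem psi_mono (e f : AGen →₀ ℕ) : psi hc hs (i₁ (mono e) * i₂ (mono f)) =
    (if e = c then 1 else 0) * (if f = s then 1 else 0) := by
  rw [psi_mul, chi_mono, chi_mono]

theorem psi_eq_zero_of_mem_polyFil {n : ℕ} (hn : c.degree + s.degree < n)
    {z : RLTensor etaR AStar} (hz : z ∈ polyFil n) : psi hc hs z = 0 := by
  refine (AddSubgroup.closure_le (K := (psi hc hs).ker)).2 ?_ hz
  rintro _ ⟨e, f, h, rfl⟩
  classical
  rw [SetLike.mem_coe, AddMonoidHom.mem_ker, psi_mono]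
  by_cases he : e = c
  · by_cases hf : f = s
    · subst he hf; omega
    · simp [hf]
  · simp [he]

theorem psi_i₁_gen_pow_mul {g : AGen} {n : ℕ} (hg : c g < n) (z : RLTensor etaR AStar) :
    psi hc hs (i₁ (gen g ^ n) * z) = 0 := by
  induction z using rl_induction with
  | zero => simp
  | add x y hx hy => rw [mul_add, map_add, hx, hy, add_zero]
  | tmul x y => rw [tmul_eq, ← mul_assoc, ← map_mul, psi_mul, chi_gen_pow_mul hc hg, zero_mul]

end psi

/-- The leading terms of `primProd e` with trivial right-hand factor. -/
theorem primProd_sub_mem (e : AGen →₀ ℕ) : primProd e - i₁ (mono e) ∈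
    AddSubgroup.closure {t | ∃ f g : AGen →₀ ℕ, g ≠ 0 ∧ g ≤ e ∧
      t = i₁ (mono f) * i₂ (mono g)} := by
  induction e using exponent_induction with
  | zero => simp [primProd, mono_zero]
  | add_single e g ih =>
    rw [primProd_add, primProd_single, pow_one, mono_add, mono_single, pow_one, map_mul]
    have e₁ : primProd e * (i₁ (gen g) + i₂ (gen g)) - i₁ (mono e) * i₁ (gen g) =
        (primProd e - i₁ (mono e)) * (i₁ (gen g) + i₂ (gen g)) + i₁ (mono e) * i₂ (gen g) := by
      ring
    rw [e₁]
    refine add_mem ?_ (AddSubgroup.subset_closure ⟨e, Finsupp.single g 1, ?_, ?_, ?_⟩)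
    -- Multiplication by `x_g ⊗ 1` leaves the right-hand exponent unchanged, and multiplication by
    -- `1 ⊗ x_g` raises it by one at `g`. Either way it stays nonzero and bounded by the new total
    -- exponent.
    · generalize primProd e - i₁ (mono e) = z at ih
      induction ih using AddSubgroup.closure_induction with
      | mem x hx =>
        obtain ⟨f, k, hk, hle, rfl⟩ := hx
        rw [mul_add]
        refine add_mem
          (AddSubgroup.subset_closure ⟨f + Finsupp.single g 1, k, hk, hle.trans ?_, ?_⟩)
          (AddSubgroup.subset_closure ⟨f, k + Finsupp.single g 1, ?_, ?_, ?_⟩)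
        · exact le_self_add
        · rw [mono_add, mono_single, map_mul, pow_one]; ring
        · exact fun h => hk (by simpa using (add_eq_zero.1 h).1)
        · exact add_le_add_left hle _
        · rw [mono_add, mono_single, map_mul, pow_one]; ring
      | zero => rw [zero_mul]; exact zero_mem _
      | add x y _ _ hx hy => rw [add_mul]; exact add_mem hx hy
      | neg x _ hx => exact (neg_mul x _ : -x * _ = -(x * _)) ▸ neg_mem hx
    · simp
    · exact le_add_self
    · rw [mono_single, pow_one]

end AStar

/-! ### Leading coefficients of the coproduct on split monomials. -/

namespace ProfileFunction

variable {p : ProfileFunction}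

-- The heights are powers of two, so by Frobenius `(x ⊗ 1 + 1 ⊗ x)^b = x^b ⊗ 1 + 1 ⊗ x^b` for the
-- height `b` of `x`. All exponents of `s` are multiples of the heights, so only powers of `1 ⊗ x^b`
-- survive modulo the elements `x^b ⊗ 1`.
open AStar in
theorem primProd_sub_mem_span {s : AGen →₀ ℕ} (hs : ∀ g, p.bound g ∣ s g) :
    primProd s - i₂ (mono s) ∈
      Ideal.span {t | ∃ g, p.bound g ≠ 0 ∧ t = i₁ (gen g ^ p.bound g)} := by
  have hm : mono s = s.prod fun g n => gen g ^ n := by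
    rw [mono, MvPolynomial.monomial_eq, map_mul, map_one, map_one, one_mul, map_finsuppProd]
    simp only [map_pow]
    rfl
  rw [← Ideal.Quotient.eq, hm, primProd, map_finsuppProd, map_finsuppProd, map_finsuppProd]
  refine Finset.prod_congr rfl fun g hg => ?_
  obtain ⟨r, hr⟩ := hs g
  have h₀ : p.bound g ≠ 0 := by
    intro h
    rw [h, zero_mul] at hr
    exact (Finsupp.mem_support_iff.1 hg) hr
  obtain ⟨n, hn⟩ := exists_bound_eq_two_pow h₀
  have : (i₁ (gen g) + i₂ (gen g)) ^ p.bound g =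
      i₁ (gen g ^ p.bound g) + i₂ (gen g ^ p.bound g) := by
    rw [hn, add_pow_two_pow tensor_two_eq_zero, map_pow, map_pow]
  simp only [hr]
  have hz := Ideal.Quotient.eq_zero_iff_mem.2 (Ideal.subset_span
    (show i₁ (gen g ^ p.bound g) ∈ {t | ∃ g, p.bound g ≠ 0 ∧ t = i₁ (gen g ^ p.bound g)} from
      ⟨g, h₀, rfl⟩))
  rw [pow_mul, this, pow_mul, map_pow (Ideal.Quotient.mk _) _ r, map_add, hz, zero_add,
    map_pow i₂ _ r, map_pow (Ideal.Quotient.mk _) _ r]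

-- This is the unitriangularity behind the theorem: among the tensors `m_c ⊗ m_s` of polynomial
-- degree at most that of `m_{c'} m_{s'}`, only `m_{c'} ⊗ m_{s'}` occurs in the coproduct of that
-- monomial, modulo the augmentation ideal.
open Classical AStar in
theorem psi_comul_mono {c s c' s' : AGen →₀ ℕ} (hc : p.IsReduced c) (hs : ∀ g, p.bound g ∣ s g)
    (hs' : TauReduced s) (hc₀ : p.IsReduced c') (hs₀ : ∀ g, p.bound g ∣ s' g)
    (hdeg : c.degree + s.degree ≤ c'.degree + s'.degree) :
    psi hc.tauReduced hs' (comul (mono (c' + s'))) = if c' = c ∧ s' = s then 1 else 0 := by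
  -- The corrections to primitivity have polynomial degree larger than that of `c' + s'`, hence
  -- larger than that of the tensor `psi` detects.
  have h₁ : psi hc.tauReduced hs' (comul (mono (c' + s'))) =
      psi hc.tauReduced hs' (primProd (c' + s')) := by
    rw [← sub_eq_zero, ← map_sub]
    refine psi_eq_zero_of_mem_polyFil _ _ ?_ (comul_mono_sub_mem (c' + s')).2
    rw [map_add]
    omega
  -- The factor from `s'` is `1 ⊗ m_{s'}` up to multiples of `x_g^b ⊗ 1` with `b` the height of
  -- `x_g`; these cannot contribute to the reduced exponent `c` on the left.
  have h₂ : psi hc.tauReduced hs' (primProd (c' + s')) =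
      psi hc.tauReduced hs' (primProd c' * i₂ (mono s')) := by
    rw [← sub_eq_zero, ← map_sub, primProd_add, ← mul_sub]
    have := primProd_sub_mem_span hs₀
    generalize primProd s' - i₂ (mono s') = z at this
    generalize primProd c' = w
    induction this using Submodule.span_induction generalizing w with
    | mem z hz =>
      obtain ⟨g, hg, rfl⟩ := hz
      rw [mul_comm]
      exact psi_i₁_gen_pow_mul _ _ (hc.lt hg) _
    | zero => simp
    | add x y _ _ hx hy => rw [mul_add, map_add, hx, hy, add_zero]
    | smul r x _ hx => rw [smul_eq_mul, ← mul_assoc]; exact hx _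
  -- Every other term of the factor from `c'` moves a nonzero exponent `k ≤ c'` to the right.
  have h₃ : psi hc.tauReduced hs' (primProd c' * i₂ (mono s')) =
      psi hc.tauReduced hs' (i₁ (mono c') * i₂ (mono s')) := by
    rw [← sub_eq_zero, ← map_sub, ← sub_mul]
    have := primProd_sub_mem c'
    generalize primProd c' - i₁ (mono c') = z at this
    induction this using AddSubgroup.closure_induction with
    | mem z hz =>
      obtain ⟨f, k, hk, hle, rfl⟩ := hz
      rw [mul_assoc, ← map_mul, ← mono_add, psi_mono, if_neg (c := k + s' = s), mul_zero]
      rintro rfl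
      refine hk (Finsupp.ext fun g => ?_)
      -- If `k + s'` were `s`, then `k` would have exponents divisible by the heights. Being below
      -- `c'` it is also reduced, so it would vanish.
      have hd : p.bound g ∣ k g := (Nat.dvd_add_left (hs₀ g)).1 (hs g)
      rw [← (hc₀.mono hle) g]
      exact Nat.mod_eq_zero_of_dvd hd
    | zero => simp
    | add x y _ _ hx hy => rw [add_mul, map_add, hx, hy, add_zero]
    | neg x _ hx =>
      rw [(neg_mul x _ : -x * i₂ (mono s') = -(x * i₂ (mono s'))), map_neg, hx, neg_zero]
  rw [h₁, h₂, h₃, psi_mono]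
  by_cases h : c' = c <;> simp [h]

end ProfileFunction

/-! ### Homogeneous coordinates -/

section Homogeneous

variable {H M : Type*} [CommRing H] [AddCommGroup M] [Module H M]
  {𝒽 : RO → AddSubgroup H} {ℳ : RO → AddSubgroup M}

theorem component_mem {p : RO → M →+ M} (h₁ : ∀ d, ∀ x ∈ ℳ d, p d x = x)
    (h₂ : ∀ d e, d ≠ e → ∀ x ∈ ℳ d, p e x = 0)
    (h₃ : ∀ x : M, x ∈ AddSubgroup.closure {y | ∃ d, y ∈ ℳ d}) (d : RO) (x : M) :
    p d x ∈ ℳ d := by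
  have := h₃ x
  induction this using AddSubgroup.closure_induction with
  | mem x hx =>
    obtain ⟨e, he⟩ := hx
    by_cases hde : e = d
    · subst hde; rwa [h₁ _ _ he]
    · rw [h₂ _ _ hde _ he]; exact zero_mem _
  | zero => rw [map_zero]; exact zero_mem _
  | add x y _ _ hx hy => rw [map_add]; exact add_mem hx hy
  | neg x _ hx => rw [map_neg]; exact neg_mem hx

/-- Replace the coefficient of `x t` by its component of degree `d - δ t`. On the combination as a
whole this is the projection to degree `d`, which fixes it. The `x t` need not be independent, so
this also applies to a mere spanning family. -/
theorem exists_homogeneous_coeffs (h𝒽 : DirectSum.IsInternal 𝒽) (hℳ : DirectSum.IsInternal ℳ)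
    (hsmul : ∀ {d e : RO} {h : H} {m : M}, h ∈ 𝒽 d → m ∈ ℳ e → h • m ∈ ℳ (d + e))
    {T : Type*} {x : T → M} {δ : T → RO} (hx : ∀ t, x t ∈ ℳ (δ t)) {d : RO} (v : T →₀ H)
    (hv : Finsupp.linearCombination H x v ∈ ℳ d) :
    ∃ w : T →₀ H, (∀ t, w t ∈ 𝒽 (d - δ t)) ∧
      Finsupp.linearCombination H x w = Finsupp.linearCombination H x v := by
  obtain ⟨p, hp₁, hp₂, -⟩ := exists_components hℳ
  obtain ⟨q, hq₁, hq₂, hq₃⟩ := exists_components h𝒽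
  have hq : ∀ d h, q d h ∈ 𝒽 d := component_mem hq₁ hq₂ hq₃
  have key : ∀ t h, p d (h • x t) = q (d - δ t) h • x t := by
    intro t h
    have := hq₃ h
    induction this using AddSubgroup.closure_induction with
    | mem h hh =>
      obtain ⟨e, he⟩ := hh
      by_cases hde : e = d - δ t
      · have hm := hsmul he (hx t)
        rw [hde, sub_add_cancel] at hm
        rw [hp₁ _ _ hm, hq₁ _ _ (hde ▸ he)]
      · rw [hp₂ _ _ (fun h => hde (eq_sub_of_add_eq h)) _ (hsmul he (hx t)), hq₂ _ _ hde _ he,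
          zero_smul]
    | zero => rw [zero_smul, map_zero, map_zero, zero_smul]
    | add x y _ _ hx hy => rw [add_smul, map_add, hx, hy, map_add, add_smul]
    | neg x _ hx => rw [neg_smul, map_neg, hx, map_neg, neg_smul]
  refine ⟨Finsupp.onFinset v.support (fun t => q (d - δ t) (v t)) ?_, fun t => hq _ _, ?_⟩
  · intro t ht
    rw [Finsupp.mem_support_iff]
    intro h
    rw [h, map_zero] at ht
    exact ht rfl
  · rw [Finsupp.linearCombination_apply, Finsupp.onFinset_sum (g := fun t h => h • x t) _
      (fun t => zero_smul _ _)]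
    rw [← hp₁ d _ hv, Finsupp.linearCombination_apply, Finsupp.sum, map_sum]
    exact Finset.sum_congr rfl fun t _ => (key t _).symm

theorem repr_mem (h𝒽 : DirectSum.IsInternal 𝒽) (hℳ : DirectSum.IsInternal ℳ)
    (hsmul : ∀ {d e : RO} {h : H} {m : M}, h ∈ 𝒽 d → m ∈ ℳ e → h • m ∈ ℳ (d + e))
    {T : Type*} (b : Module.Basis T H M) {δ : T → RO} (hb : ∀ t, b t ∈ ℳ (δ t)) {d : RO} {m : M}
    (hm : m ∈ ℳ d) (t : T) : b.repr m t ∈ 𝒽 (d - δ t) := by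
  have hm' := hm
  rw [← b.linearCombination_repr m] at hm'
  obtain ⟨w, hw, e⟩ := exists_homogeneous_coeffs h𝒽 hℳ hsmul hb _ hm'
  rw [b.linearCombination_repr] at e
  rw [← e, b.repr_linearCombination]
  exact hw t

theorem mem_sup_of_repr {T : Type*} (b : Module.Basis T H M) {N : Ideal H} {f : T → ℕ} {n : ℕ}
    {m : M} (h : ∀ t, b.repr m t ∈ N ∨ f t < n) :
    m ∈ (N • ⊤ : Submodule H M) ⊔ Submodule.span H (b '' {t | f t < n}) := by
  rw [← b.linearCombination_repr m, Finsupp.linearCombination_apply]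
  refine sum_mem fun t _ => ?_
  rcases h t with h | h
  · exact Submodule.mem_sup_left (Submodule.smul_mem_smul h trivial)
  · exact Submodule.mem_sup_right (Submodule.smul_mem _ _ (Submodule.subset_span ⟨t, h, rfl⟩))

end Homogeneous

/-! ### A decreasing measure on monomials, and local nilpotence over the coefficient ring. -/

namespace AStar

/-- The degree in `RO(ℤ/2)` of a monomial. -/
def monoDeg : (AGen →₀ ℕ) →+ RO := Finsupp.weight AGen.deg

/-- Each generator has degree `p + qα` with `q ≤ p` and `p ≥ 1`. These bounds make the terms of
`measure` nonnegative, so that its truncation to natural numbers loses nothing. -/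
theorem monoDeg_bounds (e : AGen →₀ ℕ) :
    (monoDeg e).2 ≤ (monoDeg e).1 ∧ (e.degree : ℤ) ≤ (monoDeg e).1 := by
  induction e using exponent_induction with
  | zero => simp
  | add_single e g ih =>
    rw [map_add, map_add, Finsupp.degree_single]
    have : (monoDeg (Finsupp.single g 1)).2 ≤ (monoDeg (Finsupp.single g 1)).1 ∧
        1 ≤ (monoDeg (Finsupp.single g 1)).1 := by
      rw [monoDeg, Finsupp.weight_single, one_smul]
      cases g with
      | xi n =>
        simp only [AGen.deg, xiDeg, le_refl, true_and]
        have : (1 : ℤ) ≤ 2 ^ n := one_le_pow₀ (by norm_num)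
        rw [pow_succ]
        omega
      | tau n =>
        simp only [AGen.deg, tauDeg]
        have : (1 : ℤ) ≤ 2 ^ n := one_le_pow₀ (by norm_num)
        omega
    rw [Prod.fst_add, Prod.snd_add]
    push_cast
    omega

/-- A measure of monomials, which decreases under all maps that are the identity up to the
augmentation ideal and higher polynomial degree. -/
def measure (e : AGen →₀ ℕ) : ℕ :=
  -- For degree `p + qα` and polynomial degree `n`, this packs the lexicographic order on `(p - q, p
  -- - n)` into one number. Since `0 ≤ p - n ≤ p`, the weight `p + 1` dominates the second entry.
  -- The weight varies with the monomial, but `p` never increases in the comparisons made here.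
  (((monoDeg e).1 - (monoDeg e).2) * ((monoDeg e).1 + 1) + ((monoDeg e).1 - e.degree)).toNat

/-- Outside the negative cone the degree of `h` is that of some `a^i u^j`. Passing from `s` to `t`
then does not raise `p`, and strictly lowers `p - q` unless the degrees agree; in that case the
polynomial degree has to grow. -/
theorem measure_lt {s t : AGen →₀ ℕ} {h : HF} (hh : h ∈ HF.deg (monoDeg s - monoDeg t))
    (hN : h ∉ HF.negCone) (hdeg : HF.rho h ≠ 0 → s.degree < t.degree) :
    measure t < measure s := by
  have hd : 0 ≤ (monoDeg s - monoDeg t).1 ∧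
      (monoDeg s - monoDeg t).1 + (monoDeg s - monoDeg t).2 ≤ 0 := by
    by_contra hd
    exact hN (HF.mem_negCone_of_deg hd hh)
  rw [Prod.fst_sub, Prod.snd_sub] at hd
  have hs := monoDeg_bounds s
  have ht := monoDeg_bounds t
  -- In degree zero, not being in the negative cone means that `rho` is nonzero.
  have hzero : monoDeg s = monoDeg t → s.degree < t.degree := by
    intro e
    refine hdeg fun hρ => hN (HF.mem_negCone_of_deg_zero ?_ hρ)
    rwa [e, sub_self] at hh
  have hcase : ((monoDeg s).1 = (monoDeg t).1 ∧ (monoDeg s).2 = (monoDeg t).2 ∧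
      (s.degree : ℤ) < t.degree) ∨ (monoDeg s).2 < (monoDeg t).2 := by
    by_cases e : monoDeg s = monoDeg t
    · exact Or.inl ⟨by rw [e], by rw [e], by exact_mod_cast hzero e⟩
    · right
      by_contra hlt
      exact e (Prod.ext (by omega) (by omega))
  have hs₀ : (0 : ℤ) ≤ s.degree := Int.natCast_nonneg _
  have ht₀ : (0 : ℤ) ≤ t.degree := Int.natCast_nonneg _
  unfold measure
  generalize (monoDeg s).1 = p, (monoDeg s).2 = q, (monoDeg t).1 = p', (monoDeg t).2 = q',
    (s.degree : ℤ) = n, (t.degree : ℤ) = n' at *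
  have hlt : (p' - q') * (p' + 1) + (p' - n') < (p - q) * (p + 1) + (p - n) := by
    rcases hcase with ⟨rfl, rfl, h⟩ | h
    · omega
    -- The first summand drops by at least `p + 1`, while the second can reach at most `p' ≤ p`.
    · have h₁ : (p' - q') * (p' + 1) ≤ (p - q - 1) * (p + 1) :=
        mul_le_mul (by omega) (by omega) (by omega) (by omega)
      have h₂ : (p - q - 1) * (p + 1) = (p - q) * (p + 1) - (p + 1) := by ring
      omega
  have h₀ : 0 ≤ (p' - q') * (p' + 1) := mul_nonneg (by omega) (by omega)
  omega

/-- A Nakayama principle for homogeneous matrices: only the entries that survive modulo the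
augmentation ideal need to be triangular, and there the polynomial degree must rise. All other
entries are controlled by their degrees. -/
theorem exists_pow_apply_eq_zero_of_repr {F T : Type*} [AddCommGroup F] [Module HF F]
    (ι : T → (AGen →₀ ℕ)) (b : Module.Basis T HF F) {E : F →ₗ[HF] F}
    (h₁ : ∀ s t, b.repr (E (b s)) t ∈ HF.deg (monoDeg (ι s) - monoDeg (ι t)))
    (h₂ : ∀ s t, HF.rho (b.repr (E (b s)) t) ≠ 0 → (ι s).degree < (ι t).degree) (v : F) :
    ∃ n, (E ^ n) v = 0 := by
  refine exists_pow_apply_eq_zero HF.negCone_mul_negCone b.span_eq (fun t => measure (ι t))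
    (fun s => mem_sup_of_repr b fun t => ?_) v
  by_cases h : b.repr (E (b s)) t ∈ HF.negCone
  · exact Or.inl h
  · exact Or.inr (measure_lt (h₁ s t) h (h₂ s t))

end AStar

/-! ### Bases of reduced monomials -/

theorem smul_mem_quotDeg (I : Ideal AStar) {d e : RO} {h : HF} {m : AStar ⧸ I}
    (hh : h ∈ HF.deg d) (hm : m ∈ quotDeg AStar.deg I e) :
    h • m ∈ quotDeg AStar.deg I (d + e) := by
  obtain ⟨x, hx, rfl⟩ := hm
  exact ⟨AStar.etaL h * x, AStar.isMulFamily_deg.mul_mem (AStar.etaL_mem hh) hx,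
    congrArg (Ideal.Quotient.mk I) (Algebra.smul_def h x).symm⟩

namespace ProfileFunction

variable {p : ProfileFunction}

theorem redMono_mem (t : p.Reduced) :
    p.redMono t ∈ quotDeg AStar.deg p.ideal (AStar.monoDeg t) :=
  mk_mem_quotDeg _ (AStar.mono_mem t)

/-- The functional `chi t` vanishes on the ideal and is dual to the monomial `t`. So, modulo the
augmentation ideal, the coefficients of an element of the quotient in reduced monomials are
determined, even before these are known to be independent. -/
theorem rho_eq_chi {v : p.Reduced →₀ HF} {x : AStar}
    (h : Finsupp.linearCombination HF p.redMono v = Ideal.Quotient.mk p.ideal x) (t : p.Reduced) :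
    HF.rho (v t) = AStar.chi t t.2.tauReduced x := by
  have e : Ideal.Quotient.mk p.ideal (Finsupp.linearCombination HF (fun t => AStar.mono t.1) v) =
      Ideal.Quotient.mk p.ideal x := by
    rw [← h]
    exact Finsupp.apply_linearCombination HF (Ideal.Quotient.mkₐ HF p.ideal).toLinearMap _ v
  have := chi_eq_zero_of_mem_ideal t.2 (Ideal.Quotient.eq.1 e)
  rw [map_sub, sub_eq_zero] at this
  rw [← this, Finsupp.linearCombination_apply, Finsupp.sum, map_sum]
  classical
  rw [Finset.sum_eq_single t]
  · rw [Algebra.smul_def]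
    exact (by rw [AStar.chi_etaL_mul, AStar.chi_mono, if_pos rfl, mul_one] :
      AStar.chi t.1 t.2.tauReduced (AStar.etaL (v t) * AStar.mono t.1) = HF.rho (v t)).symm
  · intro s _ hs
    rw [Algebra.smul_def]
    refine (AStar.chi_etaL_mul _ _ _).trans ?_
    rw [AStar.chi_mono, if_neg (fun h => hs (Subtype.ext h)), mul_zero]
  · intro ht
    rw [Finsupp.notMem_support_iff.1 ht, zero_smul, map_zero]

/-- A surjection `P` onto a graded free module has a homogeneous section `σ`, and `id - σ P` is an
idempotent with image the module of relations. Its matrix vanishes modulo the augmentation ideal, so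
it is locally nilpotent; being idempotent, it is zero. Without freeness a generator such as `τ_i^4`
could impose an honest relation with coefficients in the augmentation ideal. -/
theorem linearIndependent_redMono (hp : AStar.hopfAlgebroid.IsHopfIdeal p.ideal)
    (free : IsGradedFree HF (quotDeg AStar.deg p.ideal)) :
    LinearIndependent HF p.redMono := by
  obtain ⟨S, b, hb⟩ := free
  choose δ hδ using hb
  have hℳ := (isGrading_quotDeg AStar.isGrading_deg hp.homogeneous).isInternal
  have h𝒽 := HF.isGrading_deg.isInternal
  set P := Finsupp.linearCombination HF p.redMono with hP
  -- Homogeneous lifts of the homogeneous basis, so that the section preserves degrees.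
  have hw : ∀ i, ∃ w : p.Reduced →₀ HF, (∀ t : p.Reduced, w t ∈ HF.deg (δ i - AStar.monoDeg t)) ∧
      P w = b i := by
    intro i
    obtain ⟨v, hv⟩ : b i ∈ LinearMap.range P := by
      rw [hP, Finsupp.range_linearCombination, span_redMono]; trivial
    rw [← hv]
    exact exists_homogeneous_coeffs h𝒽 hℳ (smul_mem_quotDeg p.ideal) redMono_mem v
      (by rw [← hP, hv]; exact hδ i)
  choose w hw hPw using hw
  let σ : (AStar ⧸ p.ideal) →ₗ[HF] (p.Reduced →₀ HF) := b.constr HF w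
  have hPσ : ∀ x, P (σ x) = x := by
    intro x
    have : P ∘ₗ σ = LinearMap.id := b.ext fun i => by
      rw [LinearMap.comp_apply, b.constr_basis, hPw, LinearMap.id_apply]
    exact LinearMap.congr_fun this x
  have hσ : ∀ {d x}, x ∈ quotDeg AStar.deg p.ideal d →
      ∀ t : p.Reduced, σ x t ∈ HF.deg (d - AStar.monoDeg t) := by
    intro d x hx t
    rw [b.constr_apply, Finsupp.sum, Finsupp.finsetSum_apply]
    refine sum_mem fun i _ => ?_
    have := HF.isGrading_deg.mul_mem
      (repr_mem h𝒽 hℳ (smul_mem_quotDeg p.ideal) b hδ hx i) (hw i t)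
    rwa [sub_add_sub_cancel] at this
  -- All positive powers of this projection coincide with it, so it is zero as soon as some power
  -- kills each vector.
  let E : (p.Reduced →₀ HF) →ₗ[HF] (p.Reduced →₀ HF) := LinearMap.id - σ ∘ₗ P
  have hPE : ∀ v, P (E v) = 0 := by
    intro v
    rw [LinearMap.sub_apply, map_sub, LinearMap.comp_apply, hPσ, LinearMap.id_apply, sub_self]
  have hEE : ∀ v n, (E ^ (n + 1)) v = E v := by
    intro v n
    induction n with
    | zero => rw [zero_add, pow_one]
    | succ n ih =>
      rw [pow_succ', Module.End.mul_apply, ih]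
      change E v - σ (P (E v)) = E v
      rw [hPE, map_zero, sub_zero]
  have hE : ∀ v, E v = 0 := by
    intro v
    suffices h : ∃ n, (E ^ n) v = 0 by
      obtain ⟨n, hn⟩ := h
      rw [← hEE v n, pow_succ', Module.End.mul_apply, hn, map_zero]
    refine AStar.exists_pow_apply_eq_zero_of_repr (fun t : p.Reduced => t.1)
      Finsupp.basisSingleOne ?_ ?_ v
    · intro s t
      rw [Finsupp.coe_basisSingleOne, Finsupp.basisSingleOne_repr, LinearEquiv.refl_apply]
      change (Finsupp.single s 1 - σ (P (Finsupp.single s 1)) : p.Reduced →₀ HF) t ∈ _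
      rw [Finsupp.sub_apply]
      refine sub_mem ?_ (hσ ?_ t)
      · classical
        rw [Finsupp.single_apply]
        split_ifs with h
        · rw [h, sub_self]
          exact HF.isGrading_deg.one_mem
        · exact zero_mem _
      · rw [hP, Finsupp.linearCombination_single, one_smul]
        exact redMono_mem s
    -- Nothing survives modulo the augmentation ideal: the image of `E` consists of relations, and
    -- `rho_eq_chi` applied to the representative `0` makes their coefficients vanish under `rho`.
    · intro s t h
      refine absurd ?_ h
      rw [Finsupp.basisSingleOne_repr, LinearEquiv.refl_apply,
        rho_eq_chi (x := 0) ((hPE _).trans (map_zero _).symm), map_zero]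
  rw [linearIndependent_iff]
  intro v hv
  have := hE v
  rwa [LinearMap.sub_apply, LinearMap.comp_apply, hP, hv, map_zero, sub_zero] at this

/-- The basis of reduced monomials. -/
def redBasis (hp : AStar.hopfAlgebroid.IsHopfIdeal p.ideal)
    (free : IsGradedFree HF (quotDeg AStar.deg p.ideal)) :
    Module.Basis p.Reduced HF (AStar ⧸ p.ideal) :=
  Module.Basis.mk (linearIndependent_redMono hp free) span_redMono.ge

theorem redBasis_apply (hp : AStar.hopfAlgebroid.IsHopfIdeal p.ideal)
    (free : IsGradedFree HF (quotDeg AStar.deg p.ideal)) (t : p.Reduced) :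
    redBasis hp free t = p.redMono t := Module.Basis.mk_apply ..

theorem rho_redBasis_repr (hp : AStar.hopfAlgebroid.IsHopfIdeal p.ideal)
    (free : IsGradedFree HF (quotDeg AStar.deg p.ideal)) (x : AStar) (t : p.Reduced) :
    HF.rho ((redBasis hp free).repr (Ideal.Quotient.mk p.ideal x) t) =
      AStar.chi t t.2.tauReduced x := by
  refine rho_eq_chi ?_ t
  have := (redBasis hp free).linearCombination_repr (Ideal.Quotient.mk p.ideal x)
  rwa [show ⇑(redBasis hp free) = p.redMono from funext (redBasis_apply hp free)] at this

theorem redBasis_repr_mem (hp : AStar.hopfAlgebroid.IsHopfIdeal p.ideal)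
    (free : IsGradedFree HF (quotDeg AStar.deg p.ideal)) {d : RO} {x : AStar ⧸ p.ideal}
    (hx : x ∈ quotDeg AStar.deg p.ideal d) (t : p.Reduced) :
    (redBasis hp free).repr x t ∈ HF.deg (d - AStar.monoDeg t) :=
  repr_mem HF.isGrading_deg.isInternal
    (isGrading_quotDeg AStar.isGrading_deg hp.homogeneous).isInternal (smul_mem_quotDeg p.ideal)
    (redBasis hp free) (δ := fun t => AStar.monoDeg t)
    (fun t => by rw [redBasis_apply]; exact redMono_mem t) hx t

end ProfileFunction

/-! ### The projection between quotient Hopf algebroids -/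

section Factor

variable {H A : Type*} [CommRing H] [CommRing A] [Algebra H A]
  {𝒽 : RO → AddSubgroup H} {𝒶 : RO → AddSubgroup A}

/-- The projection `A/I → A/J` for Hopf algebroid ideals `I ⊆ J`. -/
def HopfAlgebroid.factorHom (𝓐 : HopfAlgebroid 𝒽 𝒶) {I J : Ideal A} (hI : 𝓐.IsHopfIdeal I)
    (hJ : 𝓐.IsHopfIdeal J) (h : I ≤ J) : (𝓐.quotient I hI).Hom (𝓐.quotient J hJ) where
  toAlgHom := Ideal.Quotient.factorₐ H h
  map_mem := by
    rintro d _ ⟨x, hx, rfl⟩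
    exact mk_mem_quotDeg J hx
  map_etaR _ := rfl
  map_comul x := by
    obtain ⟨x, rfl⟩ := Ideal.Quotient.mk_surjective x
    let g := Ideal.Quotient.factorₐ H h
    have hg : ∀ y, g.toRingHom (𝓐.quotEtaR I y) = 𝓐.quotEtaR J y := fun _ => rfl
    have : 𝓐.quotTensor J =
        (rlMap (𝓐.quotEtaR I) (𝓐.quotEtaR J) g.toRingHom hg g).comp (𝓐.quotTensor I) := by
      refine rl_hom_ext (fun y => ?_) (fun y => ?_)
      · rw [RingHom.comp_apply, 𝓐.quotTensor_inl, 𝓐.quotTensor_inl, rlMap_inl]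
        rfl
      · rw [RingHom.comp_apply, 𝓐.quotTensor_inr, 𝓐.quotTensor_inr, rlMap_inr]
        rfl
    exact RingHom.congr_fun this (𝓐.comul x)
  map_counit x := by
    obtain ⟨x, rfl⟩ := Ideal.Quotient.mk_surjective x
    rfl
  map_antipode x := by
    obtain ⟨x, rfl⟩ := Ideal.Quotient.mk_surjective x
    rfl

theorem HopfAlgebroid.factorHom_mk (𝓐 : HopfAlgebroid 𝒽 𝒶) {I J : Ideal A}
    (hI : 𝓐.IsHopfIdeal I) (hJ : 𝓐.IsHopfIdeal J) (h : I ≤ J) (x : A) :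
    (𝓐.factorHom hI hJ h).toAlgHom (Ideal.Quotient.mk I x) = Ideal.Quotient.mk J x := rfl

end Factor

/-! ### Maps into cofree comodules -/

section Cofree

variable {H C : Type*} [CommRing H] [CommRing C] [Algebra H C]
  {𝒽 : RO → AddSubgroup H} {𝒸 : RO → AddSubgroup C} (𝓒 : HopfAlgebroid 𝒽 𝒸)

open Classical in
/-- The cofree comodule on `H{S}` is a direct sum of copies of `C`. -/
def Extended.finsuppEquiv (S : Type*) : Extended 𝓒 (S →₀ H) ≃ₗ[H] (S →₀ C) :=
  letI e : Extended 𝓒 (S →₀ H) ≃+ (S →₀ C) := ((Extended.of 𝓒 (S →₀ H)).symm.trans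
    (TensorProduct.finsuppScalarRight H H (ViaRight 𝓒.etaR) S).toAddEquiv).trans
    (Finsupp.mapRange.addEquiv (toRight 𝓒.etaR).symm.toAddEquiv)
  have he : ∀ x v s, e (Extended.tmul 𝓒 x v) s = 𝓒.etaR (v s) * x := fun x v s =>
    TensorProduct.finsuppScalarRight_apply_tmul_apply (S := H) (toRight 𝓒.etaR x) v s
  { e with
    map_smul' := fun h t => by
      change e (h • t) = h • e t
      induction t using Extended.induction with
      | h₀ => rw [smul_zero, map_zero, smul_zero]
      | ha s t hs ht => rw [smul_add, map_add, map_add, hs, ht, smul_add]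
      | ht x m =>
        ext s
        rw [Extended.smul_tmul, he, Finsupp.smul_apply, he, Algebra.smul_def]
        ring }

variable {𝓒}

open Classical in
theorem Extended.finsuppEquiv_tmul {S : Type*} (x : C) (v : S →₀ H) (s : S) :
    Extended.finsuppEquiv 𝓒 S (Extended.tmul 𝓒 x v) s = 𝓒.etaR (v s) * x :=
  TensorProduct.finsuppScalarRight_apply_tmul_apply (S := H) (toRight 𝓒.etaR x) v s

theorem apply_mem_of_mem_freeDeg {S : Type*} {deg : S → RO} {d : RO} {v : S →₀ H}
    (hv : v ∈ freeDeg 𝒽 deg d) (s : S) : v s ∈ 𝒽 (d - deg s) := by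
  induction hv using AddSubgroup.closure_induction with
  | mem v hv =>
    classical
    obtain ⟨t, e, rfl, h, hh, rfl⟩ := hv
    rw [Finsupp.single_apply]
    split_ifs with hts
    · rwa [hts, add_sub_cancel_right]
    · exact zero_mem _
  | zero => exact zero_mem _
  | add v w _ _ hv hw => exact add_mem hv hw
  | neg v _ hv => exact neg_mem hv

theorem mem_freeDeg {S : Type*} {deg : S → RO} {d : RO} {v : S →₀ H}
    (hv : ∀ s, v s ∈ 𝒽 (d - deg s)) : v ∈ freeDeg 𝒽 deg d := by
  rw [← v.sum_single]
  exact sum_mem fun s _ => AddSubgroup.subset_closure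
    ⟨s, d - deg s, sub_add_cancel _ _, v s, hv s, rfl⟩

theorem Extended.finsuppEquiv_apply_mem {S : Type*} {deg : S → RO} {d : RO}
    {t : Extended 𝓒 (S →₀ H)}
    (ht : (Extended.of 𝓒 (S →₀ H)).symm t ∈ tensorDeg 𝓒.etaR 𝒸 (freeDeg 𝒽 deg) d) (s : S) :
    Extended.finsuppEquiv 𝓒 S t s ∈ 𝒸 (d - deg s) := by
  obtain ⟨t, rfl⟩ := (Extended.of 𝓒 (S →₀ H)).surjective t
  rw [AddEquiv.symm_apply_apply] at ht
  induction ht using AddSubgroup.closure_induction with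
  | mem t ht =>
    obtain ⟨i, j, rfl, x, hx, m, hm, rfl⟩ := ht
    change Extended.finsuppEquiv 𝓒 S (Extended.tmul 𝓒 x m) s ∈ _
    rw [Extended.finsuppEquiv_tmul, show i + j - deg s = (j - deg s) + i by abel]
    exact 𝓒.grading.mul_mem (𝓒.etaR_mem _ _ (apply_mem_of_mem_freeDeg hm s)) hx
  | zero => rw [map_zero, map_zero]; exact zero_mem _
  | add v w _ _ hv hw => rw [map_add, map_add]; exact add_mem hv hw
  | neg v _ hv => rw [map_neg, map_neg]; exact neg_mem hv

variable {B : Type*} [CommRing B] [Algebra H B] {𝒷 : RO → AddSubgroup B} {𝓑 : HopfAlgebroid 𝒽 𝒷}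

/-- The comodule map `B → C ⊗_H M` with component `q : B → M`. -/
def HopfAlgebroid.Hom.toCofree (f : 𝓑.Hom 𝓒) {M : Type*} [AddCommGroup M] [Module H M]
    (q : B →ₗ[H] M) : B →ₗ[H] Extended 𝓒 M := Extended.map q ∘ₗ f.coaction

/-- Coassociativity of the coaction on `B` together with naturality of `Δ ⊗ id`; this is one half of
the universal property of cofree comodules. -/
theorem HopfAlgebroid.Hom.map_toCofree (f : 𝓑.Hom 𝓒) {M : Type*} [AddCommGroup M] [Module H M]
    (q : B →ₗ[H] M) (b : B) : Extended.map (f.toCofree q) (f.comodule.coaction b) =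
      (cofreeComodule 𝓒 M).coaction (f.toCofree q b) := by
  change _ = Extended.coact 𝓒 M (Extended.map q (f.coaction b))
  rw [Extended.coact_map]
  exact (Extended.map_map (Extended.map q) f.coaction _).symm.trans
    (congrArg (Extended.map (Extended.map q)) (f.comodule.coassoc b))

theorem HopfAlgebroid.Hom.toCofree_mem (f : 𝓑.Hom 𝓒) {M : Type*} [AddCommGroup M] [Module H M]
    {ℳ : RO → AddSubgroup M} {q : B →ₗ[H] M} (hq : ∀ d, ∀ b ∈ 𝒷 d, q b ∈ ℳ d) {d : RO} {b : B}
    (hb : b ∈ 𝒷 d) : (Extended.of 𝓒 M).symm (f.toCofree q b) ∈ tensorDeg 𝓒.etaR 𝒸 ℳ d := by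
  have ht := 𝓑.comul_mem d b hb
  change (Extended.of 𝓒 M).symm (Extended.map q (Extended.of 𝓒 B
    (rlMap 𝓑.etaR 𝓒.etaR f.toAlgHom.toRingHom f.map_etaR (AlgHom.id H B) (𝓑.comul b)))) ∈ _
  generalize 𝓑.comul b = t at ht
  induction ht using AddSubgroup.closure_induction with
  | mem t ht =>
    obtain ⟨i, j, hij, x, hx, y, hy, rfl⟩ := ht
    rw [rlMap_tmul]
    exact AddSubgroup.subset_closure
      ⟨i, j, hij, f.toAlgHom x, f.map_mem _ _ hx, q y, hq _ _ hy, rfl⟩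
  | zero => simp only [map_zero]; exact zero_mem _
  | add v w _ _ hv hw => simp only [map_add]; exact add_mem hv hw
  | neg v _ hv => simp only [map_neg]; exact neg_mem hv

/-- Only the converse direction for degrees needs an argument. A degree-preserving injection into a
sum of shifted copies of `C` commutes with taking components, so an element with homogeneous image
equals its own component of that degree. -/
theorem HopfAlgebroid.Hom.isCofree_of_bijective (f : 𝓑.Hom 𝓒) {S : Type} (deg : S → RO)
    (q : B →ₗ[H] (S →₀ H)) (hq : ∀ d, ∀ b ∈ 𝒷 d, q b ∈ freeDeg 𝒽 deg d)
    (hbij : Function.Bijective (f.toCofree q)) : f.comodule.IsCofree 𝒷 := by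
  refine ⟨S, deg, LinearEquiv.ofBijective (f.toCofree q) hbij, f.map_toCofree q, fun d b =>
    ⟨f.toCofree_mem hq, fun hb => ?_⟩⟩
  rw [LinearEquiv.ofBijective_apply] at hb
  obtain ⟨p, hp₁, hp₂, hp₃⟩ := exists_components 𝓑.grading.isInternal
  obtain ⟨r, hr₁, hr₂, -⟩ := exists_components 𝓒.grading.isInternal
  let Φ : B →+ (S →₀ C) := ((Extended.finsuppEquiv 𝓒 S).toLinearMap ∘ₗ f.toCofree q).toAddMonoidHom
  have hΦ : ∀ d, ∀ b ∈ 𝒷 d, ∀ s, Φ b s ∈ 𝒸 (d - deg s) := fun d b hb s =>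
    Extended.finsuppEquiv_apply_mem (f.toCofree_mem hq hb) s
  have hcomp : ∀ s, r (d - deg s) (Φ b s) = Φ (p d b) s := by
    intro s
    have := hp₃ b
    clear hb
    induction this using AddSubgroup.closure_induction with
    | mem b hb =>
      obtain ⟨e, he⟩ := hb
      by_cases hde : e = d
      · subst hde
        rw [hp₁ _ _ he, hr₁ _ _ (hΦ _ _ he s)]
      · rw [hp₂ _ _ hde _ he, hr₂ _ _ (fun h => hde (sub_left_inj.1 h)) _ (hΦ _ _ he s), map_zero]
        rfl
    | zero => simp
    | add x y _ _ hx hy => simp only [map_add, Finsupp.add_apply, hx, hy]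
    | neg x _ hx => simp only [map_neg, Finsupp.neg_apply, hx]
  have hinj : Function.Injective Φ := (Extended.finsuppEquiv 𝓒 S).injective.comp hbij.1
  have e : p d b = b := by
    refine hinj (Finsupp.ext fun s => ?_)
    rw [← hcomp s]
    exact hr₁ _ _ (Extended.finsuppEquiv_apply_mem hb s)
  exact e ▸ component_mem hp₁ hp₂ hp₃ d b

end Cofree

namespace ProfileFunction

variable {pB pC : ProfileFunction}

/-! ### Splitting reduced monomials -/

variable (pB pC) in
/-- The exponents of the monomials on which the quotient by `I(pB)` is cofree over the quotient by
`I(pC)`. -/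
abbrev CofreeGen : Type := {s : pB.Reduced // ∀ g, pC.bound g ∣ s.1 g}

/-- The remainders of the exponents `e`. -/
def remainder (p : ProfileFunction) (e : AGen →₀ ℕ) : AGen →₀ ℕ :=
  Finsupp.onFinset e.support (fun g => e g % p.bound g) fun g hg => by
    rw [Finsupp.mem_support_iff]
    intro h
    rw [h, Nat.zero_mod] at hg
    exact hg rfl

theorem remainder_apply (p : ProfileFunction) (e : AGen →₀ ℕ) (g : AGen) :
    p.remainder e g = e g % p.bound g := rfl

theorem remainder_le (p : ProfileFunction) (e : AGen →₀ ℕ) : p.remainder e ≤ e := fun _ =>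
  Nat.mod_le _ _

theorem remainder_add {c s : AGen →₀ ℕ} (hc : pC.IsReduced c) (hs : ∀ g, pC.bound g ∣ s g) :
    pC.remainder (c + s) = c := by
  ext g
  obtain ⟨r, hr⟩ := hs g
  rw [remainder_apply, Finsupp.add_apply, hr, Nat.add_mul_mod_self_left, hc g]

/-- No carry can occur: the heights of `pC` divide those of `pB`, and a multiple of the former
strictly below the latter leaves room for any remainder. -/
theorem isReduced_add (hle : pC ≤ pB) {c s : AGen →₀ ℕ} (hc : pC.IsReduced c)
    (hs : ∀ g, pC.bound g ∣ s g) (hs' : pB.IsReduced s) : pB.IsReduced (c + s) := by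
  intro g
  by_cases hB : pB.bound g = 0
  · rw [hB, Nat.mod_zero]
  · refine Nat.mod_eq_of_lt ?_
    obtain ⟨k, hk⟩ := bound_dvd_bound hle g
    obtain ⟨r, hr⟩ := hs g
    have h₀ : pC.bound g ≠ 0 := fun h => hB (by rw [hk, h, zero_mul])
    have h₁ := hc.lt h₀
    have h₂ := hs'.lt hB
    rw [hk, hr] at h₂
    have h₃ : r + 1 ≤ k := Nat.lt_of_mul_lt_mul_left h₂
    rw [Finsupp.add_apply, hk, hr]
    calc c g + pC.bound g * r < pC.bound g + pC.bound g * r := by omega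
      _ = pC.bound g * (r + 1) := by ring
      _ ≤ pC.bound g * k := Nat.mul_le_mul_left _ h₃

/-- A monomial reduced with respect to `pB` is uniquely a product of one in the generators of the
cofree comodule and one that is reduced with respect to `pC`. -/
def splitEquiv (hle : pC ≤ pB) : (Σ _ : pB.CofreeGen pC, pC.Reduced) ≃ pB.Reduced where
  toFun x := ⟨x.2.1 + x.1.1.1, isReduced_add hle x.2.2 x.1.2 x.1.1.2⟩
  invFun e := ⟨⟨⟨e.1 - pC.remainder e, e.2.mono tsub_le_self⟩, fun g => by
    rw [Finsupp.tsub_apply, remainder_apply]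
    exact Nat.dvd_sub_mod _⟩, ⟨pC.remainder e, fun g => by
    rw [remainder_apply, Nat.mod_mod]⟩⟩
  left_inv := by
    rintro ⟨⟨⟨s, hs⟩, hs'⟩, ⟨c, hc⟩⟩
    simp only [remainder_add hc hs', add_tsub_cancel_left]
  right_inv e := Subtype.ext (add_tsub_cancel_of_le (pC.remainder_le e))

/-! ### The isomorphism with a cofree comodule -/

section Cofree

variable (hle : pC ≤ pB) (hB : AStar.hopfAlgebroid.IsHopfIdeal pB.ideal)
  (hC : AStar.hopfAlgebroid.IsHopfIdeal pC.ideal)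
  (freeB : IsGradedFree HF (quotDeg AStar.deg pB.ideal))

/-- The projection of the quotient by `I(pB)` to the span of the generators of the cofree
comodule. -/
def genProj : (AStar ⧸ pB.ideal) →ₗ[HF] (pB.CofreeGen pC →₀ HF) :=
  Finsupp.lcomapDomain Subtype.val Subtype.val_injective ∘ₗ (redBasis hB freeB).repr.toLinearMap

theorem genProj_mem {d : RO} {x : AStar ⧸ pB.ideal} (hx : x ∈ quotDeg AStar.deg pB.ideal d) :
    genProj (pC := pC) hB freeB x ∈ freeDeg HF.deg (fun s => AStar.monoDeg s.1.1) d :=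
  mem_freeDeg fun s => redBasis_repr_mem hB freeB hx s.1

/-- The projection of quotient Hopf algebroids. -/
abbrev proj : (AStar.hopfAlgebroid.quotient pB.ideal hB).Hom
    (AStar.hopfAlgebroid.quotient pC.ideal hC) :=
  AStar.hopfAlgebroid.factorHom hB hC (ideal_le_ideal hle)

/-- The comodule map to `C ⊗_H H{S}`, identified with a direct sum of copies of `C`. -/
def toSum : (AStar ⧸ pB.ideal) →ₗ[HF] (pB.CofreeGen pC →₀ AStar ⧸ pC.ideal) :=
  (Extended.finsuppEquiv (AStar.hopfAlgebroid.quotient pC.ideal hC) _).toLinearMap ∘ₗ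
    (proj hle hB hC).toCofree (genProj hB freeB)

theorem toSum_mem {d : RO} {x : AStar ⧸ pB.ideal} (hx : x ∈ quotDeg AStar.deg pB.ideal d)
    (s : pB.CofreeGen pC) :
    toSum hle hB hC freeB x s ∈ quotDeg AStar.deg pC.ideal (d - AStar.monoDeg s.1.1) :=
  Extended.finsuppEquiv_apply_mem (deg := fun s : pB.CofreeGen pC => AStar.monoDeg s.1.1)
    ((proj hle hB hC).toCofree_mem (fun _ _ h => genProj_mem hB freeB h) hx) s

/-- Links the matrix of the comodule map to the coproduct of the dual Steenrod algebra itself. Both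
sides are additive functionals of `Δ x`, so they can be compared on pure tensors, independently of
the coproduct formulas. -/
theorem rho_repr_toSum (freeC : IsGradedFree HF (quotDeg AStar.deg pC.ideal))
    (x : AStar) (s : pB.CofreeGen pC) (c : pC.Reduced) :
    HF.rho ((redBasis hC freeC).repr
      (toSum hle hB hC freeB (Ideal.Quotient.mk pB.ideal x) s) c) =
      AStar.psi c.2.tauReduced s.1.2.tauReduced (AStar.comul x) := by
  let 𝓑 := AStar.hopfAlgebroid.quotient pB.ideal hB
  let 𝓒 := AStar.hopfAlgebroid.quotient pC.ideal hC
  let f := proj hle hB hC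
  let Λ : RLTensor 𝓒.etaR (AStar ⧸ pB.ideal) →+ ZMod 2 :=
    HF.rho.toAddMonoidHom.comp <| (Finsupp.applyAddHom c).comp <|
      (redBasis hC freeC).repr.toLinearMap.toAddMonoidHom.comp <| (Finsupp.applyAddHom s).comp <|
      (Extended.finsuppEquiv 𝓒 (pB.CofreeGen pC)).toLinearMap.toAddMonoidHom.comp <|
      (Extended.map (genProj hB freeB)).toAddMonoidHom.comp (Extended.of 𝓒 _).toAddMonoidHom
  let M : RLTensor 𝓑.etaR (AStar ⧸ pB.ideal) →+* RLTensor 𝓒.etaR (AStar ⧸ pB.ideal) :=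
    rlMap 𝓑.etaR 𝓒.etaR f.toAlgHom.toRingHom f.map_etaR (AlgHom.id HF _)
  let Q : RLTensor AStar.etaR AStar →+* RLTensor 𝓑.etaR (AStar ⧸ pB.ideal) :=
    AStar.hopfAlgebroid.quotTensor pB.ideal
  change Λ (M (Q (AStar.comul x))) = _
  generalize AStar.comul x = z
  induction z using rl_induction with
  | zero => simp only [map_zero]
  | add y z hy hz => simp only [map_add, hy, hz]
  | tmul x y =>
    have e₁ : Q (toRight AStar.etaR x ⊗ₜ[HF] y) =
        toRight 𝓑.etaR (Ideal.Quotient.mk pB.ideal x) ⊗ₜ[HF] Ideal.Quotient.mk pB.ideal y :=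
      rlMap_tmul ..
    have e₂ : M (toRight 𝓑.etaR (Ideal.Quotient.mk pB.ideal x) ⊗ₜ[HF]
        Ideal.Quotient.mk pB.ideal y) =
        toRight 𝓒.etaR (Ideal.Quotient.mk pC.ideal x) ⊗ₜ[HF] Ideal.Quotient.mk pB.ideal y :=
      rlMap_tmul ..
    have e₃ : AStar.psi c.2.tauReduced s.1.2.tauReduced (toRight AStar.etaR x ⊗ₜ[HF] y) =
        AStar.chi c c.2.tauReduced x * AStar.chi s.1 s.1.2.tauReduced y := rfl
    -- The `s`-coordinate `h` of `y` crosses the tensor sign as `η_R(h)` acting on `x`, and `chi`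
    -- sees this as multiplication by `rho h`.
    rw [e₁, e₂, e₃, ← rho_redBasis_repr hB freeB y s.1, mul_comm, ← AStar.chi_etaR_mul,
      ← rho_redBasis_repr hC freeC]
    exact congrArg (fun v => HF.rho ((redBasis hC freeC).repr v c))
      (Extended.finsuppEquiv_tmul (𝓒 := 𝓒) (Ideal.Quotient.mk pC.ideal x)
        (genProj hB freeB (Ideal.Quotient.mk pB.ideal y)) s)

/-- Matching the two monomial bases through the splitting makes the comodule map an endomorphism `id
+ E` of `B`, with `E` locally nilpotent by unitriangularity of the coproduct. -/
theorem bijective_toSum (freeC : IsGradedFree HF (quotDeg AStar.deg pC.ideal)) :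
    Function.Bijective (toSum hle hB hC freeB) := by
  let bB := redBasis hB freeB
  let bX : Module.Basis pB.Reduced HF (pB.CofreeGen pC →₀ AStar ⧸ pC.ideal) :=
    (Finsupp.basis fun _ => redBasis hC freeC).reindex (splitEquiv hle)
  -- This sends `m_c` in the copy of `C` indexed by `s` to the monomial `m_c m_s`. It is merely
  -- `H`-linear and serves only for comparison.
  let Θ : (pB.CofreeGen pC →₀ AStar ⧸ pC.ideal) ≃ₗ[HF] (AStar ⧸ pB.ideal) :=
    bX.equiv bB (Equiv.refl _)
  let φ := toSum hle hB hC freeB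
  let E : (AStar ⧸ pB.ideal) →ₗ[HF] (AStar ⧸ pB.ideal) := Θ.toLinearMap ∘ₗ φ - LinearMap.id
  have hrepr : ∀ e t, bB.repr (E (bB e)) (splitEquiv hle t) =
      (redBasis hC freeC).repr (φ (bB e) t.1) t.2 - Finsupp.single e 1 (splitEquiv hle t) := by
    intro e t
    have h₁ : ∀ y, bB.repr (Θ y) = bX.repr y := by
      intro y
      have : bB.repr.toLinearMap ∘ₗ Θ.toLinearMap = bX.repr.toLinearMap := bX.ext fun i => by
        simp only [LinearMap.comp_apply, LinearEquiv.coe_coe, Θ, Module.Basis.equiv_apply,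
          Equiv.refl_apply, Module.Basis.repr_self]
      exact LinearMap.congr_fun this y
    change bB.repr (Θ (φ (bB e)) - bB e) (splitEquiv hle t) = _
    rw [map_sub, h₁, bB.repr_self, Finsupp.sub_apply]
    congr 1
    rw [Module.Basis.repr_reindex_apply, Equiv.symm_apply_apply, Finsupp.basis_repr]
  have hE : ∀ v, ∃ n, (E ^ n) v = 0 := by
    refine AStar.exists_pow_apply_eq_zero_of_repr (fun t : pB.Reduced => t.1) bB ?_ ?_
    · intro e t
      obtain ⟨t, rfl⟩ := (splitEquiv hle).surjective t
      rw [hrepr]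
      refine sub_mem ?_ ?_
      -- The copy of `C` indexed by `s` is shifted by the degree of `m_s`, so the entry at `(s, c)`
      -- has degree `|e| - |s| - |c|`, as required since `|m_c m_s| = |c| + |s|`.
      · have := redBasis_repr_mem hC freeC (toSum_mem hle hB hC freeB
          (by rw [redBasis_apply]; exact redMono_mem e : bB e ∈ _) t.1) t.2
        rw [sub_sub] at this
        rwa [show AStar.monoDeg (splitEquiv hle t).1 = AStar.monoDeg t.1.1.1 + AStar.monoDeg t.2.1
          from (map_add AStar.monoDeg t.2.1 t.1.1.1).trans (add_comm _ _)]
      · classical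
        rw [Finsupp.single_apply]
        split_ifs with h
        · rw [h, sub_self]
          exact HF.isGrading_deg.one_mem
        · exact zero_mem _
    -- By contraposition: where the polynomial degree does not rise, the matrix of the comodule map
    -- agrees with the identity modulo the augmentation ideal, so the entry of `E` vanishes under
    -- `rho`.
    · intro e t h
      by_contra hlt
      apply h
      obtain ⟨t, rfl⟩ := (splitEquiv hle).surjective t
      obtain ⟨e, rfl⟩ := (splitEquiv hle).surjective e
      rw [hrepr, map_sub]
      have hb : bB (splitEquiv hle e) =
          Ideal.Quotient.mk pB.ideal (AStar.mono (e.2.1 + e.1.1.1)) := redBasis_apply ..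
      rw [hb, rho_repr_toSum hle hB hC freeB freeC]
      have hdeg : t.2.1.degree + t.1.1.1.degree ≤ e.2.1.degree + e.1.1.1.degree := by
        rw [not_lt] at hlt
        change (t.2.1 + t.1.1.1).degree ≤ (e.2.1 + e.1.1.1).degree at hlt
        rwa [map_add, map_add] at hlt
      classical
      rw [psi_comul_mono t.2.2 t.1.2 t.1.1.2.tauReduced e.2.2 e.1.2 hdeg, Finsupp.single_apply]
      by_cases het : e = t
      · subst het; simp
      · rw [if_neg (fun h => het ((splitEquiv hle).injective h)), if_neg, map_zero, sub_zero]
        rintro ⟨h₁, h₂⟩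
        obtain ⟨⟨⟨s, hs⟩, hs'⟩, ⟨c, hc⟩⟩ := e
        obtain ⟨⟨⟨s₁, hs₁⟩, hs₁'⟩, ⟨c₁, hc₁⟩⟩ := t
        simp only at h₁ h₂
        subst h₁ h₂
        exact het rfl
  have hid : (LinearMap.id + E : _ →ₗ[HF] _) = Θ.toLinearMap ∘ₗ φ := add_sub_cancel _ _
  have := bijective_id_add hE
  rw [hid, LinearMap.coe_comp] at this
  exact (Function.Bijective.of_comp_iff' Θ.bijective _).1 this

theorem isCofree_proj (freeB : IsGradedFree HF (quotDeg AStar.deg pB.ideal))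
    (freeC : IsGradedFree HF (quotDeg AStar.deg pC.ideal)) :
    (proj hle hB hC).comodule.IsCofree (quotDeg AStar.deg pB.ideal) := by
  refine (proj hle hB hC).isCofree_of_bijective (fun s : pB.CofreeGen pC => AStar.monoDeg s.1.1)
    (genProj hB freeB) (fun _ _ h => genProj_mem hB freeB h) ?_
  have := bijective_toSum hle hB hC freeB freeC
  rw [toSum, LinearMap.coe_comp] at this
  exact (Function.Bijective.of_comp_iff' (LinearEquiv.bijective _) _).1 this

end Cofree

end ProfileFunction

end EquivariantSteenrod

end

/-! ### Cofreeness of `B` over `C`. -/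

theorem mainTheorem3 (pB pC : EquivariantSteenrod.ProfileFunction) (hle : pC ≤ pB)
    (hB : EquivariantSteenrod.AStar.hopfAlgebroid.IsHopfIdeal pB.ideal)
    (hC : EquivariantSteenrod.AStar.hopfAlgebroid.IsHopfIdeal pC.ideal)
    (freeB : EquivariantSteenrod.IsGradedFree EquivariantSteenrod.HF
      (EquivariantSteenrod.quotDeg EquivariantSteenrod.AStar.deg pB.ideal))
    (freeC : EquivariantSteenrod.IsGradedFree EquivariantSteenrod.HF
      (EquivariantSteenrod.quotDeg EquivariantSteenrod.AStar.deg pC.ideal)) :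
    ∃ f : (EquivariantSteenrod.AStar.hopfAlgebroid.quotient pB.ideal hB).Hom
        (EquivariantSteenrod.AStar.hopfAlgebroid.quotient pC.ideal hC),
      (∀ x : EquivariantSteenrod.AStar,
        f.toAlgHom (Ideal.Quotient.mk pB.ideal x) = Ideal.Quotient.mk pC.ideal x) ∧
      Function.Surjective f.toAlgHom ∧
      f.comodule.IsCofree (EquivariantSteenrod.quotDeg EquivariantSteenrod.AStar.deg pB.ideal) := by
  refine ⟨EquivariantSteenrod.ProfileFunction.proj hle hB hC,
    EquivariantSteenrod.AStar.hopfAlgebroid.factorHom_mk hB hC _, fun y => ?_,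
    EquivariantSteenrod.ProfileFunction.isCofree_proj hle hB hC freeB freeC⟩
  obtain ⟨x, rfl⟩ := Ideal.Quotient.mk_surjective y
  exact ⟨Ideal.Quotient.mk pB.ideal x, rfl⟩
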